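/- **Setting.** Let $H$ be a real separable Hilbert space, $A:D(A)\subset H\to H$ self-adjoint and negative definite with $(-A)^{-1+\delta}$ of trace class for some $\delta\in(0,1)$, and let $(e_k)$ be an orthonormal basis of $H$ with $Ae_k=-\lambda_k e_k$, $\lambda_k>0$ (so $\sum_k\lambda_k^{-1+\delta}<\infty$). Functions of $-A$ are taken in this basis; in particular $D((-A)^\varepsilon)=\{x:\sum_k\lambda_k^{2\varepsilon}\langle x,e_k\rangle^2<\infty\}$. Let $N(m,S)$ be the Gaussian measure on $H$ with mean $m$ and covariance operator $S$. Put $$R_t\varphi(x)=\int_H\varphi(y)\,N(e^{tA}x,Q_t)(dy),\qquad Q_t=-\tfrac12A^{-1}(I-e^{2tA}),\qquad \mu=N(0,-\tfrac12A^{-1}),$$ for real- or $H$-valued $\varphi$ (Bochner integral), and let $L_2$ be the generator of $R_t$ in $L^2(H,\mu)$. $C^1_b(E,F)$ is the space of bounded, continuously Fréchet differentiable functions $E\to F$ with bounded derivative; $C_b(H,H)$ is the space of bounded continuous functions. For $\varphi\in D(L_2)$, $D\varphi\in L^2(H,\mu;H)$ is its gradient in the Sobolev space $W^{1,2}(H,\mu)$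 (the closure in $L^2(H,\mu)\times L^2(H,\mu;H)$ of the gradient on $C^1_b(H,\mathbb R)$). For $u\in C^1_b(H,H)$ the operator $(-A)^\varepsilon D$ acts on the coordinates $u_k=\langle u,e_k\rangle$, that is, when all $Du_k(x)\in D((-A)^\varepsilon)$, $$(-A)^\varepsilon Du(x)[h]:=\sum_{k}\langle(-A)^\varepsilon Du_k(x),h\rangle\,e_k .$$ **Lemma.** Let $M\in\mathbb R$. There are $\tilde\lambda>0$, $c_3>0$ depending only on $A$ and $M$, and constants $C_{\varepsilon,\lambda}$ depending only on $\varepsilon,\lambda,A,M$, such that for every bounded Borel $B:H\to H$ with $\|B\|_0=\operatorname{ess\,sup}_\mu|B|\le M$ and every $\lambda\ge\tilde\lambda$ there is a unique $u=u_\lambda\in C^1_b(H,H)$ with $$u(x)=\int_0^\infty e^{-\lambda t}R_t\big(Du(\cdot)B(\cdot)+B(\cdot)\big)(x)\,dt,\qquad x\in H,$$ the integrand being Bochner integrable on $(0,\infty)$ for every $x$. Moreover: (i) for every $\varepsilon\in[0,1/2)$: $D\langle u,e_k\rangle(x)\in D((-A)^\varepsilon)$ for all $x\in H$ and all $k$,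 and for every $h\in H$ the series defining $(-A)^\varepsilon Du(x)[h]$ converges for all $x$, $(-A)^\varepsilon Du(\cdot)[h]\in C_b(H,H)$, and $\sup_{x\in H}|(-A)^\varepsilon Du(x)[h]|\le C_{\varepsilon,\lambda}|h|$; (ii) for every $k$, $\langle u(\cdot),e_k\rangle=u^{(k)}$ $\mu$-a.e., where $u^{(k)}$ is the unique solution in $D(L_2)$ of $$\lambda u^{(k)}-L_2u^{(k)}-\langle B,Du^{(k)}\rangle=\langle B,e_k\rangle\qquad\mu\text{-a.e.}$$ (existence and uniqueness of this solution are part of the claim); (iii) $\|Du(x)\|_{\mathcal L(H)}\le c_3/\sqrt\lambda$ for all $x\in H$. -/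

import Mathlib

open MeasureTheory ProbabilityTheory Filter Topology
open scoped NNReal ENNReal

noncomputable section

namespace OUDrift

variable {H : Type*} [NormedAddCommGroup H] [InnerProductSpace ℝ H]
variable {ι : Type*}

/-- `u ∈ C¹_b(E, F)`: bounded, continuously Fréchet differentiable, with bounded derivative. -/
structure IsC1b {E F : Type*} [NormedAddCommGroup E] [NormedSpace ℝ E]
    [NormedAddCommGroup F] [NormedSpace ℝ F] (u : E → F) : Prop where
  contDiff : ContDiff ℝ 1 u
  bounded : ∃ K : ℝ, ∀ x, ‖u x‖ ≤ K
  bounded_fderiv : ∃ K : ℝ, ∀ x, ‖fderiv ℝ u x‖ ≤ K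

/-! ### The operator `A`, its semigroup and its fractional powers -/

/-- `A` is self-adjoint and negative definite, `(e k)` is an orthonormal basis with
`A (e k) = - eig k • e k`, and `(-A)^(-1+δ)`, the positive operator which multiplies `e k` by
`eig k ^ (-1+δ)`, has finite trace. -/
structure StandingAssumption [CompleteSpace H] (A : H →ₗ.[ℝ] H) (e : HilbertBasis ι ℝ H)
    (eig : ι → ℝ) (δ : ℝ) : Prop where
  selfAdjoint : IsSelfAdjoint A
  negDef : ∀ x : A.domain, x ≠ 0 → inner ℝ (A x) (x : H) < 0
  eigen : ∀ k, (e k, -eig k • e k) ∈ A.graph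
  delta_pos : 0 < δ
  delta_lt_one : δ < 1
  traceClass : Summable fun k => eig k ^ (-1 + δ)

/-- The semigroup `e^{tA}`. -/
def semigroup (e : HilbertBasis ι ℝ H) (eig : ι → ℝ) (t : ℝ) (x : H) : H :=
  ∑' k, (Real.exp (-(eig k * t)) * inner ℝ (e k) x) • e k

/-- The domain of the fractional power `(-A)^s`. -/
def powDomain (e : HilbertBasis ι ℝ H) (eig : ι → ℝ) (s : ℝ) : Set H :=
  {x | Summable fun k => (eig k ^ s * inner ℝ (e k) x) ^ 2}

/-- The fractional power `(-A)^s` (meaningful on `powDomain e eig s`). -/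
def negPow (e : HilbertBasis ι ℝ H) (eig : ι → ℝ) (s : ℝ) (x : H) : H :=
  ∑' k, (eig k ^ s * inner ℝ (e k) x) • e k

/-! ### Gaussian measures and the Ornstein-Uhlenbeck semigroup -/

section Gauss

variable [MeasurableSpace H]

/-- The Gaussian measure on `H` with mean `m` and covariance operator `e k ↦ q k • e k`
(with `∑ q k < ∞`): the law of `∑ k, y k • e k`, where the coordinates `y k` are independent
real Gaussian variables with mean `⟨m, e k⟩` and variance `q k`. -/
def gaussianMeasure (e : HilbertBasis ι ℝ H) (m : H) (q : ι → ℝ≥0) : Measure H :=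
  (Measure.infinitePi fun k => gaussianReal (inner ℝ (e k) m) (q k)).map
    fun y : ι → ℝ => ∑' k, y k • e k

/-- `N(e^{tA} x, Q_t)`, where `Q_t = -(1/2) A⁻¹ (I - e^{2tA})`. -/
def transition (e : HilbertBasis ι ℝ H) (eig : ι → ℝ) (t : ℝ) (x : H) : Measure H :=
  gaussianMeasure e (semigroup e eig t x)
    fun k => Real.toNNReal ((1 - Real.exp (-(2 * eig k * t))) / (2 * eig k))

/-- The invariant measure `μ = N(0, Q)`, where `Q = -(1/2) A⁻¹`. -/
def invMeasure (e : HilbertBasis ι ℝ H) (eig : ι → ℝ) : Measure H :=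
  gaussianMeasure e 0 fun k => Real.toNNReal (1 / (2 * eig k))

/-- The Ornstein-Uhlenbeck semigroup `R_t`, on functions with values in a normed space. On
(representatives of) elements of `L²(H, μ)` the same formula gives the extension of `R_t`
to `L²(H, μ)`. -/
def ou {F : Type*} [NormedAddCommGroup F] [NormedSpace ℝ F] (e : HilbertBasis ι ℝ H)
    (eig : ι → ℝ) (t : ℝ) (φ : H → F) (x : H) : F :=
  ∫ y, φ y ∂(transition e eig t x)

/-- `φ` belongs to the domain of the generator `L₂` of `R_t` in `L²(H, μ)`, and `L₂ φ = ψ`. -/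
structure IsGeneratorValue (e : HilbertBasis ι ℝ H) (eig : ι → ℝ) (φ ψ : H → ℝ) : Prop where
  memLp : MemLp φ 2 (invMeasure e eig)
  memLp_value : MemLp ψ 2 (invMeasure e eig)
  tendsto : Tendsto
    (fun t : ℝ => eLpNorm (fun x => t⁻¹ * (ou e eig t φ x - φ x) - ψ x) 2 (invMeasure e eig))
    (𝓝[>] 0) (𝓝 0)

/-- `φ ∈ W^{1,2}(H, μ)` with Sobolev gradient `G`: the pair `(φ, G)` is the limit in
`L²(H, μ) × L²(H, μ; H)` of pairs `(φₙ, Dφₙ)` with `φₙ ∈ C¹_b(H)`. -/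
structure IsSobolevGradient [CompleteSpace H] (e : HilbertBasis ι ℝ H) (eig : ι → ℝ)
    (φ : H → ℝ) (G : H → H) : Prop where
  memLp : MemLp φ 2 (invMeasure e eig)
  memLp_grad : MemLp G 2 (invMeasure e eig)
  approx : ∃ φn : ℕ → H → ℝ, (∀ n, IsC1b (φn n)) ∧
    Tendsto (fun n => eLpNorm (fun x => φn n x - φ x) 2 (invMeasure e eig)) atTop (𝓝 0) ∧
    Tendsto (fun n => eLpNorm (fun x => gradient (φn n) x - G x) 2 (invMeasure e eig))
      atTop (𝓝 0)

/-- `v ∈ D(L₂)` solves the Kolmogorov equation `lam v - L₂ v - ⟨B, D v⟩ = f`, `μ`-a.e. -/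
def IsKolmogorovSolution [CompleteSpace H] (e : HilbertBasis ι ℝ H) (eig : ι → ℝ)
    (lam : ℝ) (B : H → H) (f v : H → ℝ) : Prop :=
  ∃ (Lv : H → ℝ) (G : H → H), IsGeneratorValue e eig v Lv ∧ IsSobolevGradient e eig v G ∧
    ∀ᵐ x ∂(invMeasure e eig), lam * v x - Lv x - inner ℝ (B x) (G x) = f x

/-- The integrand `t ↦ e^{-lam t} R_t (Du B + B)(x)`. -/
def mildIntegrand (e : HilbertBasis ι ℝ H) (eig : ι → ℝ) (lam : ℝ) (B u : H → H) (x : H)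
    (t : ℝ) : H :=
  Real.exp (-(lam * t)) • ou e eig t (fun y => fderiv ℝ u y (B y) + B y) x

/-- `u(x) = ∫₀^∞ e^{-lam t} R_t (Du B + B)(x) dt` for all `x`. -/
def IsMildFixedPoint (e : HilbertBasis ι ℝ H) (eig : ι → ℝ) (lam : ℝ) (B u : H → H) : Prop :=
  ∀ x, u x = ∫ t in Set.Ioi (0 : ℝ), mildIntegrand e eig lam B u x t

end Gauss

/-! ### The operator `(-A)^ε D` on `H`-valued functions -/

/-- The vector `(-A)^s D φ(x)` for a coordinate `φ = ⟨u, e k⟩` of `u`. -/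
def powGrad [CompleteSpace H] (e : HilbertBasis ι ℝ H) (eig : ι → ℝ) (s : ℝ) (u : H → H)
    (x : H) (k : ι) : H :=
  negPow e eig s (gradient (fun y => inner ℝ (u y) (e k)) x)

/-- `(-A)^s D u(x)[h] = ∑ k, ⟨(-A)^s D⟨u, e k⟩(x), h⟩ e k`: the operator `(-A)^s D` acts on the
coordinates of `u`. -/
def powDeriv [CompleteSpace H] (e : HilbertBasis ι ℝ H) (eig : ι → ℝ) (s : ℝ) (u : H → H)
    (x h : H) : H :=
  ∑' k, inner ℝ (powGrad e eig s u x k) h • e k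

end OUDrift

end

/-! All Gaussian measures here are images of one product of standard Gaussians, `gaussianProd`. The
vector `ouPoint e eig t x` has law N(e^{tA}x, Q_t), and moving x by z moves the noise ξ by b =
Q_t^{-1/2}e^{tA}z, with ‖b‖ ≤ t^{-1/2}‖z‖ (`ouPoint_add`, `smoothing_le`). By Cameron–Martin this
shift has an L² density ρ with ‖ρ - 1‖² = e^{‖b‖²} - 1 and ‖ρ - 1 - W(b)‖² = e^{‖b‖²} - 1 - ‖b‖², W
being `whiteNoise`. Hence R_t g is differentiable for g merely bounded and measurable, with
derivative of size t^{-1/2}, or t^{-1/2-ε} after applying (-A)^ε. Both are integrable at 0 for ε <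
1/2, so the resolvent maps bounded functions into C¹_b with gradient at most √(π/λ) times the sup
norm (`hasFDerivAt_resolvent`, `norm_resGradL_le`).

For large λ the map V ↦ D(resolvent of VB + B) is therefore a contraction of C_b(H, L(H)). Its fixed
point is Du, and u is the resolvent of Du·B + B (`exists_eq_resolvent`); (i) and (iii) are the
resolvent bounds for that function. Values of B on a μ-null set do not matter, because transition
laws at positive times are absolutely continuous with respect to μ.

For (ii), the resolvent of a bounded f lies in D(L₂) and L₂ maps it to λ times itself minus f
(`isGeneratorValue_resolvent`), which gives existence. Uniqueness is an energy estimate. Bessel's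
inequality along 1 and the coordinates ξ_k, integrated against the invariant μ and combined with
Gaussian integration by parts, bounds ‖R_tφ‖² plus the sum of q_k(t)‖R_t D_kφ‖² by ‖φ‖², with q_k(t)
the eigenvalues of Q_t. Dividing by t and letting t → 0 yields ‖Dφ‖² ≤ -2⟨L₂φ, φ⟩
(`sum_norm_sq_le_energy`), which absorbs the drift term as soon as λ > M²/2
(`IsKolmogorovSolution.ae_eq`). -/

noncomputable section

namespace OUDrift

/-! ### The standard Gaussian product measure -/

section GaussianProd

/-- The law of a family of independent standard real Gaussian variables. -/
def gaussianProd (ι : Type*) : Measure (ι → ℝ) :=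
  Measure.infinitePi fun _ => gaussianReal 0 1

instance (ι : Type*) : IsProbabilityMeasure (gaussianProd ι) := by
  unfold gaussianProd; infer_instance

variable {ι : Type*}

lemma gaussianProd_map_eval (k : ι) :
    (gaussianProd ι).map (fun ξ => ξ k) = gaussianReal 0 1 :=
  Measure.infinitePi_map_eval _ k

lemma memLp_coord (k : ι) (p : ℝ≥0) : MemLp (fun ξ : ι → ℝ => ξ k) p (gaussianProd ι) := by
  have h : MemLp id (p : ℝ≥0∞) ((gaussianProd ι).map (fun ξ => ξ k)) := by
    rw [gaussianProd_map_eval]; exact memLp_id_gaussianReal p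
  exact h.comp_of_map (measurable_pi_apply k).aemeasurable

lemma memLp_coord_two (k : ι) : MemLp (fun ξ : ι → ℝ => ξ k) 2 (gaussianProd ι) :=
  memLp_coord k 2

lemma integral_coord (k : ι) : ∫ ξ, ξ k ∂(gaussianProd ι) = 0 := by
  have h := integral_map (μ := gaussianProd ι) (φ := fun ξ => ξ k) (f := fun x : ℝ => x)
    (measurable_pi_apply k).aemeasurable (by fun_prop)
  rw [gaussianProd_map_eval] at h
  rw [← h]; exact integral_id_gaussianReal

lemma integral_coord_sq (k : ι) : ∫ ξ, ξ k * ξ k ∂(gaussianProd ι) = 1 := by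
  have h := integral_map (μ := gaussianProd ι) (φ := fun ξ => ξ k) (f := fun x : ℝ => x * x)
    (measurable_pi_apply k).aemeasurable (by fun_prop)
  rw [gaussianProd_map_eval] at h
  rw [← h]
  have hv := variance_id_gaussianReal (μ := 0) (v := 1)
  rw [variance_of_integral_eq_zero (by fun_prop) (by simp)] at hv
  simpa [sq] using hv

lemma iIndepFun_coord : iIndepFun (fun k (ξ : ι → ℝ) => ξ k) (gaussianProd ι) :=
  iIndepFun_infinitePi (X := fun _ x => x) (fun _ => measurable_id)

lemma integral_coord_mul {j k : ι} (hjk : j ≠ k) :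
    ∫ ξ, ξ j * ξ k ∂(gaussianProd ι) = 0 := by
  have h := (iIndepFun_coord.indepFun hjk).integral_fun_mul_eq_mul_integral
    (memLp_coord_two j).1 (memLp_coord_two k).1
  rw [h, integral_coord, zero_mul]

/-- The family formed by the constant `1` and the coordinates. -/
def chaosFun : Option ι → (ι → ℝ) → ℝ
  | none => fun _ => 1
  | some k => fun ξ => ξ k

lemma memLp_chaosFun (j : Option ι) : MemLp (chaosFun j) 2 (gaussianProd ι) := by
  cases j with
  | none => exact memLp_const 1
  | some k => exact memLp_coord_two k

lemma integral_chaosFun_mul [DecidableEq ι] (i j : Option ι) :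
    ∫ ξ, chaosFun i ξ * chaosFun j ξ ∂(gaussianProd ι) = if i = j then 1 else 0 := by
  cases i with
  | none =>
    cases j with
    | none => simp [chaosFun]
    | some k => simp [chaosFun, integral_coord]
  | some i =>
    cases j with
    | none => simp [chaosFun, integral_coord]
    | some j =>
      by_cases h : i = j
      · subst h; simp [chaosFun, integral_coord_sq]
      · simp [chaosFun, h, integral_coord_mul h]

/-- `chaosFun` in `L²`. -/
def chaos (j : Option ι) : Lp ℝ 2 (gaussianProd ι) := (memLp_chaosFun j).toLp

/-- The coordinates are independent, centred and of variance one. Including the constant 1 in the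
family is what later lets a single Bessel inequality control the semigroup and the gradient
together. -/
lemma orthonormal_chaos : Orthonormal ℝ (chaos (ι := ι)) := by
  classical
  rw [orthonormal_iff_ite]
  intro i j
  rw [← integral_chaosFun_mul i j, L2.inner_def]
  refine integral_congr_ae ?_
  filter_upwards [(memLp_chaosFun i).coeFn_toLp, (memLp_chaosFun j).coeFn_toLp] with ξ h1 h2
  simp only [chaos, h1, h2]
  simp [mul_comm]

lemma orthonormal_coord : Orthonormal ℝ (fun k : ι => chaos (some k)) :=
  orthonormal_chaos.comp _ (Option.some_injective ι)

variable {H : Type*} [NormedAddCommGroup H] [InnerProductSpace ℝ H]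

/-- The isonormal Gaussian process: `h ↦ ∑ k, ⟨h, e k⟩ ξ k` in `L²`. -/
def whiteNoise (e : HilbertBasis ι ℝ H) : H →ₗᵢ[ℝ] Lp ℝ 2 (gaussianProd ι) :=
  (orthonormal_coord (ι := ι)).orthogonalFamily.linearIsometry.comp
    e.repr.toLinearIsometry

lemma hasSum_whiteNoise (e : HilbertBasis ι ℝ H) (a : H) :
    HasSum (fun k => inner ℝ (e k) a • chaos (some k)) (whiteNoise e a) := by
  have := (orthonormal_coord (ι := ι)).orthogonalFamily.hasSum_linearIsometry (e.repr a)
  simpa [whiteNoise, e.repr_apply_apply] using this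

lemma whiteNoise_basis (e : HilbertBasis ι ℝ H) (k : ι) :
    whiteNoise e (e k) = chaos (some k) := by
  classical
  refine (hasSum_whiteNoise e (e k)).unique ?_
  convert! hasSum_ite_eq k (chaos (some k)) using 2 with j
  rw [orthonormal_iff_ite.1 e.orthonormal]
  split_ifs <;> simp_all

lemma inner_one_whiteNoise (e : HilbertBasis ι ℝ H) (a : H) :
    inner ℝ (chaos none) (whiteNoise e a) = 0 := by
  have h := (hasSum_whiteNoise e a).mapL (innerSL ℝ (chaos (ι := ι) none))
  have h0 : ∀ k : ι, innerSL ℝ (chaos none) (inner ℝ (e k) a • chaos (some k)) = 0 := by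
    intro k
    rw [map_smul, innerSL_apply_apply, orthonormal_chaos.2 (by simp), smul_zero]
  simp only [h0] at h
  exact h.unique hasSum_zero

lemma norm_chaos (j : Option ι) : ‖chaos j‖ = 1 := orthonormal_chaos.1 j

end GaussianProd

/-! ### Pairing square integrable functions -/

lemma memLp_of_bound {Ω E : Type*} [MeasurableSpace Ω] [NormedAddCommGroup E] {μ : Measure Ω}
    [IsFiniteMeasure μ] {F : Ω → E} {K : ℝ} (hF : AEStronglyMeasurable F μ)
    (hK : ∀ ω, ‖F ω‖ ≤ K) (p : ℝ≥0∞) : MemLp F p μ :=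
  MemLp.of_bound hF K (ae_of_all _ hK)

section Pairing

variable {Ω : Type*} [MeasurableSpace Ω] {μ : Measure Ω}
  {E : Type*} [NormedAddCommGroup E] [NormedSpace ℝ E]

lemma integrable_smul_of_memLp_two {f : Ω → ℝ} {F : Ω → E} (hf : MemLp f 2 μ)
    (hF : MemLp F 2 μ) : Integrable (fun ω => f ω • F ω) μ :=
  memLp_one_iff_integrable.1 (hF.smul hf)

lemma norm_integral_smul_le {f : Ω → ℝ} {F : Ω → E} (hf : MemLp f 2 μ) (hF : MemLp F 2 μ) :
    ‖∫ ω, f ω • F ω ∂μ‖ ≤ (eLpNorm f 2 μ).toReal * (eLpNorm F 2 μ).toReal := by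
  rw [← ENNReal.toReal_mul, ← toReal_enorm]
  refine ENNReal.toReal_mono (ENNReal.mul_ne_top hf.2.ne hF.2.ne) ?_
  refine (enorm_integral_le_lintegral_enorm _).trans ?_
  rw [← eLpNorm_one_eq_lintegral_enorm]
  exact eLpNorm_smul_le_mul_eLpNorm hF.1 hf.1

/-- The continuous linear map `f ↦ ∫ f F`. -/
def pairing (F : Ω → E) (hF : MemLp F 2 μ) : Lp ℝ 2 μ →L[ℝ] E :=
  LinearMap.mkContinuous
    { toFun := fun f => ∫ ω, f ω • F ω ∂μ
      map_add' := fun f g => by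
        rw [← integral_add (integrable_smul_of_memLp_two (Lp.memLp f) hF)
          (integrable_smul_of_memLp_two (Lp.memLp g) hF)]
        refine integral_congr_ae ?_
        filter_upwards [Lp.coeFn_add f g] with ω h
        rw [h, Pi.add_apply, add_smul]
      map_smul' := fun c f => by
        rw [RingHom.id_apply, ← integral_smul]
        refine integral_congr_ae ?_
        filter_upwards [Lp.coeFn_smul c f] with ω h
        rw [h, Pi.smul_apply, smul_eq_mul, mul_smul] }
    (eLpNorm F 2 μ).toReal fun f => by
      rw [mul_comm]
      exact norm_integral_smul_le (Lp.memLp f) hF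

lemma pairing_apply (F : Ω → E) (hF : MemLp F 2 μ) (f : Lp ℝ 2 μ) :
    pairing F hF f = ∫ ω, f ω • F ω ∂μ := rfl

lemma pairing_toLp (F : Ω → E) (hF : MemLp F 2 μ) {f : Ω → ℝ} (hf : MemLp f 2 μ) :
    pairing F hF hf.toLp = ∫ ω, f ω • F ω ∂μ := by
  rw [pairing_apply]
  refine integral_congr_ae ?_
  filter_upwards [hf.coeFn_toLp] with ω h
  rw [h]

lemma norm_pairing_le [IsProbabilityMeasure μ] {F : Ω → E} (hF : MemLp F 2 μ) {K : ℝ}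
    (hK : ∀ ω, ‖F ω‖ ≤ K) (f : Lp ℝ 2 μ) : ‖pairing F hF f‖ ≤ K * ‖f‖ := by
  have hK0 : 0 ≤ K := by
    obtain ⟨ω⟩ := μ.nonempty_of_neZero
    exact (norm_nonneg _).trans (hK ω)
  have h := norm_integral_smul_le (Lp.memLp f) hF
  rw [mul_comm] at h
  rw [pairing_apply]
  refine h.trans ?_
  rw [Lp.norm_def]
  gcongr
  refine ENNReal.toReal_le_of_le_ofReal hK0 ?_
  simpa using eLpNorm_le_of_ae_bound (p := 2) (μ := μ) (ae_of_all _ hK)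

end Pairing

/-! ### Translations of the standard Gaussian product measure -/

section Shift

/-- One-dimensional Cameron–Martin, by completing the square: -(x - b)²/2 = -x²/2 + (bx - b²/2). -/
lemma gaussianReal_eq_withDensity (b : ℝ) :
    gaussianReal b 1 =
      (gaussianReal 0 1).withDensity fun x => ENNReal.ofReal (Real.exp (b * x - b ^ 2 / 2)) := by
  rw [gaussianReal_of_var_ne_zero _ one_ne_zero, gaussianReal_of_var_ne_zero _ one_ne_zero,
    ← withDensity_mul _ (measurable_gaussianPDF _ _) (by fun_prop)]
  congr 1
  ext x
  simp only [Pi.mul_apply, gaussianPDF, gaussianPDFReal]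
  rw [← ENNReal.ofReal_mul (by positivity)]
  congr 1
  rw [mul_assoc _ (Real.exp _) (Real.exp _), ← Real.exp_add]
  congr 2
  simp only [NNReal.coe_one]
  ring

variable {ι : Type*}

open Classical in
/-- `b` on `s`, and `0` elsewhere. -/
def cutoff (s : Finset ι) (b : ι → ℝ) (k : ι) : ℝ := if k ∈ s then b k else 0

/-- The density of the law of `ξ + b`, for the part of `b` supported in `s`. -/
def expDensity (s : Finset ι) (b : ι → ℝ) (ξ : ι → ℝ) : ℝ :=
  Real.exp (∑ k ∈ s, (b k * ξ k - b k ^ 2 / 2))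

@[fun_prop]
lemma measurable_expDensity (s : Finset ι) (b : ι → ℝ) : Measurable (expDensity s b) := by
  unfold expDensity; fun_prop

/-- A measure on the product is determined by boxes. On a box the integrand is a product of
functions of single coordinates, so independence reduces the claim to the one-dimensional formula.
-/
lemma map_add_cutoff (s : Finset ι) (b : ι → ℝ) :
    (gaussianProd ι).map (fun ξ k => ξ k + cutoff s b k) =
      (gaussianProd ι).withDensity fun ξ => ENNReal.ofReal (expDensity s b ξ) := by
  classical
  have h1 : (gaussianProd ι).map (fun ξ k => ξ k + cutoff s b k) =
      Measure.infinitePi fun k => gaussianReal (cutoff s b k) 1 := by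
    have := Measure.infinitePi_map_pi (fun _ : ι => gaussianReal 0 1)
      (f := fun k x => x + cutoff s b k) (fun k => by fun_prop)
    rw [gaussianProd, this]
    congr 1; ext1 k
    rw [gaussianReal_map_add_const, zero_add]
  rw [h1]
  symm
  refine Measure.eq_infinitePi _ fun s' t ht => ?_
  -- Each factor carries the side of the box when k ∈ s' and the one-dimensional density when k ∈ s;
  -- the product over s ∪ s' collects both.
  let G : ι → ℝ → ℝ≥0∞ := fun k x =>
    (if k ∈ s' then (t k).indicator 1 x else 1) *
      (if k ∈ s then ENNReal.ofReal (Real.exp (b k * x - b k ^ 2 / 2)) else 1)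
  have hG : ∀ k, Measurable (G k) := by
    intro k
    refine Measurable.mul ?_ ?_
    · split_ifs
      · exact measurable_one.indicator (ht k)
      · fun_prop
    · split_ifs <;> fun_prop
  have hbox : MeasurableSet (Set.pi (s' : Set ι) t) :=
    MeasurableSet.pi s'.countable_toSet fun k _ => ht k
  rw [withDensity_apply _ hbox, ← lintegral_indicator hbox]
  have h2 : ∀ ξ : ι → ℝ, (Set.pi (s' : Set ι) t).indicator
      (fun ξ => ENNReal.ofReal (expDensity s b ξ)) ξ = ∏ k ∈ s ∪ s', G k (ξ k) := by
    intro ξ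
    rw [Finset.prod_mul_distrib]
    have e1 : ∏ k ∈ s ∪ s', (if k ∈ s' then (t k).indicator (1 : ℝ → ℝ≥0∞) (ξ k) else 1) =
        (Set.pi (s' : Set ι) t).indicator 1 ξ := by
      rw [Finset.prod_ite_mem, Finset.inter_eq_right.2 Finset.subset_union_right]
      by_cases hξ : ξ ∈ Set.pi (s' : Set ι) t
      · rw [Set.indicator_of_mem hξ]
        exact Finset.prod_eq_one fun k hk => Set.indicator_of_mem (hξ k hk) _
      · rw [Set.indicator_of_notMem hξ]
        simp only [Set.mem_pi, Finset.mem_coe, not_forall] at hξ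
        obtain ⟨k, hk, hkt⟩ := hξ
        exact Finset.prod_eq_zero hk (Set.indicator_of_notMem hkt _)
    have e2 : ∏ k ∈ s ∪ s',
        (if k ∈ s then ENNReal.ofReal (Real.exp (b k * ξ k - b k ^ 2 / 2)) else 1) =
        ENNReal.ofReal (expDensity s b ξ) := by
      rw [Finset.prod_ite_mem, Finset.inter_eq_right.2 Finset.subset_union_left, expDensity,
        Real.exp_sum, ENNReal.ofReal_prod_of_nonneg fun k _ => (Real.exp_pos _).le]
    rw [e1, e2]
    by_cases hξ : ξ ∈ Set.pi (s' : Set ι) t <;> simp [hξ]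
  simp_rw [h2]
  have h3 : iIndepFun (fun k (ξ : ι → ℝ) => G k (ξ k)) (gaussianProd ι) :=
    iIndepFun_infinitePi (X := fun k x => G k x) hG
  rw [lintegral_prod_eq_prod_lintegral_of_indepFun _ _ h3
    fun k => (hG k).comp (measurable_pi_apply k)]
  have h4 : ∀ k, ∫⁻ ξ, G k (ξ k) ∂(gaussianProd ι) =
      if k ∈ s' then gaussianReal (cutoff s b k) 1 (t k) else 1 := by
    intro k
    have hm := lintegral_map (μ := gaussianProd ι) (hG k) (measurable_pi_apply k)
    rw [gaussianProd_map_eval] at hm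
    rw [← hm]
    have hc : gaussianReal (cutoff s b k) 1 = (gaussianReal 0 1).withDensity
        (fun x => if k ∈ s then ENNReal.ofReal (Real.exp (b k * x - b k ^ 2 / 2)) else 1) := by
      by_cases hk : k ∈ s
      · simp only [cutoff, hk, if_true]; exact gaussianReal_eq_withDensity _
      · simp only [cutoff, hk, if_false]; exact (withDensity_one).symm
    have key : ∀ u : Set ℝ, MeasurableSet u → gaussianReal (cutoff s b k) 1 u =
        ∫⁻ x, u.indicator 1 x * (if k ∈ s then
          ENNReal.ofReal (Real.exp (b k * x - b k ^ 2 / 2)) else 1) ∂(gaussianReal 0 1) := by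
      intro u hu
      rw [hc, withDensity_apply _ hu, ← lintegral_indicator hu]
      refine lintegral_congr fun x => ?_
      by_cases hx : x ∈ u <;> simp [hx]
    by_cases hk' : k ∈ s'
    · simp only [G, hk', if_true]; exact (key _ (ht k)).symm
    -- Outside s' the box imposes nothing, and the factor integrates to the total mass of a
    -- probability measure.
    · have := key Set.univ .univ
      simp only [measure_univ, Set.indicator_univ, Pi.one_apply] at this
      simp only [G, hk', if_false]; exact this.symm
  simp_rw [h4]
  rw [Finset.prod_ite_mem, Finset.inter_eq_right.2 Finset.subset_union_right]

lemma measurable_add_cutoff (s : Finset ι) (b : ι → ℝ) :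
    Measurable (fun (ξ : ι → ℝ) k => ξ k + cutoff s b k) := by fun_prop

lemma integrable_expDensity (s : Finset ι) (b : ι → ℝ) :
    Integrable (expDensity s b) (gaussianProd ι) := by
  have h : IsProbabilityMeasure
      ((gaussianProd ι).withDensity fun ξ => ENNReal.ofReal (expDensity s b ξ)) := by
    rw [← map_add_cutoff]
    exact Measure.isProbabilityMeasure_map (measurable_add_cutoff s b).aemeasurable
  refine ⟨(measurable_expDensity s b).aestronglyMeasurable, ?_⟩
  have h1 := h.measure_univ
  rw [withDensity_apply _ .univ, setLIntegral_univ] at h1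
  rw [hasFiniteIntegral_iff_ofReal (ae_of_all _ fun ξ => show 0 ≤ expDensity s b ξ from
    (Real.exp_pos _).le), h1]
  exact ENNReal.one_lt_top

variable {E : Type*} [NormedAddCommGroup E] [NormedSpace ℝ E]

lemma integral_add_cutoff (s : Finset ι) (b : ι → ℝ) {F : (ι → ℝ) → E}
    (hF : StronglyMeasurable F) :
    ∫ ξ, F (fun k => ξ k + cutoff s b k) ∂(gaussianProd ι) =
      ∫ ξ, expDensity s b ξ • F ξ ∂(gaussianProd ι) := by
  rw [← integral_map (φ := fun (ξ : ι → ℝ) k => ξ k + cutoff s b k) (f := F)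
    (measurable_add_cutoff s b).aemeasurable hF.aestronglyMeasurable, map_add_cutoff,
    integral_withDensity_eq_integral_toReal_smul (by fun_prop)
    (ae_of_all _ fun _ => ENNReal.ofReal_lt_top)]
  refine integral_congr_ae (ae_of_all _ fun ξ => ?_)
  simp only [ENNReal.toReal_ofReal (Real.exp_pos _).le, expDensity]

lemma integral_expDensity (s : Finset ι) (b : ι → ℝ) :
    ∫ ξ, expDensity s b ξ ∂(gaussianProd ι) = 1 := by
  have := integral_add_cutoff s b (F := fun _ => (1 : ℝ)) stronglyMeasurable_const
  simpa using this.symm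

/-- The square of the density for b is the density for 2b times the constant exp(∑ b_k²), hence
integrable. -/
lemma memLp_expDensity (s : Finset ι) (b : ι → ℝ) :
    MemLp (expDensity s b) 2 (gaussianProd ι) := by
  rw [memLp_two_iff_integrable_sq (measurable_expDensity s b).aestronglyMeasurable]
  have h := (integrable_expDensity s (fun k => 2 * b k)).const_mul
    (Real.exp (∑ k ∈ s, b k ^ 2))
  refine h.congr (ae_of_all _ fun ξ => ?_)
  simp only [expDensity]
  rw [← Real.exp_add, ← Finset.sum_add_distrib, sq, ← Real.exp_add, ← Finset.sum_add_distrib]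
  congr 1
  refine Finset.sum_congr rfl fun k _ => ?_
  ring

/-- The density `expDensity` in `L²`. -/
def expVec (s : Finset ι) (b : ι → ℝ) : Lp ℝ 2 (gaussianProd ι) := (memLp_expDensity s b).toLp

lemma pairing_expVec (s : Finset ι) (b : ι → ℝ) {F : (ι → ℝ) → E}
    (hF : StronglyMeasurable F) (hF2 : MemLp F 2 (gaussianProd ι)) :
    pairing F hF2 (expVec s b) = ∫ ξ, F (fun k => ξ k + cutoff s b k) ∂(gaussianProd ι) := by
  rw [expVec, pairing_toLp, integral_add_cutoff s b hF]

lemma inner_toLp {Ω : Type*} [MeasurableSpace Ω] {μ : Measure Ω} {f g : Ω → ℝ}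
    (hf : MemLp f 2 μ) (hg : MemLp g 2 μ) : inner ℝ hf.toLp hg.toLp = ∫ ω, f ω * g ω ∂μ := by
  rw [L2.inner_def]
  refine integral_congr_ae ?_
  filter_upwards [hf.coeFn_toLp, hg.coeFn_toLp] with ω h1 h2
  rw [h1, h2]; simp [mul_comm]

-- Shifting ξ by the part of b in s multiplies the density for s' by exp of the sum of b_k² over s ∩
-- s', and the density itself has integral 1. All later L² norms of densities come from this
-- identity.
open Classical in
lemma inner_expVec (s s' : Finset ι) (b : ι → ℝ) :
    inner ℝ (expVec s b) (expVec s' b) = Real.exp (∑ k ∈ s ∩ s', b k ^ 2) := by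
  have h := integral_add_cutoff s b (measurable_expDensity s' b).stronglyMeasurable
  rw [expVec, expVec, inner_toLp]
  simp only [smul_eq_mul] at h
  rw [← h]
  have h2 : ∀ ξ : ι → ℝ, expDensity s' b (fun k => ξ k + cutoff s b k) =
      Real.exp (∑ k ∈ s ∩ s', b k ^ 2) * expDensity s' b ξ := by
    intro ξ
    simp only [expDensity]
    rw [← Real.exp_add, Finset.inter_comm, ← Finset.sum_ite_mem, ← Finset.sum_add_distrib]
    congr 1
    refine Finset.sum_congr rfl fun k _ => ?_
    simp only [cutoff]
    split_ifs <;> ring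
  simp_rw [h2]
  rw [integral_const_mul, integral_expDensity, mul_one]

lemma inner_one_expVec (s : Finset ι) (b : ι → ℝ) :
    inner ℝ (chaos none) (expVec s b) = 1 := by
  rw [expVec, chaos, inner_toLp]
  simp [chaosFun, integral_expDensity]

lemma inner_coord_expVec (s : Finset ι) (b : ι → ℝ) (k : ι) :
    inner ℝ (chaos (some k)) (expVec s b) = cutoff s b k := by
  rw [expVec, chaos, inner_toLp]
  have h := integral_add_cutoff s b (F := fun ξ : ι → ℝ => ξ k)
    (measurable_pi_apply k).stronglyMeasurable
  simp only [smul_eq_mul] at h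
  simp only [chaosFun, mul_comm (_ : ℝ) (expDensity s b _)]
  rw [← h, integral_add ((memLp_coord_two k).integrable (by norm_num)) (integrable_const _),
    integral_coord]
  simp

end Shift

/-! ### Cameron–Martin densities for square-summable shifts. -/

section ShiftVec

variable {ι : Type*}

/-- By `inner_expVec` the squared distance is e^{Σ_s} + e^{Σ_{s'}} - 2e^{Σ_{s∩s'}}, where Σ denotes
partial sums of b². All three exponentials lie within ε²/2 below the same limit once s and s'
contain a large s0. -/
lemma cauchySeq_expVec {b : ι → ℝ} (hb : Summable fun k => b k ^ 2) :
    CauchySeq fun s : Finset ι => expVec s b := by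
  classical
  rw [Metric.cauchySeq_iff]
  intro ε hε
  have hT : Tendsto (fun s : Finset ι => Real.exp (∑ k ∈ s, b k ^ 2)) atTop
      (𝓝 (Real.exp (∑' k, b k ^ 2))) :=
    (Real.continuous_exp.tendsto _).comp hb.hasSum
  obtain ⟨s0, hs0⟩ := (hT.eventually (lt_mem_nhds
    (show Real.exp (∑' k, b k ^ 2) - ε ^ 2 / 2 < Real.exp (∑' k, b k ^ 2) by
      have := pow_pos hε 2; linarith))).exists
  have hle : ∀ s : Finset ι, Real.exp (∑ k ∈ s, b k ^ 2) ≤ Real.exp (∑' k, b k ^ 2) :=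
    fun s => Real.exp_le_exp.2 (hb.sum_le_tsum _ fun k _ => sq_nonneg _)
  refine ⟨s0, fun s hs s' hs' => ?_⟩
  have hss : s0 ⊆ s ∩ s' := Finset.subset_inter hs hs'
  have h1 : Real.exp (∑ k ∈ s0, b k ^ 2) ≤ Real.exp (∑ k ∈ s ∩ s', b k ^ 2) :=
    Real.exp_le_exp.2 (Finset.sum_le_sum_of_subset_of_nonneg hss fun k _ _ => sq_nonneg _)
  rw [dist_eq_norm]
  refine lt_of_pow_lt_pow_left₀ 2 hε.le ?_
  rw [norm_sub_sq_real, ← real_inner_self_eq_norm_sq, ← real_inner_self_eq_norm_sq,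
    inner_expVec, inner_expVec, inner_expVec, Finset.inter_self, Finset.inter_self]
  have := hle s
  have := hle s'
  linarith

/-- The density of the law of `ξ + b`, in `L²`. -/
def shiftVec (b : ι → ℝ) : Lp ℝ 2 (gaussianProd ι) :=
  limUnder atTop fun s : Finset ι => expVec s b

lemma tendsto_expVec {b : ι → ℝ} (hb : Summable fun k => b k ^ 2) :
    Tendsto (fun s : Finset ι => expVec s b) atTop (𝓝 (shiftVec b)) :=
  tendsto_nhds_limUnder (cauchySeq_tendsto_of_complete (cauchySeq_expVec hb))

lemma norm_shiftVec_sq {b : ι → ℝ} (hb : Summable fun k => b k ^ 2) :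
    ‖shiftVec b‖ ^ 2 = Real.exp (∑' k, b k ^ 2) := by
  classical
  refine tendsto_nhds_unique ((tendsto_expVec hb).norm.pow 2) ?_
  simp only [← real_inner_self_eq_norm_sq, inner_expVec, Finset.inter_self]
  exact (Real.continuous_exp.tendsto _).comp hb.hasSum

lemma inner_one_shiftVec {b : ι → ℝ} (hb : Summable fun k => b k ^ 2) :
    inner ℝ (chaos none) (shiftVec b) = 1 := by
  refine tendsto_nhds_unique (tendsto_const_nhds.inner (tendsto_expVec hb)) ?_
  simp only [inner_one_expVec]
  exact tendsto_const_nhds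

lemma inner_coord_shiftVec {b : ι → ℝ} (hb : Summable fun k => b k ^ 2) (k : ι) :
    inner ℝ (chaos (some k)) (shiftVec b) = b k := by
  refine tendsto_nhds_unique (tendsto_const_nhds.inner (tendsto_expVec hb)) ?_
  refine tendsto_const_nhds.congr' ?_
  filter_upwards [eventually_ge_atTop {k}] with s hs
  rw [inner_coord_expVec, cutoff, if_pos (hs (Finset.mem_singleton_self k))]

lemma pairing_indicator {Ω : Type*} [MeasurableSpace Ω] {μ : Measure Ω} [IsFiniteMeasure μ]
    {S : Set Ω} (hS : MeasurableSet S) (f : Lp ℝ 2 μ) :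
    pairing (S.indicator fun _ => (1 : ℝ)) (memLp_indicator_const 2 hS 1 (.inr (by simp))) f =
      ∫ ω in S, f ω ∂μ := by
  rw [pairing_apply, ← integral_indicator hS]
  refine integral_congr_ae (ae_of_all _ fun ω => ?_)
  by_cases h : ω ∈ S <;> simp [h]

/-- L² convergence of the densities, tested against an indicator. It transfers positivity to the
limit density and identifies the measure it defines. -/
lemma setIntegral_shiftVec_tendsto {b : ι → ℝ} (hb : Summable fun k => b k ^ 2)
    {S : Set (ι → ℝ)} (hS : MeasurableSet S) :
    Tendsto (fun s : Finset ι =>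
      (((gaussianProd ι).map fun ξ k => ξ k + cutoff s b k) S).toReal) atTop
      (𝓝 (∫ ξ in S, shiftVec b ξ ∂(gaussianProd ι))) := by
  rw [← pairing_indicator hS]
  refine (((pairing _ _).continuous.tendsto _).comp (tendsto_expVec hb)).congr fun s => ?_
  have hm : StronglyMeasurable (S.indicator fun _ => (1 : ℝ)) :=
    stronglyMeasurable_const.indicator hS
  rw [Function.comp_apply, pairing_expVec s b hm,
    ← integral_map (φ := fun (ξ : ι → ℝ) k => ξ k + cutoff s b k)
      (f := S.indicator fun _ => (1 : ℝ)) (measurable_add_cutoff s b).aemeasurable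
      hm.aestronglyMeasurable,
    integral_indicator_const _ hS]
  simp [Measure.real]

lemma shiftVec_nonneg {b : ι → ℝ} (hb : Summable fun k => b k ^ 2) :
    0 ≤ᵐ[gaussianProd ι] shiftVec b := by
  refine ae_nonneg_of_forall_setIntegral_nonneg
    ((Lp.memLp (shiftVec b)).integrable (by norm_num)) fun S hS _ => ?_
  exact ge_of_tendsto' (setIntegral_shiftVec_tendsto hb hS) fun s => ENNReal.toReal_nonneg

/-- **Cameron–Martin theorem** for the standard Gaussian product measure. -/
lemma map_add_eq_withDensity {b : ι → ℝ} (hb : Summable fun k => b k ^ 2) :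
    (gaussianProd ι).map (fun ξ k => ξ k + b k) =
      (gaussianProd ι).withDensity fun ξ => ENNReal.ofReal (shiftVec b ξ) := by
  have hpi : ∀ c : ι → ℝ, (gaussianProd ι).map (fun ξ k => ξ k + c k) =
      Measure.infinitePi fun k => gaussianReal (c k) 1 := by
    intro c
    have := Measure.infinitePi_map_pi (fun _ : ι => gaussianReal 0 1)
      (f := fun k x => x + c k) (fun k => by fun_prop)
    rw [gaussianProd, this]
    congr 1; ext1 k
    rw [gaussianReal_map_add_const, zero_add]
  rw [hpi]
  symm
  refine Measure.eq_infinitePi _ fun s' t ht => ?_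
  have hbox : MeasurableSet (Set.pi (s' : Set ι) t) :=
    MeasurableSet.pi s'.countable_toSet fun k _ => ht k
  rw [withDensity_apply _ hbox, ← ofReal_integral_eq_lintegral_ofReal
    ((Lp.memLp (shiftVec b)).integrable (by norm_num)).integrableOn
    (ae_restrict_of_ae (shiftVec_nonneg hb))]
  have h := setIntegral_shiftVec_tendsto hb hbox
  -- A box involves only the coordinates in s', so the net is constant once s ⊇ s'.
  have h2 : Tendsto (fun s : Finset ι =>
      (((gaussianProd ι).map fun ξ k => ξ k + cutoff s b k) (Set.pi (s' : Set ι) t)).toReal) atTop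
      (𝓝 (∏ k ∈ s', gaussianReal (b k) 1 (t k)).toReal) := by
    refine tendsto_const_nhds.congr' ?_
    filter_upwards [eventually_ge_atTop s'] with s hs
    rw [hpi, Measure.infinitePi_pi _ fun k _ => ht k]
    congr 1
    refine Finset.prod_congr rfl fun k hk => ?_
    rw [cutoff, if_pos (hs hk)]
  rw [tendsto_nhds_unique h h2, ENNReal.ofReal_toReal]
  exact ENNReal.prod_ne_top fun k _ => measure_ne_top _ _

variable {E : Type*} [NormedAddCommGroup E] [NormedSpace ℝ E]

lemma measurable_add_const_pi (b : ι → ℝ) :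
    Measurable (fun (ξ : ι → ℝ) k => ξ k + b k) := by fun_prop

lemma integral_add_eq_pairing {b : ι → ℝ} (hb : Summable fun k => b k ^ 2) {F : (ι → ℝ) → E}
    (hF : StronglyMeasurable F) (hF2 : MemLp F 2 (gaussianProd ι)) :
    ∫ ξ, F (fun k => ξ k + b k) ∂(gaussianProd ι) = pairing F hF2 (shiftVec b) := by
  rw [← integral_map (φ := fun (ξ : ι → ℝ) k => ξ k + b k) (f := F)
    (measurable_add_const_pi b).aemeasurable hF.aestronglyMeasurable, map_add_eq_withDensity hb,
    integral_withDensity_eq_integral_toReal_smul₀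
    (Lp.aestronglyMeasurable _).aemeasurable.ennreal_ofReal
    (ae_of_all _ fun _ => ENNReal.ofReal_lt_top), pairing_apply]
  refine integral_congr_ae ?_
  filter_upwards [shiftVec_nonneg hb] with ξ hξ
  rw [ENNReal.toReal_ofReal hξ]

lemma map_add_absolutelyContinuous {b : ι → ℝ} (hb : Summable fun k => b k ^ 2) :
    (gaussianProd ι).map (fun ξ k => ξ k + b k) ≪ gaussianProd ι := by
  rw [map_add_eq_withDensity hb]
  exact withDensity_absolutelyContinuous _ _

end ShiftVec

lemma memLp_comp_shift {ι E : Type*} [NormedAddCommGroup E] (b : ι → ℝ) {F : (ι → ℝ) → E} {K : ℝ} (hF : StronglyMeasurable F)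
    (hK : ∀ ξ, ‖F ξ‖ ≤ K) : MemLp (fun ξ => F fun k => ξ k + b k) 2 (gaussianProd ι) :=
  memLp_of_bound (hF.comp_measurable (measurable_add_const_pi b)).aestronglyMeasurable
    (fun _ => hK _) 2

/-! ### Expansion of Gaussian expectations along a translation. -/

section ShiftEstimates

variable {ι : Type*} {H : Type*} [NormedAddCommGroup H] [InnerProductSpace ℝ H]
  {E : Type*} [NormedAddCommGroup E] [NormedSpace ℝ E]

lemma hasSum_inner_sq (e : HilbertBasis ι ℝ H) (b : H) :
    HasSum (fun k => inner ℝ (e k) b ^ 2) (‖b‖ ^ 2) := by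
  have h := e.hasSum_inner_mul_inner b b
  rw [real_inner_self_eq_norm_sq] at h
  refine h.congr_fun fun k => ?_
  rw [sq, real_inner_comm b (e k)]

lemma summable_inner_sq (e : HilbertBasis ι ℝ H) (b : H) :
    Summable fun k => inner ℝ (e k) b ^ 2 := (hasSum_inner_sq e b).summable

lemma inner_whiteNoise_shiftVec (e : HilbertBasis ι ℝ H) (a b : H) :
    inner ℝ (whiteNoise e a) (shiftVec fun k => inner ℝ (e k) b) = inner ℝ a b := by
  set ρ := shiftVec fun k => inner ℝ (e k) b
  have h := (hasSum_whiteNoise e a).mapL (innerSL ℝ ρ)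
  rw [innerSL_apply_apply, real_inner_comm] at h
  refine h.unique ?_
  refine (e.hasSum_inner_mul_inner a b).congr_fun fun k => ?_
  rw [map_smul, innerSL_apply_apply, real_inner_comm (chaos _) ρ,
    inner_coord_shiftVec (summable_inner_sq e b), smul_eq_mul, real_inner_comm a (e k)]

lemma norm_shiftVec_sub_one_sq (e : HilbertBasis ι ℝ H) (b : H) :
    ‖(shiftVec fun k => inner ℝ (e k) b) - chaos none‖ ^ 2 = Real.exp (‖b‖ ^ 2) - 1 := by
  rw [norm_sub_sq_real, norm_shiftVec_sq (summable_inner_sq e b), (hasSum_inner_sq e b).tsum_eq,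
    norm_chaos, real_inner_comm, inner_one_shiftVec (summable_inner_sq e b)]
  ring

/-- The first-chaos component of ρ is W(b), because ⟨W(a), ρ⟩ = ⟨a, b⟩ for all a. Removing the two
components 1 and W(b) therefore subtracts 1 and ‖b‖² from ‖ρ‖² = e^{‖b‖²}. -/
lemma norm_shiftVec_sub_sub_sq (e : HilbertBasis ι ℝ H) (b : H) :
    ‖(shiftVec fun k => inner ℝ (e k) b) - chaos none - whiteNoise e b‖ ^ 2 =
      Real.exp (‖b‖ ^ 2) - 1 - ‖b‖ ^ 2 := by
  rw [norm_sub_sq_real, norm_shiftVec_sub_one_sq, inner_sub_left, inner_one_whiteNoise,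
    LinearIsometry.norm_map, real_inner_comm, inner_whiteNoise_shiftVec,
    real_inner_self_eq_norm_sq]
  ring

lemma pairing_one {F : (ι → ℝ) → E}
    (hF : MemLp F 2 (gaussianProd ι)) :
    pairing F hF (chaos none) = ∫ ξ, F ξ ∂(gaussianProd ι) := by
  rw [chaos, pairing_toLp]; simp [chaosFun]

/-- Second order expansion of a Gaussian expectation along a translation. -/
lemma norm_shift_sub_sub_le (e : HilbertBasis ι ℝ H) (b : H) {F : (ι → ℝ) → E} {K : ℝ}
    (hF : StronglyMeasurable F) (hF2 : MemLp F 2 (gaussianProd ι)) (hK : ∀ ξ, ‖F ξ‖ ≤ K) :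
    ‖∫ ξ, F (fun k => ξ k + inner ℝ (e k) b) ∂(gaussianProd ι) - ∫ ξ, F ξ ∂(gaussianProd ι) -
      pairing F hF2 (whiteNoise e b)‖ ≤ 3 * K * ‖b‖ ^ (3 / 2 : ℝ) := by
  have hK0 : 0 ≤ K := (norm_nonneg _).trans (hK 0)
  set r := ‖b‖ with hr
  have hr0 : 0 ≤ r := norm_nonneg _
  -- For small r the remainder is of order r², for large r it grows at most like r. The exponent 3/2
  -- lies between: above 1 for differentiability, below 2 so that the resulting power of t is
  -- integrable at 0.
  rcases le_total r 1 with h1 | h1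
  · rw [integral_add_eq_pairing (summable_inner_sq e b) hF hF2, ← pairing_one hF2,
      ← map_sub, ← map_sub]
    refine (norm_pairing_le hF2 hK _).trans ?_
    rw [mul_comm 3 K, mul_assoc]
    gcongr
    have h2 := norm_shiftVec_sub_sub_sq e b
    have h3 : Real.exp (r ^ 2) - 1 - r ^ 2 ≤ (r ^ 2) ^ 2 := by
      have := Real.abs_exp_sub_one_sub_id_le (x := r ^ 2) (by rw [abs_of_nonneg (sq_nonneg _)]; nlinarith)
      exact (le_abs_self _).trans this
    have h4 := abs_le_of_sq_le_sq (h2.trans_le h3) (sq_nonneg _)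
    refine (le_abs_self _).trans (h4.trans ?_)
    have h5 : r ^ 2 ≤ r ^ (3 / 2 : ℝ) := by
      rw [← Real.rpow_natCast]
      exact Real.rpow_le_rpow_of_exponent_ge' hr0 h1 (by norm_num) (by norm_num)
    have := Real.rpow_nonneg hr0 (3 / 2)
    linarith
  · have b1 : ‖∫ ξ, F (fun k => ξ k + inner ℝ (e k) b) ∂(gaussianProd ι)‖ ≤ K := by
      simpa using norm_integral_le_of_norm_le_const (μ := gaussianProd ι) (ae_of_all _ fun ξ => hK _)
    have b2 : ‖∫ ξ, F ξ ∂(gaussianProd ι)‖ ≤ K := by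
      simpa using norm_integral_le_of_norm_le_const (μ := gaussianProd ι) (ae_of_all _ fun ξ => hK _)
    have b3 := norm_pairing_le hF2 hK (whiteNoise e b)
    rw [LinearIsometry.norm_map] at b3
    refine (norm_sub_le _ _).trans ((add_le_add ((norm_sub_le _ _).trans (add_le_add b1 b2))
      b3).trans ?_)
    have h5 : r ≤ r ^ (3 / 2 : ℝ) := by
      conv_lhs => rw [← Real.rpow_one r]
      exact Real.rpow_le_rpow_of_exponent_le h1 (by norm_num)
    nlinarith

lemma memLp_smul_bounded {Ω : Type*} [MeasurableSpace Ω] {μ : Measure Ω} {f : Ω → ℝ} {F : Ω → E}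
    {K : ℝ} (hf : MemLp f 2 μ) (hF : AEStronglyMeasurable F μ) (hK : ∀ ω, ‖F ω‖ ≤ K) :
    MemLp (fun ω => f ω • F ω) 2 μ :=
  (memLp_top_of_bound hF K (ae_of_all _ hK)).smul hf

/-- A change of variables moves the shift from F to the density, and the weight W(a)(ξ) becomes
W(a)(ξ - b) = W(a)(ξ) - ⟨b, a⟩. Since W(a) is only an L² class, this is checked for basis vectors,
where W is a coordinate, and extended by linearity and continuity. -/
lemma pairing_comp_shift (e : HilbertBasis ι ℝ H) (a b : H) {F : (ι → ℝ) → E} {K : ℝ}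
    (hF : StronglyMeasurable F) (hF2 : MemLp F 2 (gaussianProd ι)) (hK : ∀ ξ, ‖F ξ‖ ≤ K) :
    pairing _ (memLp_comp_shift (fun k => inner ℝ (e k) b) hF hK) (whiteNoise e a) =
      pairing _ (memLp_smul_bounded (Lp.memLp (shiftVec fun k => inner ℝ (e k) b))
        hF.aestronglyMeasurable hK) (whiteNoise e a) -
      inner ℝ b a • pairing F hF2 (shiftVec fun k => inner ℝ (e k) b) := by
  set ρ := shiftVec fun k => inner ℝ (e k) b with hρ
  set P1 := pairing _ (memLp_comp_shift (fun k => inner ℝ (e k) b) hF hK)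
  set P2 := pairing _ (memLp_smul_bounded (Lp.memLp ρ) hF.aestronglyMeasurable hK)
  have key : P1.comp (whiteNoise e).toContinuousLinearMap =
      P2.comp (whiteNoise e).toContinuousLinearMap -
        (innerSL ℝ b).smulRight (pairing F hF2 ρ) := by
    refine ContinuousLinearMap.ext_on
      (Submodule.dense_iff_topologicalClosure_eq_top.2 e.dense_span) ?_
    rintro _ ⟨k, rfl⟩
    simp only [ContinuousLinearMap.comp_apply, LinearIsometry.coe_toContinuousLinearMap,
      _root_.sub_apply, ContinuousLinearMap.smulRight_apply, innerSL_apply_apply,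
      whiteNoise_basis]
    have hc : StronglyMeasurable fun ξ : ι → ℝ => (ξ k - inner ℝ (e k) b) • F ξ :=
      StronglyMeasurable.smul (by fun_prop : Measurable fun ξ : ι → ℝ =>
        ξ k - inner ℝ (e k) b).stronglyMeasurable hF
    have hc1 : MemLp (fun ξ : ι → ℝ => ξ k - inner ℝ (e k) b) 2 (gaussianProd ι) :=
      (memLp_coord_two k).sub (memLp_const _)
    have hc2 : MemLp (fun ξ : ι → ℝ => (ξ k - inner ℝ (e k) b) • F ξ) 2 (gaussianProd ι) :=
      memLp_smul_bounded hc1 hF.aestronglyMeasurable hK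
    have h := integral_add_eq_pairing (summable_inner_sq e b) hc hc2
    simp only [add_sub_cancel_right] at h
    rw [chaos, pairing_toLp, pairing_toLp]
    simp only [chaosFun]
    rw [h, pairing_apply, pairing_apply, ← integral_smul, ← integral_sub]
    · refine integral_congr_ae (ae_of_all _ fun ξ => ?_)
      simp only [real_inner_comm b (e k), ← hρ]
      module
    · exact integrable_smul_of_memLp_two (memLp_coord_two k)
        (memLp_smul_bounded (Lp.memLp ρ) hF.aestronglyMeasurable hK)
    · exact (integrable_smul_of_memLp_two (Lp.memLp ρ) hF2).smul _
  have := congrArg (fun L => L a) key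
  simpa using this

/-- Hölder continuity of weighted Gaussian expectations along translations. -/
lemma norm_pairing_shift_sub_le (e : HilbertBasis ι ℝ H) (a b : H) {F : (ι → ℝ) → E} {K θ : ℝ}
    (hF : StronglyMeasurable F) (hF2 : MemLp F 2 (gaussianProd ι)) (hK : ∀ ξ, ‖F ξ‖ ≤ K)
    (hθ0 : 0 ≤ θ) (hθ1 : θ ≤ 1) :
    ‖pairing _ (memLp_comp_shift (fun k => inner ℝ (e k) b) hF hK) (whiteNoise e a) -
      pairing F hF2 (whiteNoise e a)‖ ≤ 3 * K * ‖b‖ ^ θ * ‖a‖ := by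
  have hK0 : 0 ≤ K := (norm_nonneg _).trans (hK 0)
  set r := ‖b‖ with hr
  have hr0 : 0 ≤ r := norm_nonneg _
  rcases le_total r 1 with h1 | h1
  · set ρ := shiftVec fun k => inner ℝ (e k) b with hρ
    have hd : MemLp (fun ξ => (ρ - chaos none : Lp ℝ 2 (gaussianProd ι)) ξ • F ξ) 2
        (gaussianProd ι) := memLp_smul_bounded (Lp.memLp _) hF.aestronglyMeasurable hK
    -- The difference is W(a) paired with (ρ - 1)F, at most 2K‖b‖‖a‖, minus ⟨b, a⟩ times a mean of
    -- F, at most K‖b‖‖a‖. This is the origin of the constant 3.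
    have e1 : pairing _ (memLp_comp_shift (fun k => inner ℝ (e k) b) hF hK) (whiteNoise e a) -
        pairing F hF2 (whiteNoise e a) =
        pairing _ hd (whiteNoise e a) - inner ℝ b a • pairing F hF2 ρ := by
      rw [pairing_comp_shift e a b hF hF2 hK, sub_right_comm]
      congr 1
      rw [pairing_apply, pairing_apply, pairing_apply, ← integral_sub]
      · refine integral_congr_ae ?_
        filter_upwards [Lp.coeFn_sub ρ (chaos none), (memLp_chaosFun (ι := ι) none).coeFn_toLp]
          with ξ h2 h3
        rw [h2, Pi.sub_apply, chaos, h3]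
        simp only [chaosFun, ← hρ]
        module
      · exact integrable_smul_of_memLp_two (Lp.memLp _)
          (memLp_smul_bounded (Lp.memLp ρ) hF.aestronglyMeasurable hK)
      · exact integrable_smul_of_memLp_two (Lp.memLp _) hF2
    have h2 : ‖ρ - chaos none‖ ≤ 2 * r := by
      have h3 := norm_shiftVec_sub_one_sq e b
      refine abs_le_of_sq_le_sq (h3.trans_le ?_) (by positivity) |>.trans' (le_abs_self _)
      have h4 := Real.abs_exp_sub_one_sub_id_le (x := r ^ 2)
        (by rw [abs_of_nonneg (sq_nonneg _)]; nlinarith)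
      have h5 := (le_abs_self _).trans h4
      have h6 : r ^ 2 ≤ 1 := by nlinarith
      nlinarith [sq_nonneg r]
    have h3 : ‖pairing _ hd (whiteNoise e a)‖ ≤ ‖a‖ * (K * (2 * r)) := by
      have h4 := norm_integral_smul_le (Lp.memLp (whiteNoise e a)) hd
      rw [pairing_apply]
      refine h4.trans ?_
      rw [← Lp.norm_def, LinearIsometry.norm_map]
      gcongr
      have h5 : eLpNorm (fun ξ => (ρ - chaos none : Lp ℝ 2 (gaussianProd ι)) ξ • F ξ) 2
          (gaussianProd ι) ≤ ENNReal.ofReal K *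
            eLpNorm (ρ - chaos none : Lp ℝ 2 (gaussianProd ι)) 2 (gaussianProd ι) := by
        refine eLpNorm_le_mul_eLpNorm_of_ae_le_mul (ae_of_all _ fun ξ => ?_) 2
        rw [norm_smul, mul_comm]
        gcongr
        exact hK ξ
      refine (ENNReal.toReal_mono (ENNReal.mul_ne_top ENNReal.ofReal_ne_top
        (Lp.eLpNorm_ne_top _)) h5).trans ?_
      rw [ENNReal.toReal_mul, ENNReal.toReal_ofReal hK0, ← Lp.norm_def]
      gcongr
    have h4 : ‖inner ℝ b a • pairing F hF2 ρ‖ ≤ r * ‖a‖ * K := by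
      rw [norm_smul]
      refine mul_le_mul (norm_inner_le_norm b a) ?_ (norm_nonneg _) (by positivity)
      rw [← integral_add_eq_pairing (summable_inner_sq e b) hF hF2]
      simpa using norm_integral_le_of_norm_le_const (μ := gaussianProd ι) (ae_of_all _ fun ξ => hK _)
    rw [e1]
    refine (norm_sub_le _ _).trans ((add_le_add h3 h4).trans ?_)
    have h5 : r ≤ r ^ θ := by
      conv_lhs => rw [← Real.rpow_one r]
      exact Real.rpow_le_rpow_of_exponent_ge' hr0 h1 hθ0 hθ1
    calc ‖a‖ * (K * (2 * r)) + r * ‖a‖ * K = 3 * K * r * ‖a‖ := by ring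
      _ ≤ _ := by gcongr
  · have b1 := norm_pairing_le (memLp_comp_shift (fun k => inner ℝ (e k) b) hF hK)
      (fun ξ => hK _) (whiteNoise e a)
    have b2 := norm_pairing_le hF2 hK (whiteNoise e a)
    rw [LinearIsometry.norm_map] at b1 b2
    refine (norm_sub_le _ _).trans ((add_le_add b1 b2).trans ?_)
    have h5 : 1 ≤ r ^ θ := Real.one_le_rpow h1 hθ0
    have h6 : 0 ≤ K * ‖a‖ := by positivity
    nlinarith

end ShiftEstimates

/-! ### Gaussian random vectors -/

section GaussianVectors

variable {ι : Type*} {H : Type*} [NormedAddCommGroup H] [InnerProductSpace ℝ H]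

/-- The vector with coordinates `y`. -/
def sumMap (e : HilbertBasis ι ℝ H) (y : ι → ℝ) : H := ∑' k, y k • e k

lemma summable_smul_basis_iff [CompleteSpace H] (e : HilbertBasis ι ℝ H) (y : ι → ℝ) :
    (Summable fun k => y k • e k) ↔ Summable fun k => y k ^ 2 := by
  have := e.orthonormal.orthogonalFamily.summable_iff_norm_sq_summable y
  simpa using this

lemma inner_sumMap [CompleteSpace H] (e : HilbertBasis ι ℝ H) {y : ι → ℝ}
    (hy : Summable fun k => y k ^ 2) (k : ι) : inner ℝ (e k) (sumMap e y) = y k := by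
  classical
  have h := ((summable_smul_basis_iff e y).2 hy).hasSum.mapL (innerSL ℝ (e k))
  rw [innerSL_apply_apply] at h
  refine h.unique ?_
  convert! hasSum_ite_eq k (y k) using 2 with j
  rw [innerSL_apply_apply, inner_smul_right, orthonormal_iff_ite.1 e.orthonormal]
  rcases eq_or_ne k j with rfl | h
  · simp
  · simp [h, h.symm]

lemma norm_sumMap_sq [CompleteSpace H] (e : HilbertBasis ι ℝ H) {y : ι → ℝ}
    (hy : Summable fun k => y k ^ 2) : ‖sumMap e y‖ ^ 2 = ∑' k, y k ^ 2 := by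
  rw [← (hasSum_inner_sq e (sumMap e y)).tsum_eq]
  simp_rw [inner_sumMap e hy]

lemma sumMap_inner (e : HilbertBasis ι ℝ H) (x : H) :
    sumMap e (fun k => inner ℝ (e k) x) = x := by
  have := e.hasSum_repr x
  simp only [e.repr_apply_apply] at this
  exact this.tsum_eq

lemma ext_inner_basis (e : HilbertBasis ι ℝ H) {x y : H}
    (h : ∀ k, inner ℝ (e k) x = inner ℝ (e k) y) : x = y := by
  rw [← sumMap_inner e x, ← sumMap_inner e y]; simp_rw [h]

lemma summable_add_sq {a b : ι → ℝ} (ha : Summable fun k => a k ^ 2)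
    (hb : Summable fun k => b k ^ 2) : Summable fun k => (a k + b k) ^ 2 := by
  refine Summable.of_nonneg_of_le (fun k => sq_nonneg _) (fun k => ?_)
    ((ha.mul_left 2).add (hb.mul_left 2))
  nlinarith [sq_nonneg (a k - b k)]

lemma summable_mul_sq {a b : ι → ℝ} {C : ℝ} (ha : ∀ k, |a k| ≤ C)
    (hb : Summable fun k => b k ^ 2) : Summable fun k => (a k * b k) ^ 2 := by
  refine Summable.of_nonneg_of_le (fun k => sq_nonneg _) (fun k => ?_) (hb.mul_left (C ^ 2))
  rw [mul_pow]
  exact mul_le_mul_of_nonneg_right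
    (sq_le_sq' (neg_le_of_abs_le (ha k)) (le_of_abs_le (ha k))) (sq_nonneg _)

lemma measurableSet_summable_sq [Countable ι] :
    MeasurableSet {y : ι → ℝ | Summable fun k => y k ^ 2} := by
  have : {y : ι → ℝ | Summable fun k => y k ^ 2} =
      {y | ∑' k, ENNReal.ofReal (y k ^ 2) ≠ ∞} := by
    ext y
    simp only [Set.mem_ofPred_eq]
    constructor
    · intro h
      exact h.tsum_ofReal_ne_top
    · intro h
      have := ENNReal.summable_toReal h
      refine this.congr fun k => ?_
      rw [ENNReal.toReal_ofReal (sq_nonneg _)]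
  rw [this]
  refine MeasurableSet.compl (measurableSet_eq_fun ?_ measurable_const)
  exact Measurable.tsum fun k => by fun_prop

lemma measurable_sumMap [CompleteSpace H] [Countable ι] [MeasurableSpace H] [BorelSpace H]
    (e : HilbertBasis ι ℝ H) : Measurable (sumMap e) := by
  classical
  set S : Set (ι → ℝ) := {y | Summable fun k => y k ^ 2} with hS
  refine measurable_of_tendsto_metrizable' (atTop : Filter (Finset ι))
    (f := fun s => S.indicator fun y => ∑ k ∈ s, y k • e k) (fun s => ?_) ?_
  · refine Measurable.indicator ?_ measurableSet_summable_sq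
    exact Continuous.measurable (by fun_prop)
  · rw [tendsto_pi_nhds]
    intro y
    by_cases hy : y ∈ S
    · simp only [Set.indicator_of_mem hy]
      exact ((summable_smul_basis_iff e y).2 hy).hasSum
    · simp only [Set.indicator_of_notMem hy]
      -- The default value 0 of a non-summable `tsum` agrees with the truncated partial sums off S,
      -- so the convergence holds everywhere.
      have : sumMap e y = 0 :=
        tsum_eq_zero_of_not_summable fun h => hy ((summable_smul_basis_iff e y).1 h)
      rw [this]
      exact tendsto_const_nhds

/-- The expectation of the sum of (r_k ξ_k)² is the sum of r_k², so the random sum is almost surely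
finite. -/
lemma ae_summable_mul_coord_sq [Countable ι] {r : ι → ℝ} (hr : Summable fun k => r k ^ 2) :
    ∀ᵐ ξ ∂(gaussianProd ι), Summable fun k => (r k * ξ k) ^ 2 := by
  have h1 : ∫⁻ ξ, ∑' k, ENNReal.ofReal ((r k * ξ k) ^ 2) ∂(gaussianProd ι) ≠ ∞ := by
    rw [lintegral_tsum fun k => Measurable.aemeasurable (by fun_prop)]
    have : ∀ k, ∫⁻ ξ, ENNReal.ofReal ((r k * ξ k) ^ 2) ∂(gaussianProd ι) =
        ENNReal.ofReal (r k ^ 2) := by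
      intro k
      have hi : Integrable (fun ξ : ι → ℝ => (r k * ξ k) ^ 2) (gaussianProd ι) :=
        ((memLp_coord_two k).const_mul (r k)).integrable_sq
      rw [← ofReal_integral_eq_lintegral_ofReal hi (ae_of_all _ fun ξ => sq_nonneg _)]
      congr 1
      simp_rw [mul_pow, integral_const_mul, sq (_ : ℝ)]
      rw [integral_coord_sq, mul_one]
    simp_rw [this]
    exact hr.tsum_ofReal_ne_top
  filter_upwards [ae_lt_top (Measurable.tsum fun k => by fun_prop) h1] with ξ hξ
  have := ENNReal.summable_toReal hξ.ne
  refine this.congr fun k => ?_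
  rw [ENNReal.toReal_ofReal (sq_nonneg _)]

/-- The vector with coordinates `m k + r k * ξ k`. -/
def affPoint (e : HilbertBasis ι ℝ H) (m r : ι → ℝ) (ξ : ι → ℝ) : H :=
  sumMap e fun k => m k + r k * ξ k

lemma measurable_affPoint [CompleteSpace H] [Countable ι] [MeasurableSpace H] [BorelSpace H]
    (e : HilbertBasis ι ℝ H) (m r : ι → ℝ) : Measurable (affPoint e m r) :=
  (measurable_sumMap e).comp (by fun_prop)

lemma ae_summable_affPoint [Countable ι] {m r : ι → ℝ} (hm : Summable fun k => m k ^ 2)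
    (hr : Summable fun k => r k ^ 2) :
    ∀ᵐ ξ ∂(gaussianProd ι), Summable fun k => (m k + r k * ξ k) ^ 2 := by
  filter_upwards [ae_summable_mul_coord_sq hr] with ξ hξ
  exact summable_add_sq hm hξ

lemma gaussianReal_eq_map (m : ℝ) (q : ℝ≥0) :
    gaussianReal m q = (gaussianReal 0 1).map fun x => m + √q * x := by
  have h : (fun x : ℝ => m + √q * x) = (fun x => m + x) ∘ fun x => √q * x := rfl
  rw [h, ← Measure.map_map (by fun_prop) (by fun_prop), gaussianReal_map_const_mul,
    gaussianReal_map_const_add]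
  congr 1
  · simp
  · ext; simp

lemma gaussianMeasure_eq_map [CompleteSpace H] [Countable ι] [MeasurableSpace H] [BorelSpace H]
    (e : HilbertBasis ι ℝ H) (m : H) (q : ι → ℝ≥0) :
    gaussianMeasure e m q =
      (gaussianProd ι).map (affPoint e (fun k => inner ℝ (e k) m) fun k => √(q k)) := by
  have h := Measure.infinitePi_map_pi (fun _ : ι => gaussianReal 0 1)
    (f := fun k x => inner ℝ (e k) m + √(q k) * x) (fun k => by fun_prop)
  simp only [← gaussianReal_eq_map] at h
  rw [gaussianMeasure, ← h]
  exact Measure.map_map (measurable_sumMap e) (by fun_prop)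

lemma gaussianReal_prod_map (a b : ℝ) :
    ((gaussianReal 0 1).prod (gaussianReal 0 1)).map (fun p : ℝ × ℝ => a * p.1 + b * p.2) =
      (gaussianReal 0 1).map fun x => √(a ^ 2 + b ^ 2) * x := by
  have h : (fun p : ℝ × ℝ => a * p.1 + b * p.2) =
      (fun p : ℝ × ℝ => p.1 + p.2) ∘ Prod.map (fun x => a * x) (fun x => b * x) := rfl
  rw [h, ← Measure.map_map (by fun_prop) (by fun_prop),
    ← Measure.map_prod_map _ _ (by fun_prop) (by fun_prop), gaussianReal_map_const_mul,
    gaussianReal_map_const_mul, gaussianReal_map_const_mul]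
  change Measure.conv _ _ = _
  rw [gaussianReal_conv_gaussianReal]
  congr 1
  · simp
  · ext
    simp [Real.sq_sqrt (by positivity : 0 ≤ a ^ 2 + b ^ 2)]

/-- The law of a sum of independent Gaussian sequences. -/
lemma gaussianProd_prod_map (a b : ι → ℝ) :
    ((gaussianProd ι).prod (gaussianProd ι)).map (fun p k => a k * p.1 k + b k * p.2 k) =
      (gaussianProd ι).map fun ξ k => √(a k ^ 2 + b k ^ 2) * ξ k := by
  have h1 := Measure.infinitePi_map_pi (fun _ : ι => gaussianReal 0 1)
    (f := fun k x => √(a k ^ 2 + b k ^ 2) * x) (fun k => by fun_prop)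
  rw [← gaussianProd] at h1
  rw [h1]
  have : ∀ k, IsProbabilityMeasure ((gaussianReal 0 1).map fun x => √(a k ^ 2 + b k ^ 2) * x) :=
    fun k => Measure.isProbabilityMeasure_map (by fun_prop)
  refine Measure.eq_infinitePi _ fun s t ht => ?_
  have hbox : MeasurableSet (Set.pi (s : Set ι) t) :=
    MeasurableSet.pi s.countable_toSet fun k _ => ht k
  rw [Measure.map_apply (by fun_prop) hbox, Measure.prod_apply (hbox.preimage (by fun_prop))]
  have hG : ∀ k, Measurable fun x : ℝ =>
      gaussianReal 0 1 ((fun y => a k * x + b k * y) ⁻¹' t k) := by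
    intro k
    exact measurable_measure_prodMk_left (ν := gaussianReal 0 1)
      (s := (fun p : ℝ × ℝ => a k * p.1 + b k * p.2) ⁻¹' t k) ((ht k).preimage (by fun_prop))
  have h2 : ∀ ξ : ι → ℝ, gaussianProd ι (Prod.mk ξ ⁻¹'
      ((fun (p : (ι → ℝ) × (ι → ℝ)) k => a k * p.1 k + b k * p.2 k) ⁻¹' Set.pi (s : Set ι) t)) =
      ∏ k ∈ s, gaussianReal 0 1 ((fun y => a k * ξ k + b k * y) ⁻¹' t k) := by
    intro ξ
    have : Prod.mk ξ ⁻¹' ((fun (p : (ι → ℝ) × (ι → ℝ)) k => a k * p.1 k + b k * p.2 k) ⁻¹'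
        Set.pi (s : Set ι) t) =
        Set.pi (s : Set ι) fun k => (fun y => a k * ξ k + b k * y) ⁻¹' t k := by
      ext η; simp
    rw [this]
    exact Measure.infinitePi_pi _ fun k _ => (ht k).preimage (by fun_prop)
  simp_rw [h2]
  have h3 : iIndepFun (fun k (ξ : ι → ℝ) =>
      gaussianReal 0 1 ((fun y => a k * ξ k + b k * y) ⁻¹' t k)) (gaussianProd ι) :=
    iIndepFun_infinitePi hG
  rw [lintegral_prod_eq_prod_lintegral_of_indepFun _ _ h3
    fun k => (hG k).comp (measurable_pi_apply k)]
  refine Finset.prod_congr rfl fun k _ => ?_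
  have hm := lintegral_map (μ := gaussianProd ι) (hG k) (measurable_pi_apply k)
  rw [gaussianProd_map_eval] at hm
  rw [← hm, ← gaussianReal_prod_map, Measure.map_apply (by fun_prop) (ht k),
    Measure.prod_apply ((ht k).preimage (by fun_prop))]
  rfl

variable [CompleteSpace H] [Countable ι] [MeasurableSpace H] [BorelSpace H]

/-- A diagonal image of a Gaussian vector plus independent diagonal noise is again diagonal
Gaussian, with variances added. Chapman–Kolmogorov and the invariance of μ are both instances. -/
lemma map_affPoint_affPoint (e : HilbertBasis ι ℝ H) {m r : ι → ℝ} (c r' : ι → ℝ)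
    (hm : Summable fun k => m k ^ 2) (hr : Summable fun k => r k ^ 2) :
    ((gaussianProd ι).prod (gaussianProd ι)).map
      (fun p => affPoint e (fun k => c k * inner ℝ (e k) (affPoint e m r p.1)) r' p.2) =
      (gaussianProd ι).map
        (affPoint e (fun k => c k * m k) fun k => √((c k * r k) ^ 2 + r' k ^ 2)) := by
  have h1 : (fun p : (ι → ℝ) × (ι → ℝ) =>
      affPoint e (fun k => c k * inner ℝ (e k) (affPoint e m r p.1)) r' p.2)
      -- The equality holds only almost everywhere: the coordinates of the inner vector are the
      -- expected ones only where its series is summable.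
      =ᵐ[(gaussianProd ι).prod (gaussianProd ι)]
      (affPoint e (fun k => c k * m k) fun _ => 1) ∘
        fun p k => (c k * r k) * p.1 k + r' k * p.2 k := by
    have h := (ae_summable_affPoint hm hr)
    have h' : ∀ᵐ p ∂((gaussianProd ι).prod (gaussianProd ι)),
        Summable fun k => (m k + r k * p.1 k) ^ 2 :=
      Measure.quasiMeasurePreserving_fst.ae h
    filter_upwards [h'] with p hp
    simp only [Function.comp_apply, affPoint]
    congr 1
    ext k
    rw [inner_sumMap e hp]
    ring
  rw [Measure.map_congr h1, ← Measure.map_map (measurable_affPoint e _ _) (by fun_prop),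
    gaussianProd_prod_map, Measure.map_map (measurable_affPoint e _ _) (by fun_prop)]
  congr 1
  ext ξ
  simp [affPoint]

end GaussianVectors

/-! ### The Ornstein-Uhlenbeck transition probabilities -/

lemma measurable_inner_basis {ι H : Type*} [NormedAddCommGroup H]
    [InnerProductSpace ℝ H] [MeasurableSpace H] [BorelSpace H] (e : HilbertBasis ι ℝ H) (k : ι) :
    Measurable fun x : H => inner ℝ (e k) x :=
  (innerSL ℝ (e k)).continuous.measurable

section Transition

variable {ι : Type*} {H : Type*} [NormedAddCommGroup H] [InnerProductSpace ℝ H]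

/-- The part of the spectral assumption that is used: the `eig k` are positive with summable
inverses. -/
structure IsSpectrum (eig : ι → ℝ) : Prop where
  pos : ∀ k, 0 < eig k
  summable_inv : Summable fun k => (eig k)⁻¹

/-- The eigenvalues of `Q_t`. -/
def ouVar (eig : ι → ℝ) (t : ℝ) (k : ι) : ℝ := (1 - Real.exp (-(2 * eig k * t))) / (2 * eig k)

/-- A random vector with law `N(e^{tA} x, Q_t)`. -/
def ouPoint (e : HilbertBasis ι ℝ H) (eig : ι → ℝ) (t : ℝ) (x : H) : (ι → ℝ) → H :=
  affPoint e (fun k => Real.exp (-(eig k * t)) * inner ℝ (e k) x) fun k => √(ouVar eig t k)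

/-- A random vector with law `N(0, -A⁻¹ / 2)`. -/
def invPoint (e : HilbertBasis ι ℝ H) (eig : ι → ℝ) : (ι → ℝ) → H :=
  affPoint e (fun _ => 0) fun k => √(1 / (2 * eig k))

variable {eig : ι → ℝ}

lemma ouVar_nonneg (h : IsSpectrum eig) {t : ℝ} (ht : 0 ≤ t) (k : ι) : 0 ≤ ouVar eig t k := by
  have := h.pos k
  refine div_nonneg (sub_nonneg.2 (Real.exp_le_one_iff.2 ?_)) (by positivity)
  have : 0 ≤ 2 * eig k * t := by positivity
  linarith

lemma ouVar_pos (h : IsSpectrum eig) {t : ℝ} (ht : 0 < t) (k : ι) : 0 < ouVar eig t k := by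
  have := h.pos k
  refine div_pos (sub_pos.2 (Real.exp_zero ▸ Real.exp_lt_exp.2 ?_)) (by positivity)
  have : 0 < 2 * eig k * t := by positivity
  linarith

lemma ouVar_le (h : IsSpectrum eig) (t : ℝ) (k : ι) : ouVar eig t k ≤ (eig k)⁻¹ := by
  have := h.pos k
  rw [ouVar, div_le_iff₀ (by positivity)]
  have e1 : (eig k)⁻¹ * (2 * eig k) = 2 := by field_simp
  have := Real.exp_pos (-(2 * eig k * t))
  linarith

lemma summable_sqrt_ouVar (h : IsSpectrum eig) {t : ℝ} (ht : 0 ≤ t) :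
    Summable fun k => √(ouVar eig t k) ^ 2 := by
  refine Summable.of_nonneg_of_le (fun k => sq_nonneg _) (fun k => ?_) h.summable_inv
  rw [Real.sq_sqrt (ouVar_nonneg h ht k)]
  exact ouVar_le h t k

lemma summable_sqrt_invVar (h : IsSpectrum eig) :
    Summable fun k => √(1 / (2 * eig k)) ^ 2 := by
  refine Summable.of_nonneg_of_le (fun k => sq_nonneg _) (fun k => ?_) h.summable_inv
  have := h.pos k
  rw [Real.sq_sqrt (by positivity), one_div, mul_inv]
  have : 0 < (eig k)⁻¹ := by positivity
  linarith

lemma abs_exp_neg_le_one (h : IsSpectrum eig) {t : ℝ} (ht : 0 ≤ t) (k : ι) :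
    |Real.exp (-(eig k * t))| ≤ 1 := by
  rw [abs_of_pos (Real.exp_pos _), Real.exp_le_one_iff]
  have := mul_nonneg (h.pos k).le ht
  linarith

lemma summable_exp_mul_inner (e : HilbertBasis ι ℝ H) (h : IsSpectrum eig) {t : ℝ} (ht : 0 ≤ t)
    (x : H) : Summable fun k => (Real.exp (-(eig k * t)) * inner ℝ (e k) x) ^ 2 :=
  summable_mul_sq (abs_exp_neg_le_one h ht) (summable_inner_sq e x)

variable [CompleteSpace H] [Countable ι] [MeasurableSpace H] [BorelSpace H]

lemma transition_eq_map (e : HilbertBasis ι ℝ H) (h : IsSpectrum eig) {t : ℝ} (ht : 0 ≤ t)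
    (x : H) : transition e eig t x = (gaussianProd ι).map (ouPoint e eig t x) := by
  rw [transition, gaussianMeasure_eq_map, ouPoint]
  congr 2
  · ext k
    exact inner_sumMap e (summable_exp_mul_inner e h ht x) k
  · ext k
    exact congrArg Real.sqrt (Real.coe_toNNReal _ (ouVar_nonneg h ht k))

lemma invMeasure_eq_map (e : HilbertBasis ι ℝ H) (h : IsSpectrum eig) :
    invMeasure e eig = (gaussianProd ι).map (invPoint e eig) := by
  rw [invMeasure, gaussianMeasure_eq_map, invPoint]
  congr 2
  · ext k; simp
  · ext k
    have := h.pos k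
    rw [Real.coe_toNNReal _ (by positivity)]

@[fun_prop]
lemma measurable_ouPoint (e : HilbertBasis ι ℝ H) (eig : ι → ℝ) (t : ℝ) (x : H) :
    Measurable (ouPoint e eig t x) := measurable_affPoint e _ _

lemma measurable_invPoint (e : HilbertBasis ι ℝ H) (eig : ι → ℝ) :
    Measurable (invPoint e eig) := measurable_affPoint e _ _

lemma measurable_ouPoint_uncurry (e : HilbertBasis ι ℝ H) (eig : ι → ℝ) :
    Measurable fun p : (ℝ × H) × (ι → ℝ) => ouPoint e eig p.1.1 p.1.2 p.2 := by
  refine (measurable_sumMap e).comp (measurable_pi_lambda _ fun k => ?_)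
  have h1 : Measurable fun p : (ℝ × H) × (ι → ℝ) => inner ℝ (e k) p.1.2 :=
    (measurable_inner_basis e k).comp (measurable_snd.comp measurable_fst)
  have h2 : Measurable fun p : (ℝ × H) × (ι → ℝ) => √(ouVar eig p.1.1 k) := by
    unfold ouVar; fun_prop
  have h3 : Measurable fun p : (ℝ × H) × (ι → ℝ) => Real.exp (-(eig k * p.1.1)) := by fun_prop
  have h4 : Measurable fun p : (ℝ × H) × (ι → ℝ) => p.2 k :=
    (measurable_pi_apply k).comp measurable_snd
  exact (h3.mul h1).add (h2.mul h4)

lemma measurable_ouPoint_prod (e : HilbertBasis ι ℝ H) (eig : ι → ℝ) (t : ℝ) :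
    Measurable fun p : H × (ι → ℝ) => ouPoint e eig t p.1 p.2 :=
  (measurable_ouPoint_uncurry e eig).comp (f := fun p : H × (ι → ℝ) => ((t, p.1), p.2))
    (by fun_prop)

lemma isProbabilityMeasure_invMeasure (e : HilbertBasis ι ℝ H) (h : IsSpectrum eig) :
    IsProbabilityMeasure (invMeasure e eig) := by
  rw [invMeasure_eq_map e h]
  exact Measure.isProbabilityMeasure_map (measurable_invPoint e eig).aemeasurable

lemma isProbabilityMeasure_transition (e : HilbertBasis ι ℝ H) (h : IsSpectrum eig) {t : ℝ}
    (ht : 0 ≤ t) (x : H) : IsProbabilityMeasure (transition e eig t x) := by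
  rw [transition_eq_map e h ht]
  exact Measure.isProbabilityMeasure_map (measurable_ouPoint e eig t x).aemeasurable

lemma ou_eq_integral {F : Type*} [NormedAddCommGroup F] [NormedSpace ℝ F]
    (e : HilbertBasis ι ℝ H) (h : IsSpectrum eig) {t : ℝ} (ht : 0 ≤ t) {φ : H → F}
    (hφ : StronglyMeasurable φ) (x : H) :
    ou e eig t φ x = ∫ ξ, φ (ouPoint e eig t x ξ) ∂(gaussianProd ι) := by
  rw [ou, transition_eq_map e h ht, integral_map (measurable_ouPoint e eig t x).aemeasurable
    hφ.aestronglyMeasurable]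

/-- The Chapman–Kolmogorov equation. -/
lemma map_ouPoint_ouPoint (e : HilbertBasis ι ℝ H) (h : IsSpectrum eig) {s t : ℝ} (hs : 0 ≤ s)
    (ht : 0 ≤ t) (x : H) :
    ((gaussianProd ι).prod (gaussianProd ι)).map
      (fun p => ouPoint e eig t (ouPoint e eig s x p.1) p.2) =
      (gaussianProd ι).map (ouPoint e eig (t + s) x) := by
  have := map_affPoint_affPoint e (fun k => Real.exp (-(eig k * t))) (fun k => √(ouVar eig t k))
    (summable_exp_mul_inner e h hs x) (summable_sqrt_ouVar h hs)
  refine this.trans ?_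
  congr 2
  · ext k
    rw [← mul_assoc, ← Real.exp_add]
    congr 2; ring
  · ext k
    congr 1
    rw [mul_pow, Real.sq_sqrt (ouVar_nonneg h hs k), Real.sq_sqrt (ouVar_nonneg h ht k),
      ouVar, ouVar, ouVar, sq, ← Real.exp_add, mul_div_assoc', ← add_div, mul_sub, ← Real.exp_add]
    congr 1
    rw [show -(eig k * t) + -(eig k * t) = -(2 * eig k * t) by ring,
      show -(2 * eig k * t) + -(2 * eig k * s) = -(2 * eig k * (t + s)) by ring]
    ring

/-- Invariance of `invMeasure`. -/
lemma map_ouPoint_invMeasure (e : HilbertBasis ι ℝ H) (h : IsSpectrum eig) {t : ℝ} (ht : 0 ≤ t) :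
    ((invMeasure e eig).prod (gaussianProd ι)).map (fun p => ouPoint e eig t p.1 p.2) =
      invMeasure e eig := by
  have h1 : (invMeasure e eig).prod (gaussianProd ι) =
      ((gaussianProd ι).prod (gaussianProd ι)).map (Prod.map (invPoint e eig) id) := by
    rw [← Measure.map_prod_map _ _ (measurable_invPoint e eig) measurable_id,
      invMeasure_eq_map e h, Measure.map_id]
  rw [h1, Measure.map_map (measurable_ouPoint_prod e eig t)
    ((measurable_invPoint e eig).prodMap measurable_id), invMeasure_eq_map e h]
  have := map_affPoint_affPoint e (fun k => Real.exp (-(eig k * t))) (fun k => √(ouVar eig t k))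
    (m := fun _ => 0) (by simp) (summable_sqrt_invVar h)
  refine this.trans ?_
  rw [invPoint]
  congr 2
  · ext k; simp
  · ext k
    have := h.pos k
    congr 1
    rw [mul_pow, Real.sq_sqrt (ouVar_nonneg h ht k), Real.sq_sqrt (by positivity), ouVar, sq,
      ← Real.exp_add, mul_div_assoc', ← add_div,
      show -(eig k * t) + -(eig k * t) = -(2 * eig k * t) by ring]
    congr 1
    ring

/-- The diagonal operator with eigenvalues `c k`. -/
def diagMap (e : HilbertBasis ι ℝ H) (c : ι → ℝ) (x : H) : H :=
  sumMap e fun k => c k * inner ℝ (e k) x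

end Transition

/-! ### Diagonal operators and the smoothing rate of the semigroup. -/

section Diagonal

variable {ι : Type*} {H : Type*} [NormedAddCommGroup H] [InnerProductSpace ℝ H] [CompleteSpace H]

lemma inner_diagMap (e : HilbertBasis ι ℝ H) {c : ι → ℝ} {C : ℝ} (hc : ∀ k, |c k| ≤ C) (x : H)
    (k : ι) : inner ℝ (e k) (diagMap e c x) = c k * inner ℝ (e k) x :=
  inner_sumMap e (summable_mul_sq hc (summable_inner_sq e x)) k

lemma norm_diagMap_le (e : HilbertBasis ι ℝ H) {c : ι → ℝ} {C : ℝ} (hC : 0 ≤ C)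
    (hc : ∀ k, |c k| ≤ C) (x : H) : ‖diagMap e c x‖ ≤ C * ‖x‖ := by
  have hs := summable_mul_sq hc (summable_inner_sq e x)
  refine le_of_sq_le_sq ?_ (by positivity)
  rw [diagMap, norm_sumMap_sq e hs, mul_pow, ← (hasSum_inner_sq e x).tsum_eq, ← tsum_mul_left]
  refine hs.tsum_le_tsum (fun k => ?_) ((summable_inner_sq e x).mul_left _)
  rw [mul_pow]
  exact mul_le_mul_of_nonneg_right
    (sq_le_sq' (neg_le_of_abs_le (hc k)) (le_of_abs_le (hc k))) (sq_nonneg _)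

lemma diagMap_add (e : HilbertBasis ι ℝ H) {c : ι → ℝ} {C : ℝ} (hc : ∀ k, |c k| ≤ C) (x y : H) :
    diagMap e c (x + y) = diagMap e c x + diagMap e c y := by
  refine ext_inner_basis e fun k => ?_
  rw [inner_add_right, inner_diagMap e hc, inner_diagMap e hc, inner_diagMap e hc, inner_add_right,
    mul_add]

lemma diagMap_smul (e : HilbertBasis ι ℝ H) {c : ι → ℝ} {C : ℝ} (hc : ∀ k, |c k| ≤ C) (a : ℝ)
    (x : H) : diagMap e c (a • x) = a • diagMap e c x := by
  refine ext_inner_basis e fun k => ?_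
  rw [inner_smul_right, inner_diagMap e hc, inner_diagMap e hc, inner_smul_right]
  ring

lemma diagMap_basis (e : HilbertBasis ι ℝ H) (c : ι → ℝ) {C : ℝ} (hc : ∀ k, |c k| ≤ C) (k : ι) :
    diagMap e c (e k) = c k • e k := by
  classical
  refine ext_inner_basis e fun j => ?_
  rw [inner_diagMap e hc, inner_smul_right, orthonormal_iff_ite.1 e.orthonormal]
  split_ifs with h
  · rw [h]
  · simp

variable {eig : ι → ℝ}

/-- The eigenvalues of `Q_t^{-1/2} e^{tA} (-A)^ε`. -/
def smoothing (eig : ι → ℝ) (ε t : ℝ) (k : ι) : ℝ :=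
  eig k ^ ε * Real.exp (-(eig k * t)) / √(ouVar eig t k)

lemma smoothing_nonneg (h : IsSpectrum eig) (ε t : ℝ) (k : ι) : 0 ≤ smoothing eig ε t k := by
  have := (h.pos k).le
  unfold smoothing; positivity

/-- The scalar core of `smoothing_le`, with s = λ_k t: s^{2ε} ≤ 1 + s because 2ε ≤ 1, and e^{2s} ≥ 1
+ 2s + 2s². -/
lemma rpow_mul_two_le {s ε : ℝ} (hs : 0 < s) (h0 : 0 ≤ ε) (h1 : ε ≤ 1 / 2) :
    s ^ (2 * ε) * (2 * s) ≤ Real.exp (2 * s) - 1 := by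
  have a1 : s ^ (2 * ε) ≤ 1 + s := by
    rcases le_total s 1 with h | h
    · have := Real.rpow_le_one hs.le h (by linarith : 0 ≤ 2 * ε); linarith
    · have := Real.rpow_le_rpow_of_exponent_le h (by linarith : 2 * ε ≤ 1)
      rw [Real.rpow_one] at this; linarith
  have a2 := Real.quadratic_le_exp_of_nonneg (by linarith : 0 ≤ 2 * s)
  nlinarith

/-- Squared and multiplied through by e^{2λ_k t}, the claim is `rpow_mul_two_le`. The rate
t^{-1/2-ε} is integrable at 0 exactly when ε < 1/2, whence the range of ε in (i). -/
lemma smoothing_le (h : IsSpectrum eig) {ε t : ℝ} (h0 : 0 ≤ ε) (h1 : ε ≤ 1 / 2) (ht : 0 < t)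
    (k : ι) : smoothing eig ε t k ≤ t ^ (-(1 / 2) - ε) := by
  have hl := h.pos k
  set l := eig k with hl'
  have hv := ouVar_pos h ht k
  have ht' : 0 ≤ t ^ (-(1 / 2) - ε) := by positivity
  refine le_of_sq_le_sq ?_ ht'
  rw [smoothing, div_pow, Real.sq_sqrt hv.le, div_le_iff₀ hv, ouVar, mul_div_assoc',
    le_div_iff₀ (by positivity), ← hl', mul_pow, ← Real.rpow_natCast (l ^ ε), ← Real.rpow_mul hl.le,
    ← Real.rpow_natCast (t ^ _), ← Real.rpow_mul ht.le, sq, ← Real.exp_add]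
  push_cast
  have key := rpow_mul_two_le (mul_pos hl ht) h0 h1
  rw [Real.mul_rpow hl.le ht.le] at key
  have e1 : t ^ ((-(1 / 2) - ε) * 2) = (t ^ (2 * ε) * t)⁻¹ := by
    rw [← Real.rpow_add_one ht.ne', ← Real.rpow_neg ht.le]; congr 1; ring
  rw [e1, mul_comm ε 2, show -(l * t) + -(l * t) = -(2 * (l * t)) by ring,
    show -(2 * l * t) = -(2 * (l * t)) by ring, inv_mul_eq_div, le_div_iff₀ (by positivity)]
  have e2 : Real.exp (-(2 * (l * t))) * Real.exp (2 * (l * t)) = 1 := by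
    rw [← Real.exp_add]; simp
  have e3 := Real.exp_pos (-(2 * (l * t)))
  nlinarith [mul_le_mul_of_nonneg_left key e3.le]

lemma abs_smoothing_le (h : IsSpectrum eig) {ε t : ℝ} (h0 : 0 ≤ ε) (h1 : ε ≤ 1 / 2) (ht : 0 < t)
    (k : ι) : |smoothing eig ε t k| ≤ t ^ (-(1 / 2) - ε) := by
  rw [abs_of_nonneg (smoothing_nonneg h ε t k)]
  exact smoothing_le h h0 h1 ht k

lemma smoothing_eq_rpow_mul {t : ℝ} (k : ι) (ε : ℝ) :
    smoothing eig ε t k = eig k ^ ε * smoothing eig 0 t k := by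
  simp only [smoothing, Real.rpow_zero, one_mul]; ring

/-- The hinge of the regularity theory: translating the starting point is translating the noise by
the bounded operator Q_t^{-1/2}e^{tA}, to which Cameron–Martin applies. -/
lemma ouPoint_add (e : HilbertBasis ι ℝ H) (h : IsSpectrum eig) {t : ℝ} (ht : 0 < t) (x z : H)
    (ξ : ι → ℝ) :
    ouPoint e eig t (x + z) ξ =
      ouPoint e eig t x fun k => ξ k + inner ℝ (e k) (diagMap e (smoothing eig 0 t) z) := by
  simp only [ouPoint, affPoint]
  congr 1
  ext k
  rw [inner_diagMap e (abs_smoothing_le h le_rfl (by norm_num) ht), inner_add_right, smoothing]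
  have := Real.sqrt_pos.2 (ouVar_pos h ht k)
  field_simp
  simp
  ring

variable [Countable ι] [MeasurableSpace H] [BorelSpace H]

/-- For `t > 0`, the transition probabilities are absolutely continuous with respect to the
invariant measure. -/
lemma transition_absolutelyContinuous (e : HilbertBasis ι ℝ H) (h : IsSpectrum eig) {t : ℝ}
    (ht : 0 < t) (x : H) : transition e eig t x ≪ invMeasure e eig := by
  have := isProbabilityMeasure_invMeasure e h
  refine Measure.AbsolutelyContinuous.mk fun N hN hN0 => ?_
  rw [← map_ouPoint_invMeasure e h ht.le, Measure.map_apply (measurable_ouPoint_prod e eig t) hN,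
    Measure.measure_prod_null (hN.preimage (measurable_ouPoint_prod e eig t))] at hN0
  -- By invariance, a μ-null set is null for the transition law from almost every point. One such x0
  -- suffices, since the laws from x0 and from x differ by a Cameron–Martin shift of the noise.
  obtain ⟨x0, hx0⟩ := hN0.exists
  rw [transition_eq_map e h ht.le, Measure.map_apply (measurable_ouPoint e eig t x) hN]
  have h1 := map_add_absolutelyContinuous
    (summable_inner_sq e (diagMap e (smoothing eig 0 t) (x - x0))) hx0
  have hS : MeasurableSet (Prod.mk x0 ⁻¹' ((fun p : H × (ι → ℝ) => ouPoint e eig t p.1 p.2) ⁻¹' N)) :=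
    (hN.preimage (measurable_ouPoint_prod e eig t)).preimage measurable_prodMk_left
  rw [Measure.map_apply (measurable_add_const_pi _) hS] at h1
  refine (congrArg _ ?_).trans h1
  ext ξ
  simp only [Set.mem_preimage]
  rw [← ouPoint_add e h ht, add_sub_cancel]

end Diagonal

/-! ### The resolvent of the Ornstein-Uhlenbeck semigroup on bounded functions -/

section ExpIntegrals

lemma integrableOn_exp_mul_rpow {lam p : ℝ} (hlam : 0 < lam) (hp : p < 1) :
    IntegrableOn (fun t : ℝ => Real.exp (-(lam * t)) * t ^ (-p)) (Set.Ioi 0) := by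
  have := integrableOn_rpow_mul_exp_neg_mul_rpow (s := -p) (p := 1) (b := lam) (by linarith)
    one_pos hlam
  refine this.congr_fun (fun t _ => ?_) measurableSet_Ioi
  simp only [Real.rpow_one]
  rw [mul_comm, neg_mul]

/-- The integral `∫₀^∞ e^{-lam t} t^{-p} dt`. -/
def expMoment (lam p : ℝ) : ℝ := ∫ t in Set.Ioi (0 : ℝ), Real.exp (-(lam * t)) * t ^ (-p)

lemma expMoment_eq {lam p : ℝ} (hlam : 0 < lam) (hp : p < 1) :
    expMoment lam p = (1 / lam) ^ (1 - p) * Real.Gamma (1 - p) := by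
  rw [← Real.integral_rpow_mul_exp_neg_mul_Ioi (by linarith) hlam, expMoment]
  refine setIntegral_congr_fun measurableSet_Ioi fun t _ => ?_
  rw [mul_comm]
  congr 2; ring

lemma expMoment_nonneg (lam p : ℝ) : 0 ≤ expMoment lam p :=
  setIntegral_nonneg measurableSet_Ioi fun _ ht =>
    mul_nonneg (Real.exp_pos _).le (Real.rpow_nonneg (le_of_lt ht) _)

variable {E : Type*} [NormedAddCommGroup E] [NormedSpace ℝ E]

lemma integrableOn_exp_smul {lam p C : ℝ} (hlam : 0 < lam) (hp : p < 1) {f : ℝ → E}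
    (hf : AEStronglyMeasurable f (volume.restrict (Set.Ioi 0)))
    (hC : ∀ t, 0 < t → ‖f t‖ ≤ C * t ^ (-p)) :
    IntegrableOn (fun t => Real.exp (-(lam * t)) • f t) (Set.Ioi 0) := by
  refine Integrable.mono' ((integrableOn_exp_mul_rpow hlam hp).const_mul C) ?_ ?_
  · exact AEStronglyMeasurable.smul (by fun_prop) hf
  · filter_upwards [ae_restrict_mem measurableSet_Ioi] with t ht
    rw [norm_smul, Real.norm_eq_abs, abs_of_pos (Real.exp_pos _), mul_left_comm]
    exact mul_le_mul_of_nonneg_left (hC t ht) (Real.exp_pos _).le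

lemma norm_integral_exp_smul_le {lam p C : ℝ} (hlam : 0 < lam) (hp : p < 1) {f : ℝ → E}
    (hC : ∀ t, 0 < t → ‖f t‖ ≤ C * t ^ (-p)) :
    ‖∫ t in Set.Ioi (0 : ℝ), Real.exp (-(lam * t)) • f t‖ ≤ C * expMoment lam p := by
  rw [expMoment, ← integral_const_mul]
  refine norm_integral_le_of_norm_le ((integrableOn_exp_mul_rpow hlam hp).const_mul C) ?_
  filter_upwards [ae_restrict_mem measurableSet_Ioi] with t ht
  rw [norm_smul, Real.norm_eq_abs, abs_of_pos (Real.exp_pos _), mul_left_comm]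
  exact mul_le_mul_of_nonneg_left (hC t ht) (Real.exp_pos _).le

end ExpIntegrals

section Resolvent

variable {ι : Type*} {H : Type*} [NormedAddCommGroup H] [InnerProductSpace ℝ H] [CompleteSpace H]
  [Countable ι] [MeasurableSpace H] [BorelSpace H]
  {E : Type*} [NormedAddCommGroup E] [NormedSpace ℝ E] {eig : ι → ℝ}

/-- `∫₀^∞ e^{-lam t} R_t g (x) dt`. -/
def resolvent (e : HilbertBasis ι ℝ H) (eig : ι → ℝ) (lam : ℝ) (g : H → E) (x : H) : E :=
  ∫ t in Set.Ioi (0 : ℝ), Real.exp (-(lam * t)) • ou e eig t g x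

/-- The derivative of `R_t g` at `x` in the direction `(-A)^ε h`, for `t > 0`. -/
def ouGrad (e : HilbertBasis ι ℝ H) (eig : ι → ℝ) (ε t : ℝ) (g : H → E) (x h : H) : E :=
  ∫ ξ, whiteNoise e (diagMap e (smoothing eig ε t) h) ξ • g (ouPoint e eig t x ξ) ∂(gaussianProd ι)

/-- The derivative of `resolvent e eig lam g` at `x` in the direction `(-A)^ε h`. -/
def resGrad (e : HilbertBasis ι ℝ H) (eig : ι → ℝ) (lam ε : ℝ) (g : H → E) (x h : H) : E :=
  ∫ t in Set.Ioi (0 : ℝ), Real.exp (-(lam * t)) • ouGrad e eig ε t g x h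

omit [NormedSpace ℝ E] in
lemma stronglyMeasurable_comp_ouPoint (e : HilbertBasis ι ℝ H) {g : H → E}
    (hg : StronglyMeasurable g) (t : ℝ) (x : H) :
    StronglyMeasurable fun ξ => g (ouPoint e eig t x ξ) :=
  hg.comp_measurable (measurable_ouPoint e eig t x)

omit [NormedSpace ℝ E] in
lemma memLp_comp_ouPoint (e : HilbertBasis ι ℝ H) {g : H → E} {K : ℝ}
    (hg : StronglyMeasurable g) (hK : ∀ x, ‖g x‖ ≤ K) (t : ℝ) (x : H) :
    MemLp (fun ξ => g (ouPoint e eig t x ξ)) 2 (gaussianProd ι) :=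
  memLp_of_bound (stronglyMeasurable_comp_ouPoint e hg t x).aestronglyMeasurable (fun _ => hK _) 2

omit [CompleteSpace H] [Countable ι] [MeasurableSpace H] [BorelSpace H] in
lemma ouGrad_eq_pairing (e : HilbertBasis ι ℝ H) {g : H → E} (ε t : ℝ) (x h : H)
    (hg : MemLp (fun ξ => g (ouPoint e eig t x ξ)) 2 (gaussianProd ι)) :
    ouGrad e eig ε t g x h = pairing _ hg (whiteNoise e (diagMap e (smoothing eig ε t) h)) := rfl

lemma norm_ou_le (e : HilbertBasis ι ℝ H) (hs : IsSpectrum eig) {t : ℝ} (ht : 0 ≤ t) {g : H → E}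
    {K : ℝ} (hK : ∀ x, ‖g x‖ ≤ K) (x : H) : ‖ou e eig t g x‖ ≤ K := by
  have := isProbabilityMeasure_transition e hs ht x
  rw [ou]
  simpa using norm_integral_le_of_norm_le_const (μ := transition e eig t x)
    (ae_of_all _ fun y => hK y)

lemma norm_ouGrad_le (e : HilbertBasis ι ℝ H) (hs : IsSpectrum eig) {ε t : ℝ} (h0 : 0 ≤ ε)
    (h1 : ε ≤ 1 / 2) (ht : 0 < t) {g : H → E} {K : ℝ} (hg : StronglyMeasurable g)
    (hK : ∀ x, ‖g x‖ ≤ K) (x h : H) :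
    ‖ouGrad e eig ε t g x h‖ ≤ K * ‖h‖ * t ^ (-(1 / 2 + ε)) := by
  have hK0 : 0 ≤ K := (norm_nonneg _).trans (hK 0)
  rw [ouGrad_eq_pairing e ε t x h (memLp_comp_ouPoint e hg hK t x)]
  refine (norm_pairing_le _ (fun _ => hK _) _).trans ?_
  rw [LinearIsometry.norm_map, mul_assoc, neg_add', mul_comm ‖h‖]
  gcongr
  exact norm_diagMap_le e (by positivity) (abs_smoothing_le hs h0 h1 ht) h

omit [Countable ι] [MeasurableSpace H] [BorelSpace H] in
lemma ouGrad_add (e : HilbertBasis ι ℝ H) (hs : IsSpectrum eig) {ε t : ℝ} (h0 : 0 ≤ ε)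
    (h1 : ε ≤ 1 / 2) (ht : 0 < t) {g : H → E}
    (x h h' : H) (hg : MemLp (fun ξ => g (ouPoint e eig t x ξ)) 2 (gaussianProd ι)) :
    ouGrad e eig ε t g x (h + h') = ouGrad e eig ε t g x h + ouGrad e eig ε t g x h' := by
  rw [ouGrad_eq_pairing e ε t x _ hg, ouGrad_eq_pairing e ε t x _ hg,
    ouGrad_eq_pairing e ε t x _ hg, diagMap_add e (abs_smoothing_le hs h0 h1 ht), map_add, map_add]

omit [Countable ι] [MeasurableSpace H] [BorelSpace H] in
lemma ouGrad_smul (e : HilbertBasis ι ℝ H) (hs : IsSpectrum eig) {ε t : ℝ} (h0 : 0 ≤ ε)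
    (h1 : ε ≤ 1 / 2) (ht : 0 < t) {g : H → E}
    (x : H) (a : ℝ) (h : H) (hg : MemLp (fun ξ => g (ouPoint e eig t x ξ)) 2 (gaussianProd ι)) :
    ouGrad e eig ε t g x (a • h) = a • ouGrad e eig ε t g x h := by
  rw [ouGrad_eq_pairing e ε t x _ hg, ouGrad_eq_pairing e ε t x _ hg,
    diagMap_smul e (abs_smoothing_le hs h0 h1 ht), map_smul, map_smul]

omit [CompleteSpace H] [Countable ι] [MeasurableSpace H] [BorelSpace H] in
lemma ouGrad_sub_fun (e : HilbertBasis ι ℝ H) {ε t : ℝ} {g g' : H → E} (x h : H)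
    (hg : MemLp (fun ξ => g (ouPoint e eig t x ξ)) 2 (gaussianProd ι))
    (hg' : MemLp (fun ξ => g' (ouPoint e eig t x ξ)) 2 (gaussianProd ι)) :
    ouGrad e eig ε t (fun y => g y - g' y) x h =
      ouGrad e eig ε t g x h - ouGrad e eig ε t g' x h := by
  simp only [ouGrad, smul_sub]
  exact integral_sub (integrable_smul_of_memLp_two (Lp.memLp _) hg)
    (integrable_smul_of_memLp_two (Lp.memLp _) hg')

-- On a basis vector the exponent ε only contributes the scalar eig k ^ ε. This links the bounded
-- operator built from `smoothing eig ε t` to (-A)^ε applied to the ordinary gradient.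
omit [Countable ι] [MeasurableSpace H] [BorelSpace H] in
lemma ouGrad_basis (e : HilbertBasis ι ℝ H) (hs : IsSpectrum eig) {ε t : ℝ} (h0 : 0 ≤ ε)
    (h1 : ε ≤ 1 / 2) (ht : 0 < t) (g : H → E) (x : H) (k : ι) :
    ouGrad e eig ε t g x (e k) = eig k ^ ε • ouGrad e eig 0 t g x (e k) := by
  rw [ouGrad, ouGrad, diagMap_basis e _ (abs_smoothing_le hs h0 h1 ht),
    diagMap_basis e _ (abs_smoothing_le hs le_rfl (by norm_num) ht), smoothing_eq_rpow_mul,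
    mul_smul, map_smul, ← integral_smul]
  refine integral_congr_ae ?_
  filter_upwards [Lp.coeFn_smul (eig k ^ ε) (whiteNoise e (smoothing eig 0 t k • e k))] with ξ hξ
  rw [hξ, Pi.smul_apply, smul_eq_mul, mul_smul]

/-- The direction h costs t^{-1/2-ε}; the translation by z enters to the power θ and costs a further
t^{-θ/2}. -/
lemma norm_ouGrad_sub_le (e : HilbertBasis ι ℝ H) (hs : IsSpectrum eig) {ε t θ : ℝ} (h0 : 0 ≤ ε)
    (h1 : ε ≤ 1 / 2) (hθ0 : 0 ≤ θ) (hθ1 : θ ≤ 1) (ht : 0 < t) {g : H → E} {K : ℝ}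
    (hg : StronglyMeasurable g) (hK : ∀ x, ‖g x‖ ≤ K) (x z h : H) :
    ‖ouGrad e eig ε t g (x + z) h - ouGrad e eig ε t g x h‖ ≤
      3 * K * ‖z‖ ^ θ * ‖h‖ * t ^ (-(1 / 2 + ε + θ / 2)) := by
  have hK0 : 0 ≤ K := (norm_nonneg _).trans (hK 0)
  have key := norm_pairing_shift_sub_le e (diagMap e (smoothing eig ε t) h)
    (diagMap e (smoothing eig 0 t) z) (stronglyMeasurable_comp_ouPoint (eig := eig) e hg t x)
    (memLp_comp_ouPoint e hg hK t x) (fun _ => hK _) hθ0 hθ1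
  have e1 : ouGrad e eig ε t g (x + z) h =
      pairing _ (memLp_comp_shift
        (fun k => inner ℝ (e k) (diagMap e (smoothing eig 0 t) z))
        (stronglyMeasurable_comp_ouPoint (eig := eig) e hg t x) (fun _ => hK _))
        (whiteNoise e (diagMap e (smoothing eig ε t) h)) := by
    rw [pairing_apply, ouGrad]
    simp_rw [ouPoint_add e hs ht x z]
  rw [e1, ouGrad_eq_pairing e ε t x h (memLp_comp_ouPoint e hg hK t x)]
  refine key.trans ?_
  have b1 := norm_diagMap_le e (by positivity) (abs_smoothing_le hs h0 h1 ht) h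
  have b2 := norm_diagMap_le e (by positivity)
    (abs_smoothing_le hs le_rfl (by norm_num) ht) z
  calc _ ≤ 3 * K * (t ^ (-(1 / 2) - 0 : ℝ) * ‖z‖) ^ θ * (t ^ (-(1 / 2) - ε) * ‖h‖) := by
        gcongr
    _ = 3 * K * ‖z‖ ^ θ * ‖h‖ * (t ^ ((-(1 / 2) - 0 : ℝ) * θ) * t ^ (-(1 / 2) - ε)) := by
        rw [Real.mul_rpow (by positivity) (norm_nonneg _), ← Real.rpow_mul ht.le]
        ring
    _ = _ := by
        rw [← Real.rpow_add ht]
        congr 2; ring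

/-- The noise shift has norm at most t^{-1/2}‖z‖, and its power 3/2 leaves t^{-3/4}, integrable at
0. A full second-order remainder would cost the non-integrable t^{-1}. -/
lemma norm_ou_sub_sub_le (e : HilbertBasis ι ℝ H) (hs : IsSpectrum eig) {t : ℝ} (ht : 0 < t)
    {g : H → E} {K : ℝ} (hg : StronglyMeasurable g) (hK : ∀ x, ‖g x‖ ≤ K) (x z : H) :
    ‖ou e eig t g (x + z) - ou e eig t g x - ouGrad e eig 0 t g x z‖ ≤
      3 * K * ‖z‖ ^ (3 / 2 : ℝ) * t ^ (-(3 / 4) : ℝ) := by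
  have hK0 : 0 ≤ K := (norm_nonneg _).trans (hK 0)
  have key := norm_shift_sub_sub_le e (diagMap e (smoothing eig 0 t) z)
    (stronglyMeasurable_comp_ouPoint (eig := eig) e hg t x)
    (memLp_comp_ouPoint e hg hK t x) (fun _ => hK _)
  rw [ou_eq_integral e hs ht.le hg, ou_eq_integral e hs ht.le hg]
  simp_rw [ouPoint_add e hs ht x z]
  refine key.trans ?_
  have b2 := norm_diagMap_le e (by positivity)
    (abs_smoothing_le hs le_rfl (by norm_num) ht) z
  calc _ ≤ 3 * K * (t ^ (-(1 / 2) - 0 : ℝ) * ‖z‖) ^ (3 / 2 : ℝ) := by gcongr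
    _ = _ := by
        rw [Real.mul_rpow (by positivity) (norm_nonneg _), ← Real.rpow_mul ht.le, sub_zero,
          show (-(1 / 2) * (3 / 2) : ℝ) = -(3 / 4) by norm_num]
        ring

lemma aestronglyMeasurable_ou (e : HilbertBasis ι ℝ H) (hs : IsSpectrum eig) {g : H → E}
    (hg : StronglyMeasurable g) (x : H) :
    AEStronglyMeasurable (fun t => ou e eig t g x) (volume.restrict (Set.Ioi 0)) := by
  have h1 : StronglyMeasurable fun t => ∫ ξ, g (ouPoint e eig t x ξ) ∂(gaussianProd ι) := by
    refine StronglyMeasurable.integral_prod_right (ν := gaussianProd ι)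
      (f := fun t ξ => g (ouPoint e eig t x ξ)) ?_
    exact hg.comp_measurable ((measurable_ouPoint_uncurry e eig).comp
      (f := fun p : ℝ × (ι → ℝ) => ((p.1, x), p.2)) (by fun_prop))
  refine h1.aestronglyMeasurable.congr ?_
  filter_upwards [ae_restrict_mem measurableSet_Ioi] with t ht
  rw [ou_eq_integral e hs (le_of_lt ht) hg]

/-- The white noise in `ouGrad` is an L² class varying with t, so joint measurability is not
immediate. Expanded along the basis, the integral is for each t > 0 a limit of finite sums whose
terms are measurable in t. -/
lemma aestronglyMeasurable_ouGrad (e : HilbertBasis ι ℝ H) (hs : IsSpectrum eig) {ε : ℝ}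
    (h0 : 0 ≤ ε) (h1 : ε ≤ 1 / 2) {g : H → E} {K : ℝ} (hg : StronglyMeasurable g)
    (hK : ∀ x, ‖g x‖ ≤ K) (x h : H) :
    AEStronglyMeasurable (fun t => ouGrad e eig ε t g x h) (volume.restrict (Set.Ioi 0)) := by
  have hG : ∀ k, StronglyMeasurable fun t =>
      ∫ ξ, ξ k • g (ouPoint e eig t x ξ) ∂(gaussianProd ι) := by
    intro k
    refine StronglyMeasurable.integral_prod_right (ν := gaussianProd ι)
      (f := fun t ξ => ξ k • g (ouPoint e eig t x ξ)) ?_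
    refine StronglyMeasurable.smul (f := fun p : ℝ × (ι → ℝ) => p.2 k)
      (Measurable.stronglyMeasurable (by fun_prop)) ?_
    exact hg.comp_measurable ((measurable_ouPoint_uncurry e eig).comp
      (f := fun p : ℝ × (ι → ℝ) => ((p.1, x), p.2)) (by fun_prop))
  refine aestronglyMeasurable_of_tendsto_ae (atTop : Filter (Finset ι))
    (f := fun s t => ∑ k ∈ s, (smoothing eig ε t k * inner ℝ (e k) h) •
      ∫ ξ, ξ k • g (ouPoint e eig t x ξ) ∂(gaussianProd ι)) (fun s => ?_) ?_
  · refine (Finset.stronglyMeasurable_fun_sum s fun k _ => ?_).aestronglyMeasurable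
    refine StronglyMeasurable.smul (Measurable.stronglyMeasurable ?_) (hG k)
    unfold smoothing ouVar
    fun_prop
  · filter_upwards [ae_restrict_mem measurableSet_Ioi] with t ht
    have hF := memLp_comp_ouPoint (eig := eig) e hg hK t x
    have hsum := (hasSum_whiteNoise e (diagMap e (smoothing eig ε t) h)).mapL (pairing _ hF)
    rw [ouGrad_eq_pairing e ε t x h hF]
    refine HasSum.congr_fun hsum fun k => ?_
    rw [map_smul, inner_diagMap e (abs_smoothing_le hs h0 h1 ht), chaos, pairing_toLp]
    rfl

lemma integrableOn_ou (e : HilbertBasis ι ℝ H) (hs : IsSpectrum eig) {lam : ℝ} (hlam : 0 < lam)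
    {g : H → E} {K : ℝ} (hg : StronglyMeasurable g) (hK : ∀ x, ‖g x‖ ≤ K) (x : H) :
    IntegrableOn (fun t => Real.exp (-(lam * t)) • ou e eig t g x) (Set.Ioi 0) :=
  integrableOn_exp_smul (p := 0) (C := K) hlam one_pos (aestronglyMeasurable_ou e hs hg x)
    fun t ht => by simpa using norm_ou_le e hs (le_of_lt ht) hK x

lemma integrableOn_ouGrad (e : HilbertBasis ι ℝ H) (hs : IsSpectrum eig) {lam ε : ℝ}
    (hlam : 0 < lam) (h0 : 0 ≤ ε) (h1 : ε < 1 / 2)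
    {g : H → E} {K : ℝ} (hg : StronglyMeasurable g) (hK : ∀ x, ‖g x‖ ≤ K) (x h : H) :
    IntegrableOn (fun t => Real.exp (-(lam * t)) • ouGrad e eig ε t g x h) (Set.Ioi 0) :=
  integrableOn_exp_smul (p := 1 / 2 + ε) hlam (by linarith)
    (aestronglyMeasurable_ouGrad e hs h0 h1.le hg hK x h)
    fun t ht => norm_ouGrad_le e hs h0 h1.le ht hg hK x h

lemma norm_resolvent_le (e : HilbertBasis ι ℝ H) (hs : IsSpectrum eig) {lam : ℝ} (hlam : 0 < lam)
    {g : H → E} {K : ℝ} (hK : ∀ x, ‖g x‖ ≤ K) (x : H) :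
    ‖resolvent e eig lam g x‖ ≤ K * expMoment lam 0 :=
  norm_integral_exp_smul_le hlam one_pos
    fun t ht => by simpa using norm_ou_le e hs (le_of_lt ht) hK x

lemma norm_resGrad_le (e : HilbertBasis ι ℝ H) (hs : IsSpectrum eig) {lam ε : ℝ}
    (hlam : 0 < lam) (h0 : 0 ≤ ε) (h1 : ε < 1 / 2)
    {g : H → E} {K : ℝ} (hg : StronglyMeasurable g) (hK : ∀ x, ‖g x‖ ≤ K) (x h : H) :
    ‖resGrad e eig lam ε g x h‖ ≤ K * expMoment lam (1 / 2 + ε) * ‖h‖ :=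
  (norm_integral_exp_smul_le hlam (by linarith)
    fun t ht => norm_ouGrad_le e hs h0 h1.le ht hg hK x h).trans_eq (by ring)

/-- `resGrad` as a continuous linear map. -/
def resGradL (e : HilbertBasis ι ℝ H) (hs : IsSpectrum eig) {lam ε : ℝ}
    (hlam : 0 < lam) (h0 : 0 ≤ ε) (h1 : ε < 1 / 2)
    {g : H → E} {K : ℝ} (hg : StronglyMeasurable g) (hK : ∀ x, ‖g x‖ ≤ K) (x : H) : H →L[ℝ] E :=
  LinearMap.mkContinuous
    { toFun := resGrad e eig lam ε g x
      map_add' := fun h h' => by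
        rw [resGrad, resGrad, resGrad, ← integral_add (integrableOn_ouGrad e hs hlam h0 h1 hg hK x h)
          (integrableOn_ouGrad e hs hlam h0 h1 hg hK x h')]
        refine setIntegral_congr_fun measurableSet_Ioi fun t ht => ?_
        rw [ouGrad_add e hs h0 h1.le ht x h h' (memLp_comp_ouPoint e hg hK t x), smul_add]
      map_smul' := fun a h => by
        rw [resGrad, resGrad, RingHom.id_apply, ← integral_smul]
        refine setIntegral_congr_fun measurableSet_Ioi fun t ht => ?_
        rw [ouGrad_smul e hs h0 h1.le ht x a h (memLp_comp_ouPoint e hg hK t x), smul_comm] }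
    (K * expMoment lam (1 / 2 + ε)) fun h => norm_resGrad_le e hs hlam h0 h1 hg hK x h

@[simp]
lemma resGradL_apply (e : HilbertBasis ι ℝ H) (hs : IsSpectrum eig) {lam ε : ℝ}
    (hlam : 0 < lam) (h0 : 0 ≤ ε) (h1 : ε < 1 / 2)
    {g : H → E} {K : ℝ} (hg : StronglyMeasurable g) (hK : ∀ x, ‖g x‖ ≤ K) (x h : H) :
    resGradL e hs hlam h0 h1 hg hK x h = resGrad e eig lam ε g x h := rfl

lemma norm_resGradL_le (e : HilbertBasis ι ℝ H) (hs : IsSpectrum eig) {lam ε : ℝ}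
    (hlam : 0 < lam) (h0 : 0 ≤ ε) (h1 : ε < 1 / 2)
    {g : H → E} {K : ℝ} (hg : StronglyMeasurable g) (hK : ∀ x, ‖g x‖ ≤ K) (x : H) :
    ‖resGradL e hs hlam h0 h1 hg hK x‖ ≤ K * expMoment lam (1 / 2 + ε) :=
  LinearMap.mkContinuous_norm_le _
    (mul_nonneg ((norm_nonneg _).trans (hK 0)) (expMoment_nonneg _ _)) _

/-- The choice θ = 1/2 - ε is positive, so it gives continuity in x, and it turns the time exponent
1/2 + ε + θ/2 into 3/4 + ε/2 < 1. -/
lemma norm_resGradL_sub_le (e : HilbertBasis ι ℝ H) (hs : IsSpectrum eig) {lam ε : ℝ}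
    (hlam : 0 < lam) (h0 : 0 ≤ ε) (h1 : ε < 1 / 2)
    {g : H → E} {K : ℝ} (hg : StronglyMeasurable g) (hK : ∀ x, ‖g x‖ ≤ K) (x z : H) :
    ‖resGradL e hs hlam h0 h1 hg hK (x + z) - resGradL e hs hlam h0 h1 hg hK x‖ ≤
      3 * K * expMoment lam (3 / 4 + ε / 2) * ‖z‖ ^ (1 / 2 - ε) := by
  have hK0 : 0 ≤ K := (norm_nonneg _).trans (hK 0)
  have hm := expMoment_nonneg lam (3 / 4 + ε / 2)
  refine ContinuousLinearMap.opNorm_le_bound _ (by positivity) fun h => ?_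
  rw [_root_.sub_apply, resGradL_apply, resGradL_apply, resGrad, resGrad,
    ← integral_sub (integrableOn_ouGrad e hs hlam h0 h1 hg hK _ h)
      (integrableOn_ouGrad e hs hlam h0 h1 hg hK x h)]
  simp_rw [← smul_sub]
  refine (norm_integral_exp_smul_le hlam (by linarith : 3 / 4 + ε / 2 < 1)
    (C := 3 * K * ‖z‖ ^ (1 / 2 - ε) * ‖h‖) fun t ht => ?_).trans_eq (by ring)
  refine (norm_ouGrad_sub_le e hs h0 h1.le (by linarith : 0 ≤ 1 / 2 - ε) (by linarith) ht hg hK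
    x z h).trans_eq ?_
  congr 2; ring

lemma continuous_resGradL (e : HilbertBasis ι ℝ H) (hs : IsSpectrum eig) {lam ε : ℝ}
    (hlam : 0 < lam) (h0 : 0 ≤ ε) (h1 : ε < 1 / 2)
    {g : H → E} {K : ℝ} (hg : StronglyMeasurable g) (hK : ∀ x, ‖g x‖ ≤ K) :
    Continuous (resGradL e hs hlam h0 h1 hg hK) := by
  rw [continuous_iff_continuousAt]
  intro x
  rw [ContinuousAt, tendsto_iff_norm_sub_tendsto_zero]
  have hc : Continuous fun y : H =>
      3 * K * expMoment lam (3 / 4 + ε / 2) * ‖y - x‖ ^ (1 / 2 - ε) :=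
    continuous_const.mul ((continuous_norm.comp (continuous_sub_right x)).rpow_const
      fun _ => .inr (by linarith))
  have ht := hc.tendsto x
  simp only [sub_self, norm_zero, Real.zero_rpow (by linarith : 1 / 2 - ε ≠ 0), mul_zero] at ht
  refine squeeze_zero (fun _ => norm_nonneg _) (fun y => ?_) ht
  have := norm_resGradL_sub_le e hs hlam h0 h1 hg hK x (y - x)
  rwa [add_sub_cancel] at this

/-- The first-order expansion of R_t g is integrated against e^{-λt}. Its remainder is O(‖z‖^{3/2})
= o(‖z‖), because t^{-3/4} is integrable at 0. -/
lemma hasFDerivAt_resolvent (e : HilbertBasis ι ℝ H) (hs : IsSpectrum eig) {lam : ℝ}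
    (hlam : 0 < lam) {g : H → E} {K : ℝ} (hg : StronglyMeasurable g) (hK : ∀ x, ‖g x‖ ≤ K)
    (x : H) : HasFDerivAt (resolvent e eig lam g)
      (resGradL e hs hlam le_rfl one_half_pos hg hK x) x := by
  rw [hasFDerivAt_iff_isLittleO_nhds_zero]
  have hO : (fun z : H => resolvent e eig lam g (x + z) - resolvent e eig lam g x -
      resGradL e hs hlam le_rfl one_half_pos hg hK x z) =O[𝓝 0]
      fun z => ‖z‖ ^ (3 / 2 : ℝ) := by
    refine Asymptotics.IsBigO.of_bound (3 * K * expMoment lam (3 / 4)) (Eventually.of_forall fun z => ?_)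
    have hI : IntegrableOn (fun t => Real.exp (-(lam * t)) • ou e eig t g (x + z) -
        Real.exp (-(lam * t)) • ou e eig t g x) (Set.Ioi 0) :=
      (integrableOn_ou e hs hlam hg hK _).sub (integrableOn_ou e hs hlam hg hK _)
    rw [resGradL_apply, resolvent, resolvent, resGrad,
      ← integral_sub (integrableOn_ou e hs hlam hg hK _) (integrableOn_ou e hs hlam hg hK _),
      ← integral_sub hI
        (integrableOn_ouGrad e hs hlam le_rfl one_half_pos hg hK x z)]
    simp_rw [← smul_sub]
    rw [Real.norm_of_nonneg (by positivity)]
    refine (norm_integral_exp_smul_le hlam (by norm_num : (3 / 4 : ℝ) < 1)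
      fun t ht => norm_ou_sub_sub_le e hs ht hg hK x z).trans_eq (by ring)
  refine hO.trans_isLittleO ?_
  rw [Asymptotics.isLittleO_iff]
  intro c hc
  have hc' : Tendsto (fun z : H => ‖z‖ ^ (1 / 2 : ℝ)) (𝓝 0) (𝓝 0) := by
    have : Continuous fun z : H => ‖z‖ ^ (1 / 2 : ℝ) :=
      continuous_norm.rpow_const fun _ => .inr (by norm_num)
    simpa using this.tendsto 0
  filter_upwards [hc'.eventually (gt_mem_nhds hc)] with z hz
  rw [Real.norm_of_nonneg (by positivity)]
  have : ‖z‖ ^ (3 / 2 : ℝ) = ‖z‖ ^ (1 / 2 : ℝ) * ‖z‖ := by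
    rw [← Real.rpow_add_one' (norm_nonneg _) (by norm_num)]; norm_num
  rw [this]
  gcongr

lemma isC1b_resolvent (e : HilbertBasis ι ℝ H) (hs : IsSpectrum eig) {lam : ℝ}
    (hlam : 0 < lam) {g : H → E} {K : ℝ} (hg : StronglyMeasurable g) (hK : ∀ x, ‖g x‖ ≤ K) :
    IsC1b (resolvent e eig lam g) where
  contDiff := by
    rw [contDiff_one_iff_fderiv]
    refine ⟨fun x => (hasFDerivAt_resolvent e hs hlam hg hK x).differentiableAt, ?_⟩
    have : fderiv ℝ (resolvent e eig lam g) = resGradL e hs hlam le_rfl one_half_pos hg hK :=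
      funext fun x => (hasFDerivAt_resolvent e hs hlam hg hK x).fderiv
    rw [this]
    exact continuous_resGradL e hs hlam le_rfl one_half_pos hg hK
  bounded := ⟨_, norm_resolvent_le e hs hlam hK⟩
  bounded_fderiv := ⟨K * expMoment lam (1 / 2 + 0), fun x => by
    rw [(hasFDerivAt_resolvent e hs hlam hg hK x).fderiv]
    exact norm_resGradL_le e hs hlam le_rfl one_half_pos hg hK x⟩

/-- Linearity in g: the difference is the operator of g - g'. This is the estimate behind the
contraction. -/
lemma resGradL_sub (e : HilbertBasis ι ℝ H) (hs : IsSpectrum eig) {lam ε : ℝ}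
    (hlam : 0 < lam) (h0 : 0 ≤ ε) (h1 : ε < 1 / 2) {g g' : H → E} {K K' C : ℝ}
    (hg : StronglyMeasurable g) (hK : ∀ x, ‖g x‖ ≤ K) (hg' : StronglyMeasurable g')
    (hK' : ∀ x, ‖g' x‖ ≤ K') (hC : ∀ x, ‖g x - g' x‖ ≤ C) (x : H) :
    ‖resGradL e hs hlam h0 h1 hg hK x - resGradL e hs hlam h0 h1 hg' hK' x‖ ≤
      C * expMoment lam (1 / 2 + ε) := by
  have : resGradL e hs hlam h0 h1 hg hK x - resGradL e hs hlam h0 h1 hg' hK' x =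
      resGradL e hs hlam h0 h1 (hg.sub hg') hC x := by
    ext h
    rw [_root_.sub_apply, resGradL_apply, resGradL_apply, resGradL_apply, resGrad, resGrad, resGrad,
      ← integral_sub (integrableOn_ouGrad e hs hlam h0 h1 hg hK _ h)
      (integrableOn_ouGrad e hs hlam h0 h1 hg' hK' x h)]
    refine setIntegral_congr_fun measurableSet_Ioi fun t ht => ?_
    rw [← smul_sub, ← ouGrad_sub_fun e x h (memLp_comp_ouPoint e hg hK t x)
      (memLp_comp_ouPoint e hg' hK' t x)]
    rfl
  rw [this]
  exact norm_resGradL_le _ _ _ _ _ _ _ _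

omit [Countable ι] [MeasurableSpace H] [BorelSpace H] in
lemma resGrad_basis (e : HilbertBasis ι ℝ H) (hs : IsSpectrum eig) {lam ε : ℝ} (h0 : 0 ≤ ε)
    (h1 : ε ≤ 1 / 2) (g : H → E) (x : H) (k : ι) :
    resGrad e eig lam ε g x (e k) = eig k ^ ε • resGrad e eig lam 0 g x (e k) := by
  rw [resGrad, resGrad, ← integral_smul]
  refine setIntegral_congr_fun measurableSet_Ioi fun t ht => ?_
  rw [ouGrad_basis e hs h0 h1 ht, smul_comm]

/-- It makes the fixed point equation insensitive to the values of the drift on a μ-null set. -/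
lemma ou_congr_ae (e : HilbertBasis ι ℝ H) (hs : IsSpectrum eig) {t : ℝ} (ht : 0 < t)
    {g g' : H → E} (h : g =ᵐ[invMeasure e eig] g') (x : H) : ou e eig t g x = ou e eig t g' x :=
  integral_congr_ae ((transition_absolutelyContinuous e hs ht x).ae_le h)

end Resolvent

/-! ### The fractional gradient of a resolvent -/

section FractionalGradient

variable {ι : Type*} {H : Type*} [NormedAddCommGroup H] [InnerProductSpace ℝ H] [CompleteSpace H]

lemma inner_gradient_coord {u : H → H} {x : H} (hu : DifferentiableAt ℝ u x) (a b : H) :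
    inner ℝ b (gradient (fun y => inner ℝ (u y) a) x) = inner ℝ (fderiv ℝ u x b) a := by
  have h1 : HasFDerivAt (fun y => inner ℝ (u y) a) ((innerSL ℝ a).comp (fderiv ℝ u x)) x := by
    have := (innerSL ℝ a).hasFDerivAt.comp x hu.hasFDerivAt
    refine this.congr_of_eventuallyEq (Eventually.of_forall fun y => ?_)
    simp [real_inner_comm]
  rw [gradient, h1.fderiv, real_inner_comm, InnerProductSpace.toDual_symm_apply]
  simp [real_inner_comm]

variable [Countable ι] [MeasurableSpace H] [BorelSpace H] {eig : ι → ℝ}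

/-- The weighted coordinates of the gradient are those of a genuine vector of H, an adjoint of a
bounded operator applied to e k. Membership in the domain of (-A)^ε and convergence of the series in
(i) follow from this. -/
lemma rpow_mul_inner_gradient (e : HilbertBasis ι ℝ H) (hs : IsSpectrum eig) {lam ε : ℝ}
    (hlam : 0 < lam) (h0 : 0 ≤ ε) (h1 : ε < 1 / 2) {g : H → H} {K : ℝ}
    (hg : StronglyMeasurable g) (hK : ∀ x, ‖g x‖ ≤ K) (x : H) (j k : ι) :
    eig j ^ ε * inner ℝ (e j) (gradient (fun y => inner ℝ (resolvent e eig lam g y) (e k)) x) =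
      inner ℝ (e j) ((resGradL e hs hlam h0 h1 hg hK x).adjoint (e k)) := by
  have hd := hasFDerivAt_resolvent e hs hlam hg hK x
  rw [inner_gradient_coord hd.differentiableAt, hd.fderiv, ContinuousLinearMap.adjoint_inner_right,
    resGradL_apply, resGradL_apply, resGrad_basis e hs h0 h1.le, real_inner_smul_left]

lemma gradient_mem_powDomain (e : HilbertBasis ι ℝ H) (hs : IsSpectrum eig) {lam ε : ℝ}
    (hlam : 0 < lam) (h0 : 0 ≤ ε) (h1 : ε < 1 / 2) {g : H → H} {K : ℝ}
    (hg : StronglyMeasurable g) (hK : ∀ x, ‖g x‖ ≤ K) (x : H) (k : ι) :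
    gradient (fun y => inner ℝ (resolvent e eig lam g y) (e k)) x ∈ powDomain e eig ε := by
  rw [powDomain, Set.mem_ofPred_eq]
  simp_rw [rpow_mul_inner_gradient e hs hlam h0 h1 hg hK]
  exact summable_inner_sq e _

lemma powGrad_resolvent (e : HilbertBasis ι ℝ H) (hs : IsSpectrum eig) {lam ε : ℝ}
    (hlam : 0 < lam) (h0 : 0 ≤ ε) (h1 : ε < 1 / 2) {g : H → H} {K : ℝ}
    (hg : StronglyMeasurable g) (hK : ∀ x, ‖g x‖ ≤ K) (x : H) (k : ι) :
    powGrad e eig ε (resolvent e eig lam g) x k =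
      (resGradL e hs hlam h0 h1 hg hK x).adjoint (e k) := by
  rw [powGrad, negPow]
  simp_rw [rpow_mul_inner_gradient e hs hlam h0 h1 hg hK]
  exact sumMap_inner e _

lemma hasSum_powGrad_resolvent (e : HilbertBasis ι ℝ H) (hs : IsSpectrum eig) {lam ε : ℝ}
    (hlam : 0 < lam) (h0 : 0 ≤ ε) (h1 : ε < 1 / 2) {g : H → H} {K : ℝ}
    (hg : StronglyMeasurable g) (hK : ∀ x, ‖g x‖ ≤ K) (x h : H) :
    HasSum (fun k => inner ℝ (powGrad e eig ε (resolvent e eig lam g) x k) h • e k)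
      (resGradL e hs hlam h0 h1 hg hK x h) := by
  refine (e.hasSum_repr _).congr_fun fun k => ?_
  rw [powGrad_resolvent e hs hlam h0 h1 hg hK, ContinuousLinearMap.adjoint_inner_left,
    e.repr_apply_apply]

end FractionalGradient

/-! ### The fixed point equation -/

section FixedPoint

variable {ι : Type*} {H : Type*} [NormedAddCommGroup H] [InnerProductSpace ℝ H] [CompleteSpace H]
  [Countable ι] [MeasurableSpace H] [BorelSpace H] [SecondCountableTopology H] {eig : ι → ℝ}

/-- The function `V B + B`. -/
def driftFun (V : H → H →L[ℝ] H) (B : H → H) (y : H) : H := V y (B y) + B y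

omit [CompleteSpace H] in
lemma stronglyMeasurable_driftFun {V : H → H →L[ℝ] H} (hV : Continuous V) {B : H → H}
    (hB : Measurable B) : StronglyMeasurable (driftFun V B) := by
  have h1 : Continuous fun p : H × H => V p.1 p.2 :=
    (hV.comp continuous_fst).clm_apply continuous_snd
  have h2 : Measurable fun y => V y (B y) := h1.measurable.comp (measurable_id.prodMk hB)
  exact (h2.add hB).stronglyMeasurable

omit [CompleteSpace H] [MeasurableSpace H] [BorelSpace H] [SecondCountableTopology H] in
lemma norm_driftFun_le {V : H → H →L[ℝ] H} {c M : ℝ} (hc : ∀ y, ‖V y‖ ≤ c) {B : H → H}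
    (hB : ∀ y, ‖B y‖ ≤ M) (y : H) : ‖driftFun V B y‖ ≤ (c + 1) * M := by
  have h1 := ((V y).le_opNorm (B y)).trans
    (mul_le_mul (hc y) (hB y) (norm_nonneg _) ((norm_nonneg _).trans (hc y)))
  have := (norm_add_le (V y (B y)) (B y)).trans (add_le_add h1 (hB y))
  rw [driftFun]; linarith

/-- The map whose fixed point is the derivative of the solution. -/
def derivMap (e : HilbertBasis ι ℝ H) (hs : IsSpectrum eig) {lam : ℝ} (hlam : 0 < lam) {B : H → H}
    {M : ℝ} (hB : Measurable B) (hM : ∀ x, ‖B x‖ ≤ M)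
    (V : BoundedContinuousFunction H (H →L[ℝ] H)) : BoundedContinuousFunction H (H →L[ℝ] H) :=
  BoundedContinuousFunction.ofNormedAddCommGroup
    (resGradL e hs hlam le_rfl one_half_pos (stronglyMeasurable_driftFun V.continuous hB)
      (norm_driftFun_le V.norm_coe_le_norm hM))
    (continuous_resGradL _ _ _ _ _ _ _) _ (norm_resGradL_le _ _ _ _ _ _ _)

/-- The map is affine in V; its linear part sends V to the derivative of the resolvent of VB and has
norm at most M `expMoment lam (1 / 2)`. -/
lemma contractingWith_derivMap (e : HilbertBasis ι ℝ H) (hs : IsSpectrum eig) {lam : ℝ}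
    (hlam : 0 < lam) {B : H → H} {M : ℝ} (hB : Measurable B) (hM : ∀ x, ‖B x‖ ≤ M)
    (hlM : 2 * M * expMoment lam (1 / 2) ≤ 1) :
    ContractingWith (1 / 2) (derivMap e hs hlam hB hM) := by
  have hM0 : 0 ≤ M := (norm_nonneg _).trans (hM 0)
  have hm := expMoment_nonneg lam (1 / 2)
  refine ⟨by rw [div_lt_one (by norm_num)]; norm_num, LipschitzWith.of_dist_le_mul fun V V' => ?_⟩
  rw [BoundedContinuousFunction.dist_le (by positivity)]
  intro x
  rw [dist_eq_norm]
  have hC : ∀ y, ‖driftFun V B y - driftFun V' B y‖ ≤ dist V V' * M := by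
    intro y
    rw [driftFun, driftFun, add_sub_add_right_eq_sub, ← _root_.sub_apply]
    refine ((V y - V' y).le_opNorm (B y)).trans ?_
    refine mul_le_mul ?_ (hM y) (norm_nonneg _) dist_nonneg
    rw [← dist_eq_norm]
    exact BoundedContinuousFunction.dist_coe_le_dist y
  refine (resGradL_sub e hs hlam le_rfl one_half_pos
    (stronglyMeasurable_driftFun V.continuous hB) (norm_driftFun_le V.norm_coe_le_norm hM)
    (stronglyMeasurable_driftFun V'.continuous hB) (norm_driftFun_le V'.norm_coe_le_norm hM) hC x).trans ?_
  rw [add_zero]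
  push_cast
  nlinarith [dist_nonneg (x := V) (y := V')]

/-- Existence and uniqueness for the fixed point equation with an everywhere bounded drift. -/
lemma exists_eq_resolvent (e : HilbertBasis ι ℝ H) (hs : IsSpectrum eig) {lam : ℝ}
    (hlam : 0 < lam) {B : H → H} {M : ℝ} (hB : Measurable B) (hM : ∀ x, ‖B x‖ ≤ M)
    (hlM : 2 * M * expMoment lam (1 / 2) ≤ 1) :
    ∃ u : H → H, IsC1b u ∧ (∀ x, ‖fderiv ℝ u x‖ ≤ 1) ∧
      u = resolvent e eig lam (driftFun (fderiv ℝ u) B) ∧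
      ∀ v, IsC1b v → v = resolvent e eig lam (driftFun (fderiv ℝ v) B) → v = u := by
  have hM0 : 0 ≤ M := (norm_nonneg _).trans (hM 0)
  have hm := expMoment_nonneg lam (1 / 2)
  have hcon := contractingWith_derivMap e hs hlam hB hM hlM
  set V := hcon.fixedPoint with hV
  have hfix : derivMap e hs hlam hB hM V = V := hcon.fixedPoint_isFixedPt
  have hgm := stronglyMeasurable_driftFun V.continuous hB
  have hgb := norm_driftFun_le V.norm_coe_le_norm hM
  set u := resolvent e eig lam (driftFun V B) with hu
  have hder : fderiv ℝ u = V := by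
    ext1 x
    rw [hu, (hasFDerivAt_resolvent e hs hlam hgm hgb x).fderiv]
    exact congrArg (fun W : BoundedContinuousFunction H (H →L[ℝ] H) => W x) hfix
  -- The fixed point satisfies ‖V‖ ≤ (‖V‖ + 1)/2.
  have hV1 : ‖V‖ ≤ 1 := by
    have h1 : ‖V‖ ≤ (‖V‖ + 1) * M * expMoment lam (1 / 2) := by
      refine (BoundedContinuousFunction.norm_le (by positivity)).2 fun x => ?_
      rw [← hder, hu, (hasFDerivAt_resolvent e hs hlam hgm hgb x).fderiv]
      have := norm_resGradL_le e hs hlam le_rfl one_half_pos hgm hgb x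
      rwa [add_zero] at this
    nlinarith [norm_nonneg V]
  refine ⟨u, isC1b_resolvent e hs hlam hgm hgb, fun x => ?_, ?_, fun v hv hvr => ?_⟩
  · rw [hder]; exact (V.norm_coe_le_norm x).trans hV1
  · rw [hder]
  · obtain ⟨K, hK⟩ := hv.bounded_fderiv
    have hc : Continuous (fderiv ℝ v) := hv.contDiff.continuous_fderiv one_ne_zero
    set W := BoundedContinuousFunction.ofNormedAddCommGroup (fderiv ℝ v) hc K hK with hW
    -- The derivative of any competing solution is a fixed point of the same contraction, and the
    -- derivative determines the solution through the equation.
    have hWf : Function.IsFixedPt (derivMap e hs hlam hB hM) W := by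
      ext1 x
      have h1 := hasFDerivAt_resolvent e hs hlam (stronglyMeasurable_driftFun W.continuous hB)
        (norm_driftFun_le W.norm_coe_le_norm hM) x
      have h2 : resolvent e eig lam (driftFun W B) = v := hvr.symm
      rw [h2] at h1
      exact h1.fderiv.symm
    have : W = V := hcon.fixedPoint_unique hWf
    rw [hvr, hu, ← this]
    rfl

end FixedPoint

/-! ### The Ornstein-Uhlenbeck semigroup in `L²(H, μ)` -/

section LTwo

variable {ι : Type*} {H : Type*} [NormedAddCommGroup H] [InnerProductSpace ℝ H] [CompleteSpace H]
  [Countable ι] [MeasurableSpace H] [BorelSpace H] {eig : ι → ℝ} [hs : Fact (IsSpectrum eig)]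

instance (e : HilbertBasis ι ℝ H) : IsProbabilityMeasure (invMeasure e eig) :=
  isProbabilityMeasure_invMeasure e hs.out

lemma measurePreserving_ouPoint (e : HilbertBasis ι ℝ H) {t : ℝ} (ht : 0 ≤ t) :
    MeasurePreserving (fun p : H × (ι → ℝ) => ouPoint e eig t p.1 p.2)
      ((invMeasure e eig).prod (gaussianProd ι)) (invMeasure e eig) :=
  ⟨measurable_ouPoint_prod e eig t, map_ouPoint_invMeasure e hs.out ht⟩

/-- The coefficients of `ξ ↦ w (ouPoint e eig t x ξ)` along `chaosFun`. -/
def chaosCoef (e : HilbertBasis ι ℝ H) (eig : ι → ℝ) (t : ℝ) (j : Option ι) (w : H → ℝ) (x : H) :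
    ℝ :=
  ∫ ξ, chaosFun j ξ * w (ouPoint e eig t x ξ) ∂(gaussianProd ι)

lemma memLp_comp_ouPoint_prod (e : HilbertBasis ι ℝ H) {t : ℝ} (ht : 0 ≤ t) {w : H → ℝ}
    (hw : MemLp w 2 (invMeasure e eig)) :
    MemLp (fun p : H × (ι → ℝ) => w (ouPoint e eig t p.1 p.2)) 2
      ((invMeasure e eig).prod (gaussianProd ι)) :=
  hw.comp_measurePreserving (measurePreserving_ouPoint e ht)

lemma ae_memLp_comp_ouPoint (e : HilbertBasis ι ℝ H) {t : ℝ} (ht : 0 ≤ t) {w : H → ℝ}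
    (hw : MemLp w 2 (invMeasure e eig)) :
    ∀ᵐ x ∂(invMeasure e eig), MemLp (fun ξ => w (ouPoint e eig t x ξ)) 2 (gaussianProd ι) := by
  have hp := memLp_comp_ouPoint_prod e ht hw
  filter_upwards [hp.integrable_sq.prod_right_ae, hp.1.prodMk_left] with x h1 h2
  exact (memLp_two_iff_integrable_sq h2).2 h1

lemma ae_eq_comp_ouPoint (e : HilbertBasis ι ℝ H) {t : ℝ} (ht : 0 ≤ t) {w w' : H → ℝ}
    (h : w =ᵐ[invMeasure e eig] w') :
    ∀ᵐ x ∂(invMeasure e eig), (fun ξ => w (ouPoint e eig t x ξ)) =ᵐ[gaussianProd ι]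
      fun ξ => w' (ouPoint e eig t x ξ) :=
  Measure.ae_ae_of_ae_prod ((measurePreserving_ouPoint e ht).quasiMeasurePreserving.ae_eq_comp h)

lemma chaosCoef_congr (e : HilbertBasis ι ℝ H) {t : ℝ} (ht : 0 ≤ t) (j : Option ι) {w w' : H → ℝ}
    (h : w =ᵐ[invMeasure e eig] w') :
    chaosCoef e eig t j w =ᵐ[invMeasure e eig] chaosCoef e eig t j w' := by
  filter_upwards [ae_eq_comp_ouPoint e ht h] with x hx
  refine integral_congr_ae ?_
  filter_upwards [hx] with ξ hξ
  rw [hξ]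

-- Bessel's inequality for the orthonormal family `chaos`, at a fixed starting point.
omit [CompleteSpace H] [Countable ι] [MeasurableSpace H] [BorelSpace H] hs in
lemma sum_chaosCoef_sq_le (e : HilbertBasis ι ℝ H) {t : ℝ} (F : Finset (Option ι)) {w : H → ℝ}
    {x : H} (hw : MemLp (fun ξ => w (ouPoint e eig t x ξ)) 2 (gaussianProd ι)) :
    ∑ j ∈ F, chaosCoef e eig t j w x ^ 2 ≤ ∫ ξ, w (ouPoint e eig t x ξ) ^ 2 ∂(gaussianProd ι) := by
  have h := (orthonormal_chaos (ι := ι)).sum_inner_products_le (x := hw.toLp) (s := F)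
  rw [← real_inner_self_eq_norm_sq, inner_toLp] at h
  simp_rw [sq (w _)]
  refine le_trans (le_of_eq ?_) h
  refine Finset.sum_congr rfl fun j _ => ?_
  rw [chaos, inner_toLp, Real.norm_eq_abs, sq_abs]
  rfl

lemma aestronglyMeasurable_chaosCoef (e : HilbertBasis ι ℝ H) {t : ℝ} (ht : 0 ≤ t) (j : Option ι)
    {w : H → ℝ} (hw : MemLp w 2 (invMeasure e eig)) :
    AEStronglyMeasurable (chaosCoef e eig t j w) (invMeasure e eig) := by
  have h1 : AEStronglyMeasurable (fun p : H × (ι → ℝ) => chaosFun j p.2)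
      ((invMeasure e eig).prod (gaussianProd ι)) :=
    (memLp_chaosFun j).1.comp_snd
  exact (h1.mul (memLp_comp_ouPoint_prod e ht hw).1).integral_prod_right'

lemma integral_integral_sq (e : HilbertBasis ι ℝ H) {t : ℝ} (ht : 0 ≤ t) {w : H → ℝ}
    (hw : MemLp w 2 (invMeasure e eig)) :
    ∫ x, ∫ ξ, w (ouPoint e eig t x ξ) ^ 2 ∂(gaussianProd ι) ∂(invMeasure e eig) =
      ∫ x, w x ^ 2 ∂(invMeasure e eig) := by
  have hp := memLp_comp_ouPoint_prod e ht hw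
  have hm := (measurePreserving_ouPoint (eig := eig) e ht)
  rw [← integral_prod (fun p : H × (ι → ℝ) => w (ouPoint e eig t p.1 p.2) ^ 2) hp.integrable_sq]
  conv_rhs => rw [← hm.map_eq]
  rw [integral_map hm.measurable.aemeasurable (by rw [hm.map_eq]; exact hw.integrable_sq.1)]

lemma integrable_integral_sq (e : HilbertBasis ι ℝ H) {t : ℝ} (ht : 0 ≤ t) {w : H → ℝ}
    (hw : MemLp w 2 (invMeasure e eig)) :
    Integrable (fun x => ∫ ξ, w (ouPoint e eig t x ξ) ^ 2 ∂(gaussianProd ι)) (invMeasure e eig) :=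
  (memLp_comp_ouPoint_prod e ht hw).integrable_sq.integral_prod_left

lemma memLp_chaosCoef (e : HilbertBasis ι ℝ H) {t : ℝ} (ht : 0 ≤ t) (j : Option ι) {w : H → ℝ}
    (hw : MemLp w 2 (invMeasure e eig)) :
    MemLp (chaosCoef e eig t j w) 2 (invMeasure e eig) := by
  have hm := aestronglyMeasurable_chaosCoef e ht j hw
  rw [memLp_two_iff_integrable_sq hm]
  refine (integrable_integral_sq e ht hw).mono' (hm.pow 2) ?_
  filter_upwards [ae_memLp_comp_ouPoint e ht hw] with x hx
  rw [Real.norm_of_nonneg (sq_nonneg _)]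
  simpa using sum_chaosCoef_sq_le e {j} hx

lemma chaosCoef_add (e : HilbertBasis ι ℝ H) {t : ℝ} (ht : 0 ≤ t) (j : Option ι) {w w' : H → ℝ}
    (hw : MemLp w 2 (invMeasure e eig)) (hw' : MemLp w' 2 (invMeasure e eig)) :
    chaosCoef e eig t j (w + w') =ᵐ[invMeasure e eig]
      chaosCoef e eig t j w + chaosCoef e eig t j w' := by
  filter_upwards [ae_memLp_comp_ouPoint e ht hw, ae_memLp_comp_ouPoint e ht hw'] with x h1 h2
  simp only [chaosCoef, Pi.add_apply, mul_add]
  exact integral_add (integrable_smul_of_memLp_two (memLp_chaosFun j) h1)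
    (integrable_smul_of_memLp_two (memLp_chaosFun j) h2)

omit [CompleteSpace H] [Countable ι] [MeasurableSpace H] [BorelSpace H] hs in
lemma chaosCoef_smul (e : HilbertBasis ι ℝ H) (t : ℝ) (j : Option ι) (c : ℝ) (w : H → ℝ) :
    chaosCoef e eig t j (c • w) = c • chaosCoef e eig t j w := by
  ext x
  simp only [chaosCoef, Pi.smul_apply, smul_eq_mul]
  rw [← integral_const_mul]
  congr 1; ext ξ; ring

omit hs in
lemma norm_toLp_sq {Ω : Type*} [MeasurableSpace Ω] {μ : Measure Ω} {f : Ω → ℝ}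
    (hf : MemLp f 2 μ) : ‖hf.toLp‖ ^ 2 = ∫ ω, f ω ^ 2 ∂μ := by
  rw [← real_inner_self_eq_norm_sq, inner_toLp]
  simp_rw [sq]

/-- Bessel's inequality integrated over the starting point; invariance of μ turns the right side
into ‖w‖². Single indices give contractions on L², and all indices together give the energy
inequality. -/
lemma sum_norm_chaosCoef_sq_le (e : HilbertBasis ι ℝ H) {t : ℝ} (ht : 0 ≤ t)
    (F : Finset (Option ι)) {w : H → ℝ} (hw : MemLp w 2 (invMeasure e eig)) :
    ∑ j ∈ F, ‖(memLp_chaosCoef e ht j hw).toLp‖ ^ 2 ≤ ‖hw.toLp‖ ^ 2 := by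
  simp_rw [norm_toLp_sq]
  rw [← integral_integral_sq e ht hw, ← integral_finsetSum F
    fun j _ => (memLp_chaosCoef e ht j hw).integrable_sq]
  refine integral_mono_ae (integrable_finsetSum F
    fun j _ => (memLp_chaosCoef e ht j hw).integrable_sq) (integrable_integral_sq e ht hw) ?_
  filter_upwards [ae_memLp_comp_ouPoint e ht hw] with x hx
  exact sum_chaosCoef_sq_le e F hx

/-- `chaosCoef` as an operator in `L²(H, μ)`. For `j = none` it is the semigroup `R_t`. -/
def chaosOp (e : HilbertBasis ι ℝ H) (eig : ι → ℝ) [hs : Fact (IsSpectrum eig)] {t : ℝ}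
    (ht : 0 ≤ t) (j : Option ι) :
    Lp ℝ 2 (invMeasure e eig) →L[ℝ] Lp ℝ 2 (invMeasure e eig) :=
  LinearMap.mkContinuous
    { toFun := fun w => (memLp_chaosCoef e ht j (Lp.memLp w)).toLp
      map_add' := fun w w' => by
        rw [← MemLp.toLp_add, MemLp.toLp_eq_toLp_iff]
        exact (chaosCoef_congr e ht j (Lp.coeFn_add w w')).trans
          (chaosCoef_add e ht j (Lp.memLp w) (Lp.memLp w'))
      map_smul' := fun c w => by
        rw [RingHom.id_apply, ← MemLp.toLp_const_smul, MemLp.toLp_eq_toLp_iff]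
        exact (chaosCoef_congr e ht j (Lp.coeFn_smul c w)).trans
          (chaosCoef_smul e t j c w).eventuallyEq }
    1 fun w => by
      have h := sum_norm_chaosCoef_sq_le e ht {j} (Lp.memLp w)
      rw [Finset.sum_singleton, Lp.toLp_coeFn] at h
      rw [one_mul]
      exact abs_le_of_sq_le_sq h (norm_nonneg _) |>.trans' (le_abs_self _)

lemma chaosOp_toLp (e : HilbertBasis ι ℝ H) {t : ℝ} (ht : 0 ≤ t) (j : Option ι) {w : H → ℝ}
    (hw : MemLp w 2 (invMeasure e eig)) :
    chaosOp e eig ht j hw.toLp = (memLp_chaosCoef e ht j hw).toLp := by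
  refine (MemLp.toLp_eq_toLp_iff (memLp_chaosCoef e ht j (Lp.memLp _)) _).2 ?_
  exact chaosCoef_congr e ht j hw.coeFn_toLp

lemma norm_chaosOp_le (e : HilbertBasis ι ℝ H) {t : ℝ} (ht : 0 ≤ t) (j : Option ι)
    (w : Lp ℝ 2 (invMeasure e eig)) : ‖chaosOp e eig ht j w‖ ≤ ‖w‖ := by
  refine ((chaosOp e eig ht j).le_opNorm w).trans ?_
  exact mul_le_of_le_one_left (norm_nonneg _) (LinearMap.mkContinuous_norm_le _ zero_le_one _)

lemma sum_norm_chaosOp_sq_le (e : HilbertBasis ι ℝ H) {t : ℝ} (ht : 0 ≤ t)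
    (F : Finset (Option ι)) (w : Lp ℝ 2 (invMeasure e eig)) :
    ∑ j ∈ F, ‖chaosOp e eig ht j w‖ ^ 2 ≤ ‖w‖ ^ 2 := by
  have h := sum_norm_chaosCoef_sq_le e ht F (Lp.memLp w)
  rwa [Lp.toLp_coeFn] at h

/-- On `L²` functions, `ou` is the operator `chaosOp` for `j = none`. -/
lemma ou_ae_eq_chaosCoef (e : HilbertBasis ι ℝ H) {t : ℝ} (ht : 0 < t) {w : H → ℝ}
    (hw : AEStronglyMeasurable w (invMeasure e eig)) :
    ou e eig t w =ᵐ[invMeasure e eig] chaosCoef e eig t none w := by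
  filter_upwards [chaosCoef_congr e ht.le none hw.ae_eq_mk] with x hx
  rw [hx, ou_congr_ae e hs.out ht hw.ae_eq_mk, ou_eq_integral e hs.out ht.le hw.stronglyMeasurable_mk]
  simp [chaosCoef, chaosFun]

/-! #### Strong continuity -/

-- Each squared coordinate of the difference tends to 0, and since the eigenvalues of Q_t are at
-- most 1/eig k, these squares are dominated by an almost surely summable family independent of t.
omit [MeasurableSpace H] [BorelSpace H] in
lemma tendsto_ouPoint (e : HilbertBasis ι ℝ H) (x : H) :
    ∀ᵐ ξ ∂(gaussianProd ι), Tendsto (fun t => ouPoint e eig t x ξ) (𝓝[>] 0) (𝓝 x) := by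
  have hr : Summable fun k => √((eig k)⁻¹) ^ 2 := by
    refine hs.out.summable_inv.congr fun k => ?_
    rw [Real.sq_sqrt (inv_nonneg.2 (hs.out.pos k).le)]
  filter_upwards [ae_summable_mul_coord_sq hr] with ξ hξ
  have hbd : ∀ t : ℝ, 0 < t → ∀ k, ((Real.exp (-(eig k * t)) - 1) * inner ℝ (e k) x +
      √(ouVar eig t k) * ξ k) ^ 2 ≤
      2 * inner ℝ (e k) x ^ 2 + 2 * (√((eig k)⁻¹) * ξ k) ^ 2 := by
    intro t ht k
    have h1 : (Real.exp (-(eig k * t)) - 1) ^ 2 ≤ 1 := by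
      have := abs_exp_neg_le_one hs.out ht.le k
      have h2 := Real.exp_pos (-(eig k * t))
      rw [abs_of_pos h2] at this
      nlinarith
    have h2 : √(ouVar eig t k) ^ 2 ≤ √((eig k)⁻¹) ^ 2 := by
      gcongr
      exact ouVar_le hs.out t k
    have h3 := mul_le_mul_of_nonneg_right h1 (sq_nonneg (inner ℝ (e k) x))
    have h4 := mul_le_mul_of_nonneg_right h2 (sq_nonneg (ξ k))
    have h5 := sq_nonneg ((Real.exp (-(eig k * t)) - 1) * inner ℝ (e k) x -
      √(ouVar eig t k) * ξ k)
    rw [mul_pow]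
    nlinarith
  have hsum : Summable fun k => 2 * inner ℝ (e k) x ^ 2 + 2 * (√((eig k)⁻¹) * ξ k) ^ 2 :=
    ((summable_inner_sq e x).mul_left 2).add (hξ.mul_left 2)
  have hlim : Tendsto (fun t => ∑' k, ((Real.exp (-(eig k * t)) - 1) * inner ℝ (e k) x +
      √(ouVar eig t k) * ξ k) ^ 2) (𝓝[>] 0) (𝓝 (∑' _ : ι, (0 : ℝ))) := by
    refine tendsto_tsum_of_dominated_convergence hsum (fun k => ?_) ?_
    · have hc : ContinuousAt (fun t : ℝ => ((Real.exp (-(eig k * t)) - 1) * inner ℝ (e k) x +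
          √(ouVar eig t k) * ξ k) ^ 2) 0 := by
        unfold ouVar; fun_prop
      have := hc.tendsto
      simp only [ouVar, mul_zero, neg_zero, Real.exp_zero, sub_self, zero_mul, zero_div,
        Real.sqrt_zero, add_zero] at this
      rw [zero_pow two_ne_zero] at this
      exact this.mono_left nhdsWithin_le_nhds
    · filter_upwards [self_mem_nhdsWithin] with t ht k
      rw [Real.norm_of_nonneg (sq_nonneg _)]
      exact hbd t ht k
  rw [tsum_zero] at hlim
  rw [tendsto_iff_norm_sub_tendsto_zero]
  have hsq : Tendsto (fun t => ‖ouPoint e eig t x ξ - x‖ ^ 2) (𝓝[>] 0) (𝓝 0) := by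
    refine hlim.congr' ?_
    filter_upwards [self_mem_nhdsWithin] with t ht
    have hm : Summable fun k => (Real.exp (-(eig k * t)) * inner ℝ (e k) x +
        √(ouVar eig t k) * ξ k) ^ 2 := by
      have := summable_add_sq (Summable.of_nonneg_of_le (fun k => sq_nonneg _) (hbd t ht) hsum)
        (summable_inner_sq e x)
      refine this.congr fun k => ?_
      congr 1; ring
    rw [← (hasSum_inner_sq e (ouPoint e eig t x ξ - x)).tsum_eq]
    refine tsum_congr fun k => ?_
    rw [inner_sub_right, ouPoint, affPoint, inner_sumMap e hm]
    congr 1; ring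
  have := hsq.sqrt
  simpa using this

end LTwo

section StrongContinuity

variable {ι : Type*} {H : Type*} [NormedAddCommGroup H] [InnerProductSpace ℝ H] [CompleteSpace H]
  [Countable ι] [MeasurableSpace H] [BorelSpace H] {eig : ι → ℝ} [hs : Fact (IsSpectrum eig)]

/-- The semigroup `R_t` in `L²(H, μ)`, for all real times (`R_0` for negative times). -/
def ouOp (e : HilbertBasis ι ℝ H) (eig : ι → ℝ) [hs : Fact (IsSpectrum eig)] (t : ℝ) :
    Lp ℝ 2 (invMeasure e eig) →L[ℝ] Lp ℝ 2 (invMeasure e eig) :=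
  chaosOp e eig (le_max_right t 0) none

lemma ouOp_of_nonneg (e : HilbertBasis ι ℝ H) {t : ℝ} (ht : 0 ≤ t) :
    ouOp e eig t = chaosOp e eig ht none := by
  unfold ouOp
  congr 1
  exact max_eq_left ht

lemma norm_ouOp_le (e : HilbertBasis ι ℝ H) (t : ℝ) (f : Lp ℝ 2 (invMeasure e eig)) :
    ‖ouOp e eig t f‖ ≤ ‖f‖ := norm_chaosOp_le e _ _ f

lemma tendsto_ouOp_of_continuous (e : HilbertBasis ι ℝ H) {φ : H → ℝ} (hc : Continuous φ) {K : ℝ}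
    (hK : ∀ x, ‖φ x‖ ≤ K) (hφ : MemLp φ 2 (invMeasure e eig)) :
    Tendsto (fun t => ouOp e eig t hφ.toLp) (𝓝[>] 0) (𝓝 hφ.toLp) := by
  have hpt : ∀ x, Tendsto (fun t => chaosCoef e eig t none φ x) (𝓝[>] 0) (𝓝 (φ x)) := by
    intro x
    have h0 : φ x = ∫ _, φ x ∂(gaussianProd ι) := by simp
    conv => enter [3, 1]; rw [h0]
    simp only [chaosCoef, chaosFun, one_mul]
    refine tendsto_integral_filter_of_dominated_convergence (fun _ => K)
      (Eventually.of_forall fun t =>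
        (hc.measurable.comp (measurable_ouPoint e eig t x)).aestronglyMeasurable)
      (Eventually.of_forall fun t => ae_of_all _ fun ξ => hK _) (integrable_const _) ?_
    filter_upwards [tendsto_ouPoint (eig := eig) e x] with ξ hξ
    exact (hc.tendsto x).comp hξ
  have hb : ∀ t x, ‖chaosCoef e eig t none φ x‖ ≤ K := by
    intro t x
    simp only [chaosCoef, chaosFun, one_mul]
    simpa using norm_integral_le_of_norm_le_const (μ := gaussianProd ι) (ae_of_all _ fun ξ => hK _)
  have hlim : Tendsto (fun t => ∫ x, (chaosCoef e eig t none φ x - φ x) ^ 2 ∂(invMeasure e eig))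
      (𝓝[>] 0) (𝓝 (∫ _, (0 : ℝ) ∂(invMeasure e eig))) := by
    refine tendsto_integral_filter_of_dominated_convergence (fun _ => (2 * K) ^ 2) ?_ ?_
      (integrable_const _) (ae_of_all _ fun x => ?_)
    · filter_upwards [self_mem_nhdsWithin] with t ht
      exact ((memLp_chaosCoef (eig := eig) e (le_of_lt ht) none hφ).1.sub hφ.1).pow 2
    · refine Eventually.of_forall fun t => ae_of_all _ fun x => ?_
      rw [norm_pow]
      gcongr
      refine (norm_sub_le _ _).trans ?_
      have := hb t x
      have := hK x
      linarith
    · have := ((hpt x).sub_const (φ x)).pow 2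
      simpa using this
  rw [integral_zero] at hlim
  rw [tendsto_iff_norm_sub_tendsto_zero]
  have hsq : Tendsto (fun t => ‖ouOp e eig t hφ.toLp - hφ.toLp‖ ^ 2) (𝓝[>] 0) (𝓝 0) := by
    refine hlim.congr' ?_
    filter_upwards [self_mem_nhdsWithin] with t ht
    rw [ouOp_of_nonneg e (le_of_lt ht), chaosOp_toLp, ← MemLp.toLp_sub, norm_toLp_sq]
    rfl
  simpa using hsq.sqrt

/-- The operators are contractions and bounded continuous functions are dense in L², so
`tendsto_ouOp_of_continuous` suffices. -/
lemma tendsto_ouOp (e : HilbertBasis ι ℝ H) (f : Lp ℝ 2 (invMeasure e eig)) :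
    Tendsto (fun t => ouOp e eig t f) (𝓝[>] 0) (𝓝 f) := by
  rw [Metric.tendsto_nhds]
  intro ε hε
  obtain ⟨φ, hφ⟩ := (BoundedContinuousFunction.toLp_denseRange (E := ℝ) (𝕜 := ℝ)
    (μ := invMeasure e eig) (p := 2) (by norm_num)).exists_dist_lt f (by positivity : 0 < ε / 3)
  have hm : MemLp φ 2 (invMeasure e eig) :=
    memLp_of_bound φ.continuous.aestronglyMeasurable φ.norm_coe_le_norm 2
  have he : BoundedContinuousFunction.toLp (E := ℝ) 2 (invMeasure e eig) ℝ φ = hm.toLp := by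
    refine Lp.ext ?_
    exact (BoundedContinuousFunction.coeFn_toLp _ _ _ φ).trans hm.coeFn_toLp.symm
  rw [he] at hφ
  have h1 := tendsto_ouOp_of_continuous e φ.continuous φ.norm_coe_le_norm hm
  filter_upwards [Metric.tendsto_nhds.1 h1 (ε / 3) (by positivity)] with t ht
  have h2 : dist (ouOp e eig t f) (ouOp e eig t hm.toLp) ≤ dist f hm.toLp := by
    rw [dist_eq_norm, dist_eq_norm, ← map_sub]
    exact norm_ouOp_le e t _
  have h3 := dist_triangle4_right (ouOp e eig t f) f (ouOp e eig t hm.toLp) hm.toLp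
  linarith

end StrongContinuity

/-! #### Integration by parts -/

section IntegrationByParts

variable {ι : Type*} {H : Type*} [NormedAddCommGroup H] [InnerProductSpace ℝ H] [CompleteSpace H]

lemma sumMap_add_single (e : HilbertBasis ι ℝ H) {y : ι → ℝ} (hy : Summable fun k => y k ^ 2)
    (k : ι) (c : ℝ) {z : ι → ℝ} (hz : ∀ j, z j = y j + c * inner ℝ (e j) (e k)) :
    sumMap e z = sumMap e y + c • e k := by
  have hz' : Summable fun j => z j ^ 2 := by
    simp_rw [hz]
    refine summable_add_sq hy (summable_mul_sq (a := fun _ => c) (C := |c|) (fun _ => le_rfl) ?_)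
    exact summable_inner_sq e (e k)
  refine ext_inner_basis e fun j => ?_
  rw [inner_sumMap e hz', inner_add_right, inner_sumMap e hy, inner_smul_right, hz]

lemma ouPoint_add_smul (e : HilbertBasis ι ℝ H) (eig : ι → ℝ) (t : ℝ) (x : H) {ξ : ι → ℝ}
    (hξ : Summable fun k => (Real.exp (-(eig k * t)) * inner ℝ (e k) x +
      √(ouVar eig t k) * ξ k) ^ 2) (k : ι) (s : ℝ) :
    ouPoint e eig t x (fun j => ξ j + inner ℝ (e j) (s • e k)) =
      ouPoint e eig t x ξ + (s * √(ouVar eig t k)) • e k := by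
  classical
  refine sumMap_add_single e hξ k _ fun j => ?_
  simp only [inner_smul_right]
  rw [orthonormal_iff_ite.1 e.orthonormal]
  split_ifs with h
  · subst h; ring
  · ring

variable [Countable ι] [MeasurableSpace H] [BorelSpace H] [SecondCountableTopology H]
  {eig : ι → ℝ} [hs : Fact (IsSpectrum eig)]

omit [Countable ι] [MeasurableSpace H] [BorelSpace H] [SecondCountableTopology H] hs in
lemma inner_gradient (φ : H → ℝ) (x h : H) : inner ℝ h (gradient φ x) = fderiv ℝ φ x h := by
  rw [gradient, real_inner_comm, InnerProductSpace.toDual_symm_apply]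

omit [Countable ι] [MeasurableSpace H] [BorelSpace H] [SecondCountableTopology H] hs in
lemma IsC1b.continuous_gradient {φ : H → ℝ} (hφ : IsC1b φ) : Continuous (gradient φ) :=
  (InnerProductSpace.toDual ℝ H).symm.continuous.comp (hφ.contDiff.continuous_fderiv one_ne_zero)

omit [Countable ι] [MeasurableSpace H] [BorelSpace H] [SecondCountableTopology H] hs in
lemma IsC1b.bounded_gradient {φ : H → ℝ} (hφ : IsC1b φ) : ∃ K, ∀ x, ‖gradient φ x‖ ≤ K := by
  obtain ⟨K, hK⟩ := hφ.bounded_fderiv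
  refine ⟨K, fun x => ?_⟩
  rw [gradient, LinearIsometryEquiv.norm_map]
  exact hK x

omit [SecondCountableTopology H] in
/-- Gaussian integration by parts for `C¹_b` functions. -/
lemma chaosCoef_some_of_isC1b (e : HilbertBasis ι ℝ H) {t : ℝ} (ht : 0 ≤ t) (k : ι) {φ : H → ℝ}
    (hφ : IsC1b φ) (x : H) :
    chaosCoef e eig t (some k) φ x =
      √(ouVar eig t k) * chaosCoef e eig t none (fun y => inner ℝ (e k) (gradient φ y)) x := by
  obtain ⟨K, hK⟩ := hφ.bounded
  obtain ⟨K', hK'⟩ := hφ.bounded_gradient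
  have hφm : StronglyMeasurable φ := hφ.contDiff.continuous.stronglyMeasurable
  have hF := stronglyMeasurable_comp_ouPoint (eig := eig) e hφm t x
  have hF2 := memLp_comp_ouPoint (eig := eig) e hφm hK t x
  set F : (ι → ℝ) → ℝ := fun ξ => φ (ouPoint e eig t x ξ) with hFdef
  -- The derivative of I at 0 is computed twice: moving the shift to the measure gives the chaos
  -- coefficient, differentiating φ under the integral gives the gradient.
  set I : ℝ → ℝ := fun s => ∫ ξ, F (fun j => ξ j + inner ℝ (e j) (s • e k)) ∂(gaussianProd ι)
  have hI0 : I 0 = ∫ ξ, F ξ ∂(gaussianProd ι) := by simp [I]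
  have hp : ∀ s : ℝ, pairing F hF2 (whiteNoise e (s • e k)) =
      s * chaosCoef e eig t (some k) φ x := by
    intro s
    rw [map_smul, map_smul, whiteNoise_basis, chaos, pairing_toLp]
    rfl
  have hder1 : HasDerivAt I (chaosCoef e eig t (some k) φ x) 0 := by
    rw [hasDerivAt_iff_isLittleO_nhds_zero]
    have hO : (fun s => I (0 + s) - I 0 - s • chaosCoef e eig t (some k) φ x) =O[𝓝 0]
        fun s : ℝ => |s| ^ (3 / 2 : ℝ) := by
      refine Asymptotics.IsBigO.of_bound (3 * K) (Eventually.of_forall fun s => ?_)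
      have := norm_shift_sub_sub_le e (s • e k) hF hF2 fun ξ => hK _
      rw [hp, norm_smul, e.orthonormal.1 k, mul_one, Real.norm_eq_abs s] at this
      rw [zero_add, hI0, smul_eq_mul, Real.norm_of_nonneg (by positivity : 0 ≤ |s| ^ (3 / 2 : ℝ))]
      exact this
    refine hO.trans_isLittleO ?_
    rw [Asymptotics.isLittleO_iff]
    intro c hc
    have hc' : Tendsto (fun s : ℝ => |s| ^ (1 / 2 : ℝ)) (𝓝 0) (𝓝 0) := by
      have : Continuous fun s : ℝ => |s| ^ (1 / 2 : ℝ) :=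
        continuous_abs.rpow_const fun _ => .inr (by norm_num)
      simpa using this.tendsto 0
    filter_upwards [hc'.eventually (gt_mem_nhds hc)] with s hs'
    rw [Real.norm_of_nonneg (by positivity)]
    have : |s| ^ (3 / 2 : ℝ) = |s| ^ (1 / 2 : ℝ) * |s| := by
      rw [← Real.rpow_add_one' (abs_nonneg _) (by norm_num)]; norm_num
    rw [this, Real.norm_eq_abs]
    gcongr
  set q := √(ouVar eig t k) with hq
  have hgm : StronglyMeasurable fun y => inner ℝ (e k) (gradient φ y) :=
    (continuous_const.inner hφ.continuous_gradient).stronglyMeasurable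
  have hder2 : HasDerivAt I
      (∫ ξ, q * inner ℝ (e k) (gradient φ (ouPoint e eig t x ξ)) ∂(gaussianProd ι)) 0 := by
    have hI : I = fun s => ∫ ξ, φ (ouPoint e eig t x ξ + (s * q) • e k) ∂(gaussianProd ι) := by
      ext s
      refine integral_congr_ae ?_
      filter_upwards [ae_summable_affPoint (summable_exp_mul_inner e hs.out ht x)
        (summable_sqrt_ouVar hs.out ht)] with ξ hξ
      simp only [hFdef]
      rw [ouPoint_add_smul e eig t x hξ k s]
    have hmeas : ∀ s : ℝ, AEStronglyMeasurable
        (fun ξ => φ (ouPoint e eig t x ξ + (s * q) • e k)) (gaussianProd ι) := fun s =>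
      (hφm.comp_measurable ((measurable_ouPoint e eig t x).add_const _)).aestronglyMeasurable
    have := (hasDerivAt_integral_of_dominated_loc_of_deriv_le (μ := gaussianProd ι)
      (F := fun s ξ => φ (ouPoint e eig t x ξ + (s * q) • e k))
      (F' := fun s ξ => q * inner ℝ (e k) (gradient φ (ouPoint e eig t x ξ + (s * q) • e k)))
      (x₀ := (0 : ℝ)) (bound := fun _ => q * K') univ_mem (Eventually.of_forall hmeas)
      ((memLp_of_bound (hmeas 0) (fun _ => hK _) 1).integrable le_rfl) ?_ ?_
      (integrable_const _) ?_).2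
    · rw [hI]
      simpa using this
    · refine (StronglyMeasurable.const_mul ?_ q).aestronglyMeasurable
      exact hgm.comp_measurable ((measurable_ouPoint e eig t x).add_const _)
    · refine ae_of_all _ fun ξ s _ => ?_
      rw [norm_mul, Real.norm_of_nonneg (Real.sqrt_nonneg _)]
      gcongr
      refine (norm_inner_le_norm _ _).trans ?_
      rw [e.orthonormal.1 k, one_mul]
      exact hK' _
    · refine ae_of_all _ fun ξ s _ => ?_
      have h1 : HasDerivAt (fun s : ℝ => ouPoint e eig t x ξ + (s * q) • e k)
          ((1 * q) • e k) s :=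
        (((hasDerivAt_id s).mul_const q).smul_const (e k)).const_add _
      have h2 := ((hφ.contDiff.differentiable one_ne_zero _).hasFDerivAt
        (x := ouPoint e eig t x ξ + (s * q) • e k)).comp_hasDerivAt s h1
      convert! h2 using 1
      rw [inner_gradient, map_smul, one_mul, smul_eq_mul]
  rw [hder1.unique hder2, integral_const_mul]
  simp [chaosCoef, chaosFun]

omit [CompleteSpace H] [Countable ι] [BorelSpace H] [SecondCountableTopology H] hs in
lemma memLp_inner_basis (e : HilbertBasis ι ℝ H) {μ : Measure H} {G : H → H} (hG : MemLp G 2 μ)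
    (k : ι) : MemLp (fun x => inner ℝ (e k) (G x)) 2 μ :=
  hG.const_inner (e k)

lemma IsC1b.memLp_gradient (e : HilbertBasis ι ℝ H) {φ : H → ℝ} (hφ : IsC1b φ) :
    MemLp (gradient φ) 2 (invMeasure e eig) := by
  obtain ⟨K', hK'⟩ := hφ.bounded_gradient
  exact memLp_of_bound hφ.continuous_gradient.aestronglyMeasurable hK' 2

lemma IsC1b.memLp {E : Type*} [NormedAddCommGroup E] [NormedSpace ℝ E]
    (e : HilbertBasis ι ℝ H) {φ : H → E} (hφ : IsC1b φ) :
    MemLp φ 2 (invMeasure e eig) := by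
  obtain ⟨K, hK⟩ := hφ.bounded
  exact memLp_of_bound hφ.contDiff.continuous.aestronglyMeasurable hK 2

/-- Gaussian integration by parts for Sobolev functions. -/
lemma chaosOp_some_of_isSobolevGradient (e : HilbertBasis ι ℝ H) {t : ℝ} (ht : 0 ≤ t) (k : ι)
    {φ : H → ℝ} {G : H → H} (h : IsSobolevGradient e eig φ G) :
    chaosOp e eig ht (some k) h.memLp.toLp = √(ouVar eig t k) •
      chaosOp e eig ht none (memLp_inner_basis e h.memLp_grad k).toLp := by
  obtain ⟨φn, hφn, hlim, hlimG⟩ := h.approx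
  have h1 : Tendsto (fun n => ((hφn n).memLp (eig := eig) e).toLp) atTop (𝓝 h.memLp.toLp) :=
    (Lp.tendsto_Lp_iff_tendsto_eLpNorm'' _ _ _ _).2 hlim
  have h2 : Tendsto (fun n =>
      (memLp_inner_basis e ((hφn n).memLp_gradient (eig := eig) e) k).toLp) atTop
      (𝓝 (memLp_inner_basis e h.memLp_grad k).toLp) := by
    refine (Lp.tendsto_Lp_iff_tendsto_eLpNorm'' _ _ _ _).2 ?_
    refine tendsto_of_tendsto_of_tendsto_of_le_of_le tendsto_const_nhds hlimG
      (fun n => zero_le) fun n => ?_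
    refine eLpNorm_mono fun x => ?_
    rw [Pi.sub_apply, ← inner_sub_right]
    refine (norm_inner_le_norm _ _).trans ?_
    rw [e.orthonormal.1 k, one_mul]
  -- Both sides are L²-continuous, in φ and in G respectively, so the identity passes to the limit
  -- for any Sobolev gradient; uniqueness of that gradient is not needed.
  refine tendsto_nhds_unique (((chaosOp e eig ht (some k)).continuous.tendsto _).comp h1) ?_
  refine ((((chaosOp e eig ht none).continuous.tendsto _).comp h2).const_smul
    (√(ouVar eig t k))).congr fun n => ?_
  simp only [Function.comp_apply]
  rw [chaosOp_toLp, chaosOp_toLp, ← MemLp.toLp_const_smul, MemLp.toLp_eq_toLp_iff]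
  refine ae_of_all _ fun x => ?_
  rw [chaosCoef_some_of_isC1b e ht k (hφn n) x]
  rfl

end IntegrationByParts

/-! #### The energy inequality and uniqueness -/

section Energy

variable {ι : Type*} {H : Type*} [NormedAddCommGroup H] [InnerProductSpace ℝ H] [CompleteSpace H]
  [Countable ι] [MeasurableSpace H] [BorelSpace H] {eig : ι → ℝ} [hs : Fact (IsSpectrum eig)]

lemma IsGeneratorValue.tendsto_ouOp {e : HilbertBasis ι ℝ H} {φ ψ : H → ℝ}
    (h : IsGeneratorValue e eig φ ψ) :
    Tendsto (fun t : ℝ => t⁻¹ • (ouOp e eig t h.memLp.toLp - h.memLp.toLp)) (𝓝[>] 0)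
      (𝓝 h.memLp_value.toLp) := by
  rw [Lp.tendsto_Lp_iff_tendsto_eLpNorm]
  refine h.tendsto.congr' ?_
  filter_upwards [self_mem_nhdsWithin] with t ht
  refine eLpNorm_congr_ae ?_
  rw [ouOp_of_nonneg e (le_of_lt ht), chaosOp_toLp, ← MemLp.toLp_sub, ← MemLp.toLp_const_smul]
  filter_upwards [ou_ae_eq_chaosCoef e ht h.memLp.1, (((memLp_chaosCoef e (le_of_lt ht) none
    h.memLp).sub h.memLp).const_smul t⁻¹).coeFn_toLp] with x h1 h2
  rw [Pi.sub_apply, h2, h1]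
  rfl

omit [Countable ι] in
lemma tendsto_ouVar_div (k : ι) : Tendsto (fun t => ouVar eig t k / t) (𝓝[>] 0) (𝓝 1) := by
  have hk := hs.out.pos k
  have h1 : HasDerivAt (fun t => ouVar eig t k) 1 0 := by
    have h2 : HasDerivAt (fun t : ℝ => -(2 * eig k * t)) (-(2 * eig k)) 0 := by
      convert! ((hasDerivAt_id (0 : ℝ)).const_mul (2 * eig k)).neg using 1
      simp
    have h3 := (h2.exp.const_sub 1).div_const (2 * eig k)
    convert! h3 using 1
    simp only [mul_zero, neg_zero, Real.exp_zero, one_mul, neg_neg]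
    field_simp
  have h4 := h1.tendsto_slope_zero_right
  refine h4.congr fun t => ?_
  simp [ouVar, div_eq_inv_mul]

/-- The Dirichlet form controls the gradient. -/
lemma sum_norm_sq_le_energy (e : HilbertBasis ι ℝ H) {φ ψ : Lp ℝ 2 (invMeasure e eig)}
    {g : ι → Lp ℝ 2 (invMeasure e eig)}
    (hgen : Tendsto (fun t : ℝ => t⁻¹ • (ouOp e eig t φ - φ)) (𝓝[>] 0) (𝓝 ψ))
    (hibp : ∀ (t : ℝ) (ht : 0 ≤ t) (k : ι),
      chaosOp e eig ht (some k) φ = √(ouVar eig t k) • chaosOp e eig ht none (g k))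
    (F : Finset ι) : ∑ k ∈ F, ‖g k‖ ^ 2 ≤ -2 * inner ℝ ψ φ := by
  classical
  have h1 : Tendsto (fun t => ∑ k ∈ F, ouVar eig t k / t * ‖ouOp e eig t (g k)‖ ^ 2) (𝓝[>] 0)
      (𝓝 (∑ k ∈ F, 1 * ‖g k‖ ^ 2)) :=
    tendsto_finsetSum F fun k _ => (tendsto_ouVar_div k).mul ((tendsto_ouOp e (g k)).norm.pow 2)
  -- The inner product is the factored form of t⁻¹(‖φ‖² - ‖R_tφ‖²) = -t⁻¹⟨R_tφ - φ, R_tφ + φ⟩, with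
  -- limit -2⟨ψ, φ⟩.
  have h2 : Tendsto (fun t : ℝ => -inner ℝ (t⁻¹ • (ouOp e eig t φ - φ)) (ouOp e eig t φ + φ))
      (𝓝[>] 0) (𝓝 (-inner ℝ ψ (φ + φ))) :=
    (hgen.inner ((tendsto_ouOp e φ).add_const φ)).neg
  have h3 := le_of_tendsto_of_tendsto h1 h2 ?_
  · simp only [one_mul, inner_add_right] at h3
    linarith
  filter_upwards [self_mem_nhdsWithin] with t ht
  have ht' : (0 : ℝ) < t := ht
  -- The index `none` contributes ‖R_tφ‖²; by `hibp` each `some k` contributes q_k(t)‖R_t g_k‖², and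
  -- q_k(t)/t → 1.
  have hb := sum_norm_chaosOp_sq_le e ht'.le
    (Finset.cons none (F.map Function.Embedding.some) (by simp)) φ
  rw [Finset.sum_cons, Finset.sum_map] at hb
  simp only [Function.Embedding.some_apply, hibp t ht'.le, norm_smul, mul_pow,
    Real.norm_of_nonneg (Real.sqrt_nonneg _), Real.sq_sqrt (ouVar_nonneg hs.out ht'.le _),
    ← ouOp_of_nonneg e ht'.le] at hb
  rw [real_inner_smul_left, inner_sub_left, inner_add_right, inner_add_right,
    real_inner_self_eq_norm_sq, real_inner_self_eq_norm_sq, real_inner_comm φ]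
  have e1 : ∑ k ∈ F, ouVar eig t k / t * ‖ouOp e eig t (g k)‖ ^ 2 =
      t⁻¹ * ∑ k ∈ F, ouVar eig t k * ‖ouOp e eig t (g k)‖ ^ 2 := by
    rw [Finset.mul_sum]
    refine Finset.sum_congr rfl fun k _ => ?_
    ring
  rw [e1, ← mul_neg]
  refine mul_le_mul_of_nonneg_left ?_ (inv_nonneg.2 ht'.le)
  linarith

omit hs [BorelSpace H] [CompleteSpace H] in
lemma integral_norm_sq_le (e : HilbertBasis ι ℝ H) {μ : Measure H} {D : H → H}
    (hD : MemLp D 2 μ) {S : ℝ}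
    (hS : ∀ F : Finset ι, ∑ k ∈ F, ∫ x, inner ℝ (e k) (D x) ^ 2 ∂μ ≤ S) :
    ∫ x, ‖D x‖ ^ 2 ∂μ ≤ S := by
  have hi : ∀ k, Integrable (fun x => inner ℝ (e k) (D x) ^ 2) μ := fun k =>
    (hD.const_inner (e k)).integrable_sq
  have h0 : ∀ k, 0 ≤ ∫ x, inner ℝ (e k) (D x) ^ 2 ∂μ := fun k =>
    integral_nonneg fun x => sq_nonneg _
  have hsum : Summable fun k => ∫ x, inner ℝ (e k) (D x) ^ 2 ∂μ := summable_of_sum_le h0 hS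
  have h1 := integral_tsum_of_summable_integral_norm hi
    (by simpa only [Real.norm_of_nonneg (sq_nonneg _)] using hsum)
  simp_rw [(hasSum_inner_sq e _).tsum_eq] at h1
  rw [← h1]
  exact hsum.tsum_le_of_sum_le hS

variable [SecondCountableTopology H]

/-- Uniqueness for the Kolmogorov equation in `D(L₂)`. -/
lemma IsKolmogorovSolution.ae_eq {e : HilbertBasis ι ℝ H} {lam M : ℝ} {B : H → H} {f v v' : H → ℝ}
    (hM : ∀ᵐ x ∂(invMeasure e eig), ‖B x‖ ≤ M) (hlam : M ^ 2 / 2 < lam)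
    (hv : IsKolmogorovSolution e eig lam B f v) (hv' : IsKolmogorovSolution e eig lam B f v') :
    v =ᵐ[invMeasure e eig] v' := by
  obtain ⟨Lv, G, hgen, hsob, heq⟩ := hv
  obtain ⟨Lv', G', hgen', hsob', heq'⟩ := hv'
  have hM0 : 0 ≤ M := by
    obtain ⟨x, hx⟩ := hM.exists
    exact (norm_nonneg _).trans hx
  set φ := hgen.memLp.toLp - hgen'.memLp.toLp with hφ
  set ψ := hgen.memLp_value.toLp - hgen'.memLp_value.toLp with hψ
  have hD : MemLp (fun x => G x - G' x) 2 (invMeasure e eig) := hsob.memLp_grad.sub hsob'.memLp_grad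
  set g : ι → Lp ℝ 2 (invMeasure e eig) := fun k => (memLp_inner_basis e hD k).toLp with hg
  have hgk : ∀ k, g k = (memLp_inner_basis e hsob.memLp_grad k).toLp -
      (memLp_inner_basis e hsob'.memLp_grad k).toLp := by
    intro k
    rw [hg, ← MemLp.toLp_sub]
    refine (MemLp.toLp_eq_toLp_iff _ _).2 (ae_of_all _ fun x => ?_)
    simp [inner_sub_right]
  have hE := sum_norm_sq_le_energy e (φ := φ) (ψ := ψ) (g := g)
    ((hgen.tendsto_ouOp.sub hgen'.tendsto_ouOp).congr fun t => by
      rw [hφ, map_sub, ← smul_sub]; congr 1; abel)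
    (fun t ht k => by
      rw [hφ, hgk, map_sub, map_sub, smul_sub, chaosOp_some_of_isSobolevGradient e ht k hsob,
        chaosOp_some_of_isSobolevGradient e ht k hsob'])
  simp only [hg, norm_toLp_sq] at hE
  set S := -2 * inner ℝ ψ φ with hSdef
  have hS := integral_norm_sq_le e hD hE
  have hS0 : 0 ≤ S := (integral_nonneg fun x => sq_nonneg _).trans hS
  set β := lam • φ - ψ with hβ
  have hβ_ae : ∀ᵐ x ∂(invMeasure e eig), β x = inner ℝ (B x) (G x - G' x) := by
    filter_upwards [heq, heq', Lp.coeFn_sub (lam • φ) ψ, Lp.coeFn_smul lam φ,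
      Lp.coeFn_sub hgen.memLp.toLp hgen'.memLp.toLp, hgen.memLp.coeFn_toLp,
      hgen'.memLp.coeFn_toLp, Lp.coeFn_sub hgen.memLp_value.toLp hgen'.memLp_value.toLp,
      hgen.memLp_value.coeFn_toLp, hgen'.memLp_value.coeFn_toLp]
      with x h1 h2 h3 h4 h5 h6 h7 h8 h9 h10
    rw [hβ, h3, Pi.sub_apply, h4, Pi.smul_apply, h5, h8, Pi.sub_apply, Pi.sub_apply, h6, h7, h9, h10,
      inner_sub_right, smul_eq_mul]
    linarith
  have hβn : ‖β‖ ^ 2 ≤ M ^ 2 * S := by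
    have h1 := norm_toLp_sq (Lp.memLp β)
    rw [Lp.toLp_coeFn] at h1
    rw [h1]
    refine le_trans ?_ (mul_le_mul_of_nonneg_left hS (sq_nonneg M))
    rw [← integral_const_mul]
    refine integral_mono_ae (Lp.memLp β).integrable_sq (hD.integrable_norm_pow two_ne_zero |>.const_mul _) ?_
    filter_upwards [hβ_ae, hM] with x h2 h3
    rw [h2, ← sq_abs, ← mul_pow]
    gcongr
    exact (abs_real_inner_le_norm _ _).trans (by gcongr)
  have hβs : ‖β‖ ≤ M * √S := by
    refine le_of_sq_le_sq ?_ (by positivity)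
    rw [mul_pow, Real.sq_sqrt hS0]
    exact hβn
  have hmain : lam * ‖φ‖ ^ 2 = -(S / 2) + inner ℝ β φ := by
    rw [hβ, inner_sub_left, real_inner_smul_left, real_inner_self_eq_norm_sq, hSdef]
    ring
  have hip : inner ℝ β φ ≤ M * √S * ‖φ‖ :=
    (real_inner_le_norm β φ).trans (by gcongr)
  -- By Young, M√S‖φ‖ ≤ S/2 + M²‖φ‖²/2; the energy term -S/2 cancels the first part and leaves (λ -
  -- M²/2)‖φ‖² ≤ 0.
  have hφ0 : ‖φ‖ ^ 2 ≤ 0 := by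
    have h1 := Real.sq_sqrt hS0
    have h2 := sq_nonneg (√S - M * ‖φ‖)
    by_contra hcon
    push Not at hcon
    have h3 := mul_pos (sub_pos.2 hlam) hcon
    nlinarith
  have hφz : φ = 0 := by
    rw [← norm_eq_zero]
    nlinarith [norm_nonneg φ]
  exact (MemLp.toLp_eq_toLp_iff hgen.memLp hgen'.memLp).1 (sub_eq_zero.1 hφz)

end Energy

/-! #### The resolvent takes values in the domain of the generator -/

section ResolventGenerator

lemma eLpNorm_two_sq {Ω E : Type*} [MeasurableSpace Ω] [NormedAddCommGroup E] (μ : Measure Ω)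
    (f : Ω → E) : eLpNorm f 2 μ ^ 2 = ∫⁻ ω, ‖f ω‖ₑ ^ 2 ∂μ := by
  have := eLpNorm_nnreal_pow_eq_lintegral (f := f) (μ := μ) (p := 2) two_ne_zero
  simpa using this

/-- Averages of functions in a ball of `L²` stay in that ball. -/
lemma eLpNorm_average_le {Ω : Type*} [MeasurableSpace Ω] {μ : Measure Ω} [SFinite μ]
    {h : ℝ → Ω → ℝ} (hm : StronglyMeasurable (Function.uncurry h)) {s : ℝ} (hs : 0 < s) {η : ℝ≥0∞}
    (hη : ∀ r, 0 < r → r ≤ s → eLpNorm (h r) 2 μ ≤ η) :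
    eLpNorm (fun ω => s⁻¹ * ∫ r in Set.Ioc 0 s, h r ω) 2 μ ≤ η := by
  set ν : Measure ℝ := ENNReal.ofReal s⁻¹ • volume.restrict (Set.Ioc 0 s) with hν
  have hprob : IsProbabilityMeasure ν := by
    constructor
    rw [hν, Measure.smul_apply, Measure.restrict_apply .univ, Set.univ_inter, Real.volume_Ioc,
      sub_zero, smul_eq_mul, ← ENNReal.ofReal_mul (by positivity), inv_mul_cancel₀ hs.ne',
      ENNReal.ofReal_one]
  -- The average is an integral against the probability measure ν, where the L¹ norm is at most the
  -- L² norm; Tonelli then exchanges r and ω.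
  have h1 : ∀ ω, ‖s⁻¹ * ∫ r in Set.Ioc 0 s, h r ω‖ₑ ^ 2 ≤ ∫⁻ r, ‖h r ω‖ₑ ^ 2 ∂ν := by
    intro ω
    have e1 : s⁻¹ * ∫ r in Set.Ioc 0 s, h r ω = ∫ r, h r ω ∂ν := by
      rw [hν, integral_smul_measure, ENNReal.toReal_ofReal (by positivity), smul_eq_mul]
    have hmω : StronglyMeasurable fun r => h r ω :=
      hm.comp_measurable (measurable_id.prodMk measurable_const)
    rw [e1, ← eLpNorm_two_sq]
    gcongr
    refine (enorm_integral_le_lintegral_enorm _).trans ?_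
    rw [← eLpNorm_one_eq_lintegral_enorm]
    exact eLpNorm_le_eLpNorm_of_exponent_le (by norm_num) hmω.aestronglyMeasurable
  refine (ENNReal.pow_le_pow_left_iff two_ne_zero).1 ?_
  rw [eLpNorm_two_sq]
  refine (lintegral_mono h1).trans ?_
  rw [lintegral_lintegral_swap]
  · simp_rw [← eLpNorm_two_sq]
    calc ∫⁻ r, eLpNorm (h r) 2 μ ^ 2 ∂ν ≤ ∫⁻ _, η ^ 2 ∂ν := by
          refine lintegral_mono_ae ?_
          have : ∀ᵐ r ∂ν, r ∈ Set.Ioc 0 s :=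
            Measure.ae_smul_measure (ae_restrict_mem measurableSet_Ioc) _
          filter_upwards [this] with r hr
          gcongr
          exact hη r hr.1 hr.2
      _ = η ^ 2 := by simp
  · have : Measurable fun p : Ω × ℝ => ‖h p.2 p.1‖ₑ ^ 2 :=
      ((hm.comp_measurable measurable_swap).enorm).pow_const 2
    exact this.aemeasurable

lemma setIntegral_Ioi_add (F : ℝ → ℝ) (s : ℝ) :
    ∫ t in Set.Ioi 0, F (t + s) = ∫ t in Set.Ioi s, F t := by
  rw [← integral_indicator measurableSet_Ioi, ← integral_indicator measurableSet_Ioi,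
    ← integral_add_right_eq_self ((Set.Ioi s).indicator F) s]
  congr 1
  ext t
  simp [Set.indicator_apply]

variable {ι : Type*} {H : Type*} [NormedAddCommGroup H] [InnerProductSpace ℝ H] [CompleteSpace H]
  [Countable ι] [MeasurableSpace H] [BorelSpace H] {eig : ι → ℝ} [hs : Fact (IsSpectrum eig)]

lemma chaosCoef_none_eq_ou (e : HilbertBasis ι ℝ H) {t : ℝ} (ht : 0 ≤ t) {f : H → ℝ}
    (hf : StronglyMeasurable f) (x : H) : chaosCoef e eig t none f x = ou e eig t f x := by
  rw [ou_eq_integral e hs.out ht hf]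
  simp [chaosCoef, chaosFun]

omit [CompleteSpace H] [Countable ι] [MeasurableSpace H] [BorelSpace H] hs in
lemma norm_chaosCoef_none_le (e : HilbertBasis ι ℝ H) {f : H → ℝ} {K : ℝ} (hK : ∀ x, ‖f x‖ ≤ K)
    (t : ℝ) (x : H) : ‖chaosCoef e eig t none f x‖ ≤ K := by
  simp only [chaosCoef, chaosFun, one_mul]
  simpa using norm_integral_le_of_norm_le_const (μ := gaussianProd ι) (ae_of_all _ fun ξ => hK _)

omit hs in
lemma stronglyMeasurable_chaosCoef_none (e : HilbertBasis ι ℝ H) {f : H → ℝ}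
    (hf : StronglyMeasurable f) :
    StronglyMeasurable fun p : ℝ × H => chaosCoef e eig p.1 none f p.2 := by
  simp only [chaosCoef, chaosFun, one_mul]
  refine StronglyMeasurable.integral_prod_right (ν := gaussianProd ι)
    (f := fun (p : ℝ × H) ξ => f (ouPoint e eig p.1 p.2 ξ)) ?_
  exact hf.comp_measurable (measurable_ouPoint_uncurry e eig)

lemma integral_chaosCoef_none_ouPoint (e : HilbertBasis ι ℝ H) {s t : ℝ} (hs0 : 0 ≤ s)
    (ht : 0 ≤ t) {f : H → ℝ} {K : ℝ} (hf : StronglyMeasurable f) (hK : ∀ x, ‖f x‖ ≤ K) (x : H) :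
    ∫ ξ, chaosCoef e eig t none f (ouPoint e eig s x ξ) ∂(gaussianProd ι) =
      chaosCoef e eig (t + s) none f x := by
  have hmeas : Measurable fun p : (ι → ℝ) × (ι → ℝ) =>
      ouPoint e eig t (ouPoint e eig s x p.1) p.2 :=
    (measurable_ouPoint_prod e eig t).comp
      (((measurable_ouPoint e eig s x).comp measurable_fst).prodMk measurable_snd)
  simp only [chaosCoef, chaosFun, one_mul]
  rw [← integral_map (measurable_ouPoint e eig (t + s) x).aemeasurable hf.aestronglyMeasurable,
    ← map_ouPoint_ouPoint e hs.out hs0 ht x,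
    integral_map hmeas.aemeasurable hf.aestronglyMeasurable, integral_prod]
  exact (memLp_of_bound (hf.comp_measurable hmeas).aestronglyMeasurable (fun _ => hK _) 1).integrable
    le_rfl

lemma resolvent_eq_chaosCoef (e : HilbertBasis ι ℝ H) {f : H → ℝ} (hf : StronglyMeasurable f)
    (lam : ℝ) (x : H) : resolvent e eig lam f x =
      ∫ t in Set.Ioi 0, Real.exp (-(lam * t)) * chaosCoef e eig t none f x := by
  refine setIntegral_congr_fun measurableSet_Ioi fun t ht => ?_
  rw [chaosCoef_none_eq_ou e (le_of_lt ht) hf, smul_eq_mul]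

lemma integrableOn_exp_mul_chaosCoef (e : HilbertBasis ι ℝ H) {lam : ℝ} (hlam : 0 < lam)
    {f : H → ℝ} {K : ℝ} (hf : StronglyMeasurable f) (hK : ∀ x, ‖f x‖ ≤ K) (x : H) :
    IntegrableOn (fun t => Real.exp (-(lam * t)) * chaosCoef e eig t none f x) (Set.Ioi 0) := by
  refine (integrableOn_ou e hs.out hlam hf hK x).congr_fun (fun t ht => ?_) measurableSet_Ioi
  beta_reduce
  rw [chaosCoef_none_eq_ou e (le_of_lt ht) hf, smul_eq_mul]

/-- Chapman–Kolmogorov and the substitution t ↦ t + s turn the left side into e^{λs} times the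
integral of e^{-λt}R_t f over (s, ∞). -/
lemma ou_resolvent (e : HilbertBasis ι ℝ H) {lam : ℝ} (hlam : 0 < lam) {f : H → ℝ} {K : ℝ}
    (hf : StronglyMeasurable f) (hK : ∀ x, ‖f x‖ ≤ K) {s : ℝ} (hs0 : 0 ≤ s) (x : H) :
    ou e eig s (resolvent e eig lam f) x = Real.exp (lam * s) * (resolvent e eig lam f x -
      ∫ r in Set.Ioc 0 s, Real.exp (-(lam * r)) * chaosCoef e eig r none f x) := by
  have hJ := stronglyMeasurable_chaosCoef_none (eig := eig) e hf
  have hres : resolvent e eig lam f =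
      fun x => ∫ t in Set.Ioi 0, Real.exp (-(lam * t)) * chaosCoef e eig t none f x :=
    funext (resolvent_eq_chaosCoef e hf lam)
  have hresm : StronglyMeasurable (resolvent e eig lam f) := by
    rw [hres]
    refine StronglyMeasurable.integral_prod_right (ν := volume.restrict (Set.Ioi 0))
      (f := fun x t => Real.exp (-(lam * t)) * chaosCoef e eig t none f x) ?_
    exact StronglyMeasurable.mul (Measurable.stronglyMeasurable (by fun_prop))
      (hJ.comp_measurable measurable_swap)
  rw [ou_eq_integral e hs.out hs0 hresm]
  simp_rw [resolvent_eq_chaosCoef e hf lam]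
  rw [integral_integral_swap]
  · have h1 : ∀ t ∈ Set.Ioi (0 : ℝ), ∫ ξ, Real.exp (-(lam * t)) *
        chaosCoef e eig t none f (ouPoint e eig s x ξ) ∂(gaussianProd ι) =
        Real.exp (lam * s) * (Real.exp (-(lam * (t + s))) * chaosCoef e eig (t + s) none f x) := by
      intro t ht
      rw [integral_const_mul, integral_chaosCoef_none_ouPoint e hs0 (le_of_lt ht) hf hK,
        ← mul_assoc, ← Real.exp_add]
      congr 2; ring
    rw [setIntegral_congr_fun measurableSet_Ioi h1, integral_const_mul,
      setIntegral_Ioi_add (fun r => Real.exp (-(lam * r)) * chaosCoef e eig r none f x) s]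
    congr 1
    have hI := integrableOn_exp_mul_chaosCoef (eig := eig) e hlam hf hK x
    rw [← Set.Ioc_union_Ioi_eq_Ioi hs0, setIntegral_union (Set.Ioc_disjoint_Ioi le_rfl)
      measurableSet_Ioi (hI.mono_set Set.Ioc_subset_Ioi_self)
      (hI.mono_set (Set.Ioi_subset_Ioi hs0))]
    ring
  · have hb : Integrable (fun p : (ι → ℝ) × ℝ => (1 : ℝ) * (Real.exp (-(lam * p.2)) * K))
        ((gaussianProd ι).prod (volume.restrict (Set.Ioi 0))) := by
      refine Integrable.mul_prod (f := fun _ => (1 : ℝ))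
        (g := fun r => Real.exp (-(lam * r)) * K) (integrable_const _) ?_
      have := (integrableOn_exp_mul_rpow hlam zero_lt_one).mul_const K
      simpa using this
    refine hb.mono' ?_ (ae_of_all _ fun p => ?_)
    · refine StronglyMeasurable.aestronglyMeasurable ?_
      refine StronglyMeasurable.mul (Measurable.stronglyMeasurable (by fun_prop)) ?_
      exact hJ.comp_measurable
        (measurable_snd.prodMk ((measurable_ouPoint e eig s x).comp measurable_fst))
    · rw [Function.uncurry, one_mul, norm_mul, Real.norm_of_nonneg (Real.exp_pos _).le]
      gcongr
      exact norm_chaosCoef_none_le e hK _ _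

lemma tendsto_eLpNorm_chaosCoef_none (e : HilbertBasis ι ℝ H) {f : H → ℝ}
    (hf : MemLp f 2 (invMeasure e eig)) :
    Tendsto (fun r => eLpNorm (fun x => chaosCoef e eig r none f x - f x) 2 (invMeasure e eig))
      (𝓝[>] 0) (𝓝 0) := by
  refine ((Lp.tendsto_Lp_iff_tendsto_eLpNorm _ _ hf).1 (tendsto_ouOp e hf.toLp)).congr' ?_
  filter_upwards [self_mem_nhdsWithin] with r hr
  refine eLpNorm_congr_ae ?_
  rw [ouOp_of_nonneg e (le_of_lt hr), chaosOp_toLp]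
  filter_upwards [(memLp_chaosCoef e (le_of_lt hr) none hf).coeFn_toLp] with x hx
  rw [Pi.sub_apply, hx]

/-- The difference quotient of the semigroup at a resolvent. -/
lemma ou_resolvent_sub_div (e : HilbertBasis ι ℝ H) {lam : ℝ} (hlam : 0 < lam) {f : H → ℝ} {K : ℝ}
    (hf : StronglyMeasurable f) (hK : ∀ x, ‖f x‖ ≤ K) {s : ℝ} (hs0 : 0 < s) (x : H) :
    s⁻¹ * (ou e eig s (resolvent e eig lam f) x - resolvent e eig lam f x) -
        (lam * resolvent e eig lam f x - f x) =
      (s⁻¹ * (Real.exp (lam * s) - 1) - lam) * resolvent e eig lam f x -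
        s⁻¹ * ∫ r in Set.Ioc 0 s, (Real.exp (lam * (s - r)) * chaosCoef e eig r none f x - f x) := by
  have hI := (integrableOn_exp_mul_chaosCoef (eig := eig) e hlam hf hK x).mono_set
    (show Set.Ioc 0 s ⊆ Set.Ioi 0 from Set.Ioc_subset_Ioi_self)
  have h1 : ∫ r in Set.Ioc 0 s, (Real.exp (lam * (s - r)) * chaosCoef e eig r none f x - f x) =
      Real.exp (lam * s) * (∫ r in Set.Ioc 0 s, Real.exp (-(lam * r)) * chaosCoef e eig r none f x) -
        s * f x := by
    rw [← integral_const_mul, show s * f x = ∫ _ in Set.Ioc 0 s, f x by simp [hs0.le],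
      ← integral_sub (hI.const_mul _) (by simp)]
    refine integral_congr_ae (ae_of_all _ fun r => ?_)
    beta_reduce
    rw [← mul_assoc, ← Real.exp_add]
    congr 3; ring
  rw [ou_resolvent e hlam hf hK hs0.le, h1]
  field_simp
  ring

/-- The resolvent of a bounded function `f` belongs to the domain of the generator. -/
lemma isGeneratorValue_resolvent [SecondCountableTopology H] (e : HilbertBasis ι ℝ H) {lam : ℝ}
    (hlam : 0 < lam) {f : H → ℝ}
    {K : ℝ} (hf : StronglyMeasurable f) (hK : ∀ x, ‖f x‖ ≤ K) :
    IsGeneratorValue e eig (resolvent e eig lam f) fun x => lam * resolvent e eig lam f x - f x := by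
  have hK0 : 0 ≤ K := (norm_nonneg _).trans (hK 0)
  have hC1 := isC1b_resolvent e hs.out hlam hf hK
  have hu : MemLp (resolvent e eig lam f) 2 (invMeasure e eig) := hC1.memLp e
  have hf2 : MemLp f 2 (invMeasure e eig) := memLp_of_bound hf.aestronglyMeasurable hK 2
  have hJ := stronglyMeasurable_chaosCoef_none (eig := eig) e hf
  refine ⟨hu, (hu.const_mul lam).sub hf2, ?_⟩
  -- By `ou_resolvent_sub_div` the error has two parts: c(s) times the resolvent, where c(s) → 0 is
  -- a difference quotient minus its limit, and an average over (0, s] of h, small by strong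
  -- continuity of R_r at 0.
  set c : ℝ → ℝ := fun s => s⁻¹ * (Real.exp (lam * s) - 1) - lam with hc
  set h : ℝ → ℝ → H → ℝ := fun s r x =>
    Real.exp (lam * (s - r)) * chaosCoef e eig r none f x - f x with hh
  have hhm : ∀ s, StronglyMeasurable (Function.uncurry (h s)) := fun s =>
    ((Measurable.stronglyMeasurable (by fun_prop)).mul hJ).sub (hf.comp_measurable measurable_snd)
  have hexp : HasDerivAt (fun s : ℝ => Real.exp (lam * s)) lam 0 := by
    simpa using ((hasDerivAt_id (0 : ℝ)).const_mul lam).exp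
  have hT1 : Tendsto (fun s => eLpNorm (fun x => c s * resolvent e eig lam f x) 2
      (invMeasure e eig)) (𝓝[>] 0) (𝓝 0) := by
    have h1 : Tendsto c (𝓝[>] 0) (𝓝 0) := by
      have := hexp.tendsto_slope_zero_right.sub_const lam
      simpa using this
    have h2 : Tendsto (fun s => ‖c s‖ₑ * eLpNorm (resolvent e eig lam f) 2 (invMeasure e eig))
        (𝓝[>] 0) (𝓝 (‖(0 : ℝ)‖ₑ * eLpNorm (resolvent e eig lam f) 2 (invMeasure e eig))) :=
      ENNReal.Tendsto.mul_const h1.enorm (.inr hu.eLpNorm_ne_top)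
    rw [enorm_zero, zero_mul] at h2
    refine h2.congr fun s => ?_
    rw [← eLpNorm_const_smul (c s) (resolvent e eig lam f) 2 (invMeasure e eig)]
    simp only [Pi.smul_def, smul_eq_mul]
  have hhle : ∀ s r, 0 < r → r ≤ s → eLpNorm (h s r) 2 (invMeasure e eig) ≤
      ENNReal.ofReal ((Real.exp (lam * s) - 1) * K) +
        eLpNorm (fun x => chaosCoef e eig r none f x - f x) 2 (invMeasure e eig) := by
    intro s r hr hrs
    have hm1 : AEStronglyMeasurable (chaosCoef e eig r none f) (invMeasure e eig) :=
      (hJ.comp_measurable (measurable_const.prodMk measurable_id)).aestronglyMeasurable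
    have h1 : h s r = (fun x => (Real.exp (lam * (s - r)) - 1) * chaosCoef e eig r none f x) +
        fun x => chaosCoef e eig r none f x - f x := by
      ext x
      simp only [hh, Pi.add_apply]
      ring
    rw [h1]
    refine (eLpNorm_add_le (hm1.const_mul _) (hm1.sub hf2.1) (by norm_num)).trans ?_
    refine add_le_add ?_ le_rfl
    refine (eLpNorm_le_of_ae_bound (C := (Real.exp (lam * s) - 1) * K)
      (ae_of_all _ fun x => ?_)).trans_eq (by simp)
    have h2 : 0 ≤ Real.exp (lam * (s - r)) - 1 := by
      rw [sub_nonneg]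
      exact Real.one_le_exp (mul_nonneg hlam.le (by linarith))
    rw [norm_mul, Real.norm_of_nonneg h2]
    refine mul_le_mul ?_ (norm_chaosCoef_none_le e hK _ _) (norm_nonneg _) ?_
    · gcongr
      linarith
    · refine h2.trans ?_
      gcongr
      linarith
  have hT2 : Tendsto (fun s => eLpNorm (fun x => s⁻¹ * ∫ r in Set.Ioc 0 s, h s r x) 2
      (invMeasure e eig)) (𝓝[>] 0) (𝓝 0) := by
    rw [ENNReal.tendsto_nhds_zero]
    intro η hη
    have hη2 : 0 < η / 2 := ENNReal.half_pos hη.ne'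
    have h1 : Tendsto (fun s => ENNReal.ofReal ((Real.exp (lam * s) - 1) * K)) (𝓝[>] 0) (𝓝 0) := by
      have : Continuous fun s => ENNReal.ofReal ((Real.exp (lam * s) - 1) * K) :=
        ENNReal.continuous_ofReal.comp (by fun_prop)
      simpa using (this.tendsto 0).mono_left nhdsWithin_le_nhds
    have h2 := ENNReal.tendsto_nhds_zero.1 (tendsto_eLpNorm_chaosCoef_none e hf2) _ hη2
    obtain ⟨a, ha, h2⟩ := mem_nhdsGT_iff_exists_Ioo_subset.1 h2
    filter_upwards [ENNReal.tendsto_nhds_zero.1 h1 _ hη2, Ioo_mem_nhdsGT ha] with s hs1 hs2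
    refine eLpNorm_average_le (hhm s) hs2.1 fun r hr hrs => (hhle s r hr hrs).trans ?_
    rw [← ENNReal.add_halves η]
    exact add_le_add hs1 (h2 ⟨hr, hrs.trans_lt hs2.2⟩)
  have hT := hT1.add hT2
  rw [add_zero] at hT
  refine tendsto_of_tendsto_of_tendsto_of_le_of_le' tendsto_const_nhds hT
    (Eventually.of_forall fun _ => zero_le) ?_
  filter_upwards [self_mem_nhdsWithin] with s hs0
  simp_rw [ou_resolvent_sub_div e hlam hf hK hs0]
  refine eLpNorm_sub_le (hu.1.const_mul _) ?_ (by norm_num)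
  refine StronglyMeasurable.aestronglyMeasurable ?_
  refine StronglyMeasurable.const_mul ?_ _
  exact StronglyMeasurable.integral_prod_right (ν := volume.restrict (Set.Ioc 0 s))
    (f := fun x r => h s r x) ((hhm s).comp_measurable measurable_swap)

end ResolventGenerator

/-! ### The main estimate and the Kolmogorov equation -/

section Main

/-- The terms eig k ^ (-1+δ) tend to 0, so eig k ≥ 1 for all but finitely many k, and there 1/eig k
≤ eig k ^ (-1+δ). -/
lemma StandingAssumption.isSpectrum {ι : Type*} {H : Type*} [NormedAddCommGroup H]
    [InnerProductSpace ℝ H] [CompleteSpace H] {A : H →ₗ.[ℝ] H} {e : HilbertBasis ι ℝ H}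
    {eig : ι → ℝ} {δ : ℝ} (hA : StandingAssumption A e eig δ) : IsSpectrum eig := by
  have hpos : ∀ k, 0 < eig k := by
    intro k
    obtain ⟨y, hy, hAy⟩ := (LinearPMap.mem_graph_iff A).1 (hA.eigen k)
    dsimp only at hy hAy
    have hnorm : ‖e k‖ = 1 := e.orthonormal.1 k
    have hy0 : y ≠ 0 := by
      rintro rfl
      rw [← hy] at hnorm
      simp at hnorm
    have h := hA.negDef y hy0
    rw [hAy, hy, real_inner_smul_left, real_inner_self_eq_norm_sq, hnorm] at h
    linarith
  refine ⟨hpos, Summable.of_norm_bounded_eventually hA.traceClass ?_⟩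
  filter_upwards [hA.traceClass.tendsto_cofinite_zero.eventually (gt_mem_nhds zero_lt_one)] with k hk
  have h1 : 1 ≤ eig k := by
    by_contra! hlt
    exact hk.not_ge (Real.one_le_rpow_of_pos_of_le_one_of_nonpos (hpos k) hlt.le
      (by linarith [hA.delta_lt_one]))
  rw [Real.norm_of_nonneg (inv_nonneg.2 (hpos k).le), ← Real.rpow_neg_one]
  exact Real.rpow_le_rpow_of_exponent_le h1 (by linarith [hA.delta_pos])

lemma expMoment_one_half {lam : ℝ} (hlam : 0 < lam) : expMoment lam (1 / 2) = √Real.pi / √lam := by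
  rw [expMoment_eq hlam (by norm_num), show (1 : ℝ) - 1 / 2 = 1 / 2 by norm_num,
    Real.Gamma_one_half_eq, ← Real.sqrt_eq_rpow, Real.sqrt_div zero_le_one, Real.sqrt_one]
  ring

variable {ι : Type*} {H : Type*} [NormedAddCommGroup H] [InnerProductSpace ℝ H] [CompleteSpace H]
  [Countable ι] [MeasurableSpace H] [BorelSpace H] {eig : ι → ℝ} [hs : Fact (IsSpectrum eig)]

lemma inner_resolvent (e : HilbertBasis ι ℝ H) {lam : ℝ} (hlam : 0 < lam) {g : H → H} {K : ℝ}
    (hg : StronglyMeasurable g) (hK : ∀ x, ‖g x‖ ≤ K) (a x : H) :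
    inner ℝ (resolvent e eig lam g x) a = resolvent e eig lam (fun y => inner ℝ (g y) a) x := by
  simp_rw [real_inner_comm a]
  rw [resolvent, ← integral_inner (integrableOn_ou e hs.out hlam hg hK x)]
  refine setIntegral_congr_fun measurableSet_Ioi fun t ht => ?_
  have := isProbabilityMeasure_transition e hs.out (le_of_lt ht) x
  rw [real_inner_smul_right, smul_eq_mul, ou, ou, integral_inner]
  exact (memLp_of_bound hg.aestronglyMeasurable hK 1).integrable le_rfl

lemma IsC1b.isSobolevGradient [SecondCountableTopology H] (e : HilbertBasis ι ℝ H) {φ : H → ℝ}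
    (hφ : IsC1b φ) : IsSobolevGradient e eig φ (gradient φ) :=
  ⟨hφ.memLp e, hφ.memLp_gradient e, fun _ => φ, fun _ => hφ, by simp, by simp⟩

/-- The coordinates of a solution of the fixed point equation solve the Kolmogorov equation. -/
lemma isKolmogorovSolution_coord [SecondCountableTopology H] (e : HilbertBasis ι ℝ H) {lam : ℝ}
    (hlam : 0 < lam) {B B' : H → H} {M c : ℝ} (hB' : Measurable B') (hM : ∀ x, ‖B' x‖ ≤ M)
    (hBB' : B' =ᵐ[invMeasure e eig] B) {u : H → H} (hu : IsC1b u) (hc : ∀ x, ‖fderiv ℝ u x‖ ≤ c)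
    (hfix : u = resolvent e eig lam (driftFun (fderiv ℝ u) B')) (k : ι) :
    IsKolmogorovSolution e eig lam B (fun x => inner ℝ (B x) (e k))
      fun x => inner ℝ (u x) (e k) := by
  have hg := stronglyMeasurable_driftFun (hu.contDiff.continuous_fderiv one_ne_zero) hB'
  have hK := norm_driftFun_le hc hM
  set f : H → ℝ := fun y => inner ℝ (driftFun (fderiv ℝ u) B' y) (e k) with hf
  have hfm : StronglyMeasurable f := hg.inner stronglyMeasurable_const
  have hfb : ∀ x, ‖f x‖ ≤ (c + 1) * M := fun x =>
    (norm_inner_le_norm _ _).trans (by rw [e.orthonormal.1 k, mul_one]; exact hK x)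
  have hv : (fun x => inner ℝ (u x) (e k)) = resolvent e eig lam f := by
    ext x
    conv_lhs => rw [hfix]
    exact inner_resolvent e hlam hg hK (e k) x
  refine ⟨fun x => lam * inner ℝ (u x) (e k) - f x,
    gradient fun x => inner ℝ (u x) (e k), ?_, ?_, ?_⟩
  · have := isGeneratorValue_resolvent (eig := eig) e hlam hfm hfb
    rw [← hv] at this
    exact this
  · refine IsC1b.isSobolevGradient e ?_
    rw [hv]
    exact isC1b_resolvent e hs.out hlam hfm hfb
  · filter_upwards [hBB'] with x hx
    rw [inner_gradient_coord (hu.contDiff.differentiable one_ne_zero x), hf, ← hx]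
    simp only [driftFun, inner_add_left]
    ring

lemma mildIntegrand_eq (e : HilbertBasis ι ℝ H) {B B' : H → H} (hBB' : B' =ᵐ[invMeasure e eig] B)
    (lam : ℝ) (u : H → H) (x : H) {t : ℝ} (ht : 0 < t) : mildIntegrand e eig lam B u x t =
      Real.exp (-(lam * t)) • ou e eig t (driftFun (fderiv ℝ u) B') x := by
  rw [mildIntegrand, ou_congr_ae e hs.out ht]
  filter_upwards [hBB'] with y hy
  rw [driftFun, hy]

lemma isMildFixedPoint_iff (e : HilbertBasis ι ℝ H) {B B' : H → H}
    (hBB' : B' =ᵐ[invMeasure e eig] B) (lam : ℝ) (u : H → H) :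
    IsMildFixedPoint e eig lam B u ↔ u = resolvent e eig lam (driftFun (fderiv ℝ u) B') := by
  rw [funext_iff]
  refine forall_congr' fun x => ?_
  rw [resolvent, setIntegral_congr_fun measurableSet_Ioi
    fun t ht => mildIntegrand_eq e hBB' lam u x ht]

end Main

end OUDrift

end

/-! ### The main theorem. -/

theorem lemma2p6 {H : Type*} [NormedAddCommGroup H] [InnerProductSpace ℝ H] [CompleteSpace H]
    [TopologicalSpace.SeparableSpace H] [MeasurableSpace H] [BorelSpace H]
    {ι : Type*} [Countable ι]
    (A : H →ₗ.[ℝ] H) (e : HilbertBasis ι ℝ H) (eig : ι → ℝ) (δ : ℝ)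
    (hA : OUDrift.StandingAssumption A e eig δ) (M : ℝ) :
    ∃ (lamTilde c₃ : ℝ) (C : ℝ → ℝ → ℝ), 0 < lamTilde ∧ 0 < c₃ ∧
      ∀ B : H → H, Measurable B → (∃ K : ℝ, ∀ x, ‖B x‖ ≤ K) →
        (∀ᵐ x ∂(OUDrift.invMeasure e eig), ‖B x‖ ≤ M) →
        ∀ lam : ℝ, lamTilde ≤ lam →
          ∃ u : H → H,
            -- existence and uniqueness in `C¹_b(H, H)`
            (OUDrift.IsC1b u ∧
              (∀ x, IntegrableOn (OUDrift.mildIntegrand e eig lam B u x) (Set.Ioi 0)) ∧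
              OUDrift.IsMildFixedPoint e eig lam B u ∧
              ∀ v : H → H, OUDrift.IsC1b v → OUDrift.IsMildFixedPoint e eig lam B v → v = u) ∧
            -- (i)
            (∀ ε : ℝ, 0 ≤ ε → ε < 1 / 2 →
              (∀ x k, gradient (fun y => inner ℝ (u y) (e k)) x ∈ OUDrift.powDomain e eig ε) ∧
              ∀ h : H,
                (∀ x, Summable fun k => inner ℝ (OUDrift.powGrad e eig ε u x k) h • e k) ∧
                Continuous (fun x => OUDrift.powDeriv e eig ε u x h) ∧
                ∀ x, ‖OUDrift.powDeriv e eig ε u x h‖ ≤ C ε lam * ‖h‖) ∧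
            -- (ii)
            (∀ k : ι,
              OUDrift.IsKolmogorovSolution e eig lam B (fun x => inner ℝ (B x) (e k))
                (fun x => inner ℝ (u x) (e k)) ∧
              ∀ v : H → ℝ,
                OUDrift.IsKolmogorovSolution e eig lam B (fun x => inner ℝ (B x) (e k)) v →
                v =ᵐ[OUDrift.invMeasure e eig] fun x => inner ℝ (u x) (e k)) ∧
            -- (iii)
            (∀ x, ‖fderiv ℝ u x‖ ≤ c₃ / Real.sqrt lam) := by
  open OUDrift in
  have : SecondCountableTopology H := UniformSpace.secondCountable_of_separable H
  have hs : Fact (IsSpectrum eig) := ⟨hA.isSpectrum⟩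
  have hpi := Real.pi_gt_three
  -- For λ ≥ 4πM² the quantity 2M√π/√λ is at most 1, which the contraction needs. The factor 2M in
  -- the other constants bounds Du·B + B, and the summands 1 keep the constants positive when M = 0.
  refine ⟨4 * Real.pi * M ^ 2 + 1, 2 * |M| * √Real.pi + 1,
    fun ε lam => 2 * M * expMoment lam (1 / 2 + ε), by positivity, by positivity, ?_⟩
  intro B hB _ hBM lam hle
  have hlam : 0 < lam := lt_of_lt_of_le (by positivity) hle
  have hM0 : 0 ≤ M := by
    obtain ⟨x, hx⟩ := hBM.exists
    exact (norm_nonneg _).trans hx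
  -- The truncated drift is bounded by M everywhere and equals B almost everywhere, so the constants
  -- depend on M and not on the supremum of B.
  set B' : H → H := {x | ‖B x‖ ≤ M}.indicator B with hB'
  have hBm' : Measurable B' := hB.indicator (measurableSet_le hB.norm measurable_const)
  have hBM' : ∀ x, ‖B' x‖ ≤ M := by
    intro x
    by_cases hx : ‖B x‖ ≤ M
    · rwa [hB', Set.indicator_of_mem (show x ∈ {x | ‖B x‖ ≤ M} from hx)]
    · rwa [hB', Set.indicator_of_notMem (show x ∉ {x | ‖B x‖ ≤ M} from hx), norm_zero]
  have hBB' : B' =ᵐ[invMeasure e eig] B := by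
    filter_upwards [hBM] with x hx
    exact Set.indicator_of_mem (show x ∈ {x | ‖B x‖ ≤ M} from hx) B
  have hsmall : 2 * M * expMoment lam (1 / 2) ≤ 1 := by
    rw [expMoment_one_half hlam, ← mul_div_assoc, div_le_one (Real.sqrt_pos.2 hlam)]
    refine Real.le_sqrt_of_sq_le ?_
    rw [mul_pow, Real.sq_sqrt Real.pi_pos.le]
    linarith
  obtain ⟨u, hu, hu1, hfix, huniq⟩ := exists_eq_resolvent e hs.out hlam hBm' hBM' hsmall
  have hg := stronglyMeasurable_driftFun (hu.contDiff.continuous_fderiv one_ne_zero) hBm'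
  have hK : ∀ y, ‖driftFun (fderiv ℝ u) B' y‖ ≤ 2 * M := by
    intro y
    have := norm_driftFun_le hu1 hBM' y
    rwa [one_add_one_eq_two] at this
  refine ⟨u, ⟨hu, fun x => ?_, (isMildFixedPoint_iff e hBB' lam u).2 hfix, fun v hv hvm => ?_⟩,
    fun ε h0 h1 => ?_, fun k => ?_, fun x => ?_⟩
  · exact (integrableOn_ou e hs.out hlam hg hK x).congr_fun
      (fun t ht => (mildIntegrand_eq e hBB' lam u x ht).symm) measurableSet_Ioi
  · exact huniq v hv ((isMildFixedPoint_iff e hBB' lam v).1 hvm)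
  · have hsum : ∀ x h, HasSum (fun k => inner ℝ (powGrad e eig ε u x k) h • e k)
        (resGradL e hs.out hlam h0 h1 hg hK x h) := by
      intro x h
      have := hasSum_powGrad_resolvent e hs.out hlam h0 h1 hg hK x h
      rwa [← hfix] at this
    have hpow : ∀ x h, powDeriv e eig ε u x h = resGradL e hs.out hlam h0 h1 hg hK x h :=
      fun x h => (hsum x h).tsum_eq
    refine ⟨fun x k => ?_, fun h => ⟨fun x => (hsum x h).summable, ?_, fun x => ?_⟩⟩
    · have := gradient_mem_powDomain e hs.out hlam h0 h1 hg hK x k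
      rwa [← hfix] at this
    · simp_rw [hpow]
      exact (continuous_resGradL e hs.out hlam h0 h1 hg hK).clm_apply continuous_const
    · rw [hpow]
      exact ContinuousLinearMap.le_of_opNorm_le _ (norm_resGradL_le e hs.out hlam h0 h1 hg hK x) h
  · have hsol := isKolmogorovSolution_coord e hlam hBm' hBM' hBB' hu hu1 hfix k
    refine ⟨hsol, fun v hv => IsKolmogorovSolution.ae_eq hBM ?_ hv hsol⟩
    -- The uniqueness threshold M²/2 lies below 4πM² + 1.
    nlinarith [sq_nonneg M]
  · have h1 : fderiv ℝ u x = resGradL e hs.out hlam le_rfl one_half_pos hg hK x := by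
      have := hasFDerivAt_resolvent e hs.out hlam hg hK x
      rw [← hfix] at this
      exact this.fderiv
    rw [h1]
    refine (norm_resGradL_le e hs.out hlam le_rfl one_half_pos hg hK x).trans ?_
    rw [add_zero, expMoment_one_half hlam, abs_of_nonneg hM0, ← mul_div_assoc]
    gcongr
    linarith
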